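/- Let $k$ be an algebraically closed field of characteristic $p\ge 3$. Let $A(n)=k[X_1,\dots,X_n]/(X_1^p,\dots,X_n^p)$ with canonical generators $x_1,\dots,x_n$ and partial derivatives $\partial_1,\dots,\partial_n$, and let $W(n)=\operatorname{Der}_k(A(n))$, with $[p]$-map $D\mapsto D^p$. Let $S(n)=\{D\in W(n):\sum_i\partial_i(D(x_i))=0\}$ and $$H(2m)=\Big\{\sum_{i=1}^{2m}f_i\partial_i\in W(2m):\ \sigma(i)\partial_{j'}(f_i)=\sigma(j)\partial_{i'}(f_j)\text{ for all }i,j\Big\},$$ where $\sigma(i)=1,\ i'=i+m$ for $i\le m$ and $\sigma(i)=-1,\ i'=i-m$ for $i>m$. Let $\mathfrak g$ be one of $W(n)$ ($n\ge1$), the derived algebra $S(n)^{(1)}$ ($n\ge3$), or the second derived algebra $H(2m)^{(2)}$ ($m\ge1$), where $p\ge5$ is assumed if $\mathfrak g=W(1)$ or $\mathfrak g=H(2)^{(2)}$. Let $G=\operatorname{Aut}(\mathfrak g)$, and put $\mu(\mathfrak g)=n,\ n-1,\ m$ respectively. For $0\le r\le\mu(\mathfrak g)$ let $z_i=1+x_i$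 if $i\le r$ and $z_i=x_i$ if $i>r$, and let $\mathfrak t_r^{\mathfrak g}\subseteq\mathfrak g$ be the standard torus spanned by the elements $d_1,\dots,d_{\mu(\mathfrak g)}$ with $$d_i=z_i\partial_i,\qquad d_i=z_i\partial_i-x_n\partial_n,\qquad d_i=z_i\partial_i-x_{i'}\partial_{i'}$$ in the three cases respectively. For a semisimple element $s\in\mathfrak g$ (that is, $s\in\operatorname{span}_k\{s^{[p]^j}:j\ge1\}$) let $\operatorname{Ind}(s)=\min\{r:\ 0\le r\le\mu(\mathfrak g),\ G.s\cap\mathfrak t_r^{\mathfrak g}\neq\emptyset\}$, and let $\mathfrak t_r^{\mathfrak g,r}$ be the set of semisimple elements $s\in\mathfrak t_r^{\mathfrak g}$ with $\operatorname{Ind}(s)=r$. For $\psi\in\operatorname{Aut}(A(n))$ (with $n=2m$ in the third case) write $\sigma_\psi(D)=\psi\circ D\circ\psi^{-1}$ for $D\in W(n)$. Let $0\le r\le\mu(\mathfrak g)$ and $d,t\in\mathfrak t_r^{\mathfrak g,r}$. If $d$ and $t$ lie in the same $G$-orbit, then there is an algebra automorphism $\psi$ of $A(n)$ such that $\sigma_\psi$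 restricts to an automorphism of $\mathfrak g$ which lies in the normalizer $N_G(\mathfrak t_r^{\mathfrak g})=\{g\in G: g(\mathfrak t_r^{\mathfrak g})=\mathfrak t_r^{\mathfrak g}\}$ and satisfies $\sigma_\psi(d)=t$. -/

import Mathlib

namespace CartanType

section TruncatedPolynomials

variable (p : ℕ) (k : Type*) [Field k] (ι : Type*)

/-- The ideal `(X_i ^ p : i ∈ ι)` of the polynomial ring. -/
noncomputable def truncIdeal : Ideal (MvPolynomial ι k) :=
  Ideal.span (Set.range fun i : ι => (MvPolynomial.X i : MvPolynomial ι k) ^ p)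

/-- The truncated polynomial ring `A = k[X_i] / (X_i ^ p)` in variables indexed by `ι`. -/
noncomputable abbrev TruncPoly : Type _ := MvPolynomial ι k ⧸ truncIdeal p k ι

/-- The canonical generator `x_i` of `A`. -/
noncomputable def x (i : ι) : TruncPoly p k ι := Ideal.Quotient.mk (truncIdeal p k ι) (MvPolynomial.X i)

/-- The Jacobson-Witt algebra `W = Der_k(A)`, with the commutator bracket. -/
noncomputable abbrev Witt : Type _ := Derivation k (TruncPoly p k ι) (TruncPoly p k ι)

variable {k ι} in
theorem pderiv_mem [CharP k p] (i : ι) {f : MvPolynomial ι k} (hf : f ∈ truncIdeal p k ι) :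
    MvPolynomial.pderiv i f ∈ truncIdeal p k ι := by
  classical
  refine Submodule.span_induction (p := fun f _ => MvPolynomial.pderiv i f ∈ truncIdeal p k ι)
    ?_ ?_ ?_ ?_ hf
  · rintro _ ⟨j, rfl⟩
    simp
  · simp
  · intro a b _ _ ha hb
    rw [map_add]
    exact add_mem ha hb
  · intro a b hb h
    rw [smul_eq_mul, Derivation.leibniz, smul_eq_mul, smul_eq_mul]
    exact add_mem (Ideal.mul_mem_left _ _ h) (Ideal.mul_mem_right _ _ hb)

/-- The partial derivative `∂_i` of `A` with respect to `x_i`: the derivation of `A` induced by the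
formal partial derivative of polynomials. -/
noncomputable def partialD [CharP k p] (i : ι) : Witt p k ι :=
  Derivation.liftOfSurjective (f := Ideal.Quotient.mkₐ k (truncIdeal p k ι))
    (Ideal.Quotient.mkₐ_surjective k _) (d := MvPolynomial.pderiv i) (by
      intro f hf
      have hf' : f ∈ truncIdeal p k ι := Ideal.Quotient.eq_zero_iff_mem.mp hf
      exact Ideal.Quotient.eq_zero_iff_mem.mpr (pderiv_mem p i hf'))

variable {k ι}

theorem partialD_mk [CharP k p] (i : ι) (f : MvPolynomial ι k) :
    partialD p k ι i (Ideal.Quotient.mk (truncIdeal p k ι) f) =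
      Ideal.Quotient.mk (truncIdeal p k ι) (MvPolynomial.pderiv i f) :=
  Derivation.liftOfSurjective_apply (f := Ideal.Quotient.mkₐ k (truncIdeal p k ι))
    (Ideal.Quotient.mkₐ_surjective k _) (d := MvPolynomial.pderiv i) (by
      intro f hf
      have hf' : f ∈ truncIdeal p k ι := Ideal.Quotient.eq_zero_iff_mem.mp hf
      exact Ideal.Quotient.eq_zero_iff_mem.mpr (pderiv_mem p i hf')) f

theorem partialD_x [CharP k p] [DecidableEq ι] (i j : ι) :
    partialD p k ι i (x p k ι j) = if j = i then 1 else 0 := by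
  rw [x, partialD_mk, MvPolynomial.pderiv_X]
  by_cases h : j = i
  · subst h; simp
  · simp [h]

theorem witt_ext {D E : Witt p k ι} (h : ∀ i, D (x p k ι i) = E (x p k ι i)) : D = E := by
  ext a
  obtain ⟨f, rfl⟩ := Ideal.Quotient.mk_surjective a
  induction f using MvPolynomial.induction_on with
  | C c =>
    have hc : (Ideal.Quotient.mk (truncIdeal p k ι)) (MvPolynomial.C c) =
        algebraMap k (TruncPoly p k ι) c := rfl
    rw [hc, Derivation.map_algebraMap, Derivation.map_algebraMap]
  | add f g hf hg => rw [map_add, map_add, map_add, hf, hg]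
  | mul_X f i hf =>
    have hi : (Ideal.Quotient.mk (truncIdeal p k ι)) (MvPolynomial.X i) = x p k ι i := rfl
    rw [map_mul, Derivation.leibniz, Derivation.leibniz, hf, hi, h i]

theorem partialD_comm [CharP k p] (i j : ι) (a : TruncPoly p k ι) :
    partialD p k ι i (partialD p k ι j a) = partialD p k ι j (partialD p k ι i a) := by
  classical
  have h : ⁅partialD p k ι i, partialD p k ι j⁆ = 0 := by
    apply witt_ext
    intro l
    rw [Derivation.commutator_apply, partialD_x, partialD_x]
    split_ifs <;> simp
  have := congrArg (fun D : Witt p k ι => D a) h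
  simpa [Derivation.commutator_apply, sub_eq_zero] using this

theorem witt_sum_apply {α : Type*} (s : Finset α) (F : α → Witt p k ι) (a : TruncPoly p k ι) :
    (∑ i ∈ s, F i) a = ∑ i ∈ s, F i a := by
  have h := map_sum (Derivation.coeFnAddMonoidHom (R := k) (A := TruncPoly p k ι)
    (M := TruncPoly p k ι)) F s
  have h' := congrFun h a
  rw [Finset.sum_apply] at h'
  exact h'

theorem witt_apply [CharP k p] [Fintype ι] (D : Witt p k ι) (a : TruncPoly p k ι) :
    D a = ∑ i, D (x p k ι i) * partialD p k ι i a := by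
  classical
  have h : D = ∑ i, D (x p k ι i) • partialD p k ι i := by
    apply witt_ext
    intro l
    rw [witt_sum_apply]
    simp [partialD_x]
  conv_lhs => rw [h]
  rw [witt_sum_apply]
  simp

end TruncatedPolynomials

section Divergence

variable (p : ℕ) (k : Type*) [Field k] [CharP k p]

/-- The divergence `div(D) = ∑ i, ∂_i (D(x_i))` on `W(n)`. -/
noncomputable def divergence {n : ℕ} (D : Witt p k (Fin n)) : TruncPoly p k (Fin n) :=
  ∑ i, partialD p k (Fin n) i (D (x p k (Fin n) i))

theorem divergence_lie {n : ℕ} (D E : Witt p k (Fin n)) :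
    divergence p k ⁅D, E⁆ = D (divergence p k E) - E (divergence p k D) := by
  have key : ∀ D E : Witt p k (Fin n),
      ∑ i, partialD p k (Fin n) i (D (E (x p k (Fin n) i))) =
        (∑ i, ∑ j, partialD p k (Fin n) i (D (x p k (Fin n) j)) *
          partialD p k (Fin n) j (E (x p k (Fin n) i))) + D (divergence p k E) := by
    intro D E
    rw [divergence, map_sum, ← Finset.sum_add_distrib]
    refine Finset.sum_congr rfl fun i _ => ?_
    rw [witt_apply p D (E (x p k (Fin n) i)),
      witt_apply p D (partialD p k (Fin n) i (E (x p k (Fin n) i))), map_sum,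
      ← Finset.sum_add_distrib]
    refine Finset.sum_congr rfl fun j _ => ?_
    rw [Derivation.leibniz, partialD_comm p j i, smul_eq_mul, smul_eq_mul]
    ring
  have hc := Finset.sum_comm (s := (Finset.univ : Finset (Fin n)))
    (t := (Finset.univ : Finset (Fin n)))
    (f := fun i j => partialD p k (Fin n) i (D (x p k (Fin n) j)) *
          partialD p k (Fin n) j (E (x p k (Fin n) i)))
  have hswap : (∑ i, ∑ j, partialD p k (Fin n) i (D (x p k (Fin n) j)) *
          partialD p k (Fin n) j (E (x p k (Fin n) i))) =
      ∑ i, ∑ j, partialD p k (Fin n) i (E (x p k (Fin n) j)) *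
          partialD p k (Fin n) j (D (x p k (Fin n) i)) := by
    rw [hc]
    refine Finset.sum_congr rfl fun i _ => Finset.sum_congr rfl fun j _ => mul_comm _ _
  have h1 : divergence p k ⁅D, E⁆ =
      (∑ i, partialD p k (Fin n) i (D (E (x p k (Fin n) i)))) -
        ∑ i, partialD p k (Fin n) i (E (D (x p k (Fin n) i))) := by
    rw [divergence, ← Finset.sum_sub_distrib]
    refine Finset.sum_congr rfl fun i _ => ?_
    rw [Derivation.commutator_apply, map_sub]
  rw [h1, key D E, key E D, hswap]
  ring

/-- `S(n)`: the derivations of divergence zero. -/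
noncomputable def specialFull (n : ℕ) : LieSubalgebra k (Witt p k (Fin n)) where
  carrier := {D | divergence p k D = 0}
  add_mem' := by
    intro D E hD hE
    have : divergence p k (D + E) = divergence p k D + divergence p k E := by
      simp [divergence, Finset.sum_add_distrib]
    have hD' : divergence p k D = 0 := hD
    have hE' : divergence p k E = 0 := hE
    change divergence p k (D + E) = 0
    rw [this, hD', hE', add_zero]
  zero_mem' := by simp [divergence]
  smul_mem' := by
    intro c D hD
    have : divergence p k (c • D) = c • divergence p k D := by
      simp [divergence, Finset.smul_sum]
    have hD' : divergence p k D = 0 := hD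
    change divergence p k (c • D) = 0
    rw [this, hD', smul_zero]
  lie_mem' := by
    intro D E hD hE
    have hD' : divergence p k D = 0 := hD
    have hE' : divergence p k E = 0 := hE
    change divergence p k ⁅D, E⁆ = 0
    rw [divergence_lie, hD', hE', map_zero, map_zero, sub_zero]

end Divergence

section Hamiltonian

variable (p : ℕ) (k : Type*) [Field k] [CharP k p]

/-- The `2m` variables of type `H` are indexed by `Fin m ⊕ Fin m`: `inl i` is the (0-based) index
`i` among the first `m`, `inr i` the corresponding index among the last `m`, and `i' = i.swap`.
This is the sign `σ(i)`. -/
def sgn {m : ℕ} : Fin m ⊕ Fin m → k :=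
  Sum.elim (fun _ => 1) (fun _ => -1)

theorem hamiltonian_lie {m : ℕ} {D E : Witt p k (Fin m ⊕ Fin m)}
    (hD : ∀ i j, sgn k i • partialD p k _ j.swap (D (x p k _ i)) =
      sgn k j • partialD p k _ i.swap (D (x p k _ j)))
    (hE : ∀ i j, sgn k i • partialD p k _ j.swap (E (x p k _ i)) =
      sgn k j • partialD p k _ i.swap (E (x p k _ j))) (i j : Fin m ⊕ Fin m) :
    sgn k i • partialD p k _ j.swap (⁅D, E⁆ (x p k _ i)) =
      sgn k j • partialD p k _ i.swap (⁅D, E⁆ (x p k _ j)) := by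
  let T : Witt p k (Fin m ⊕ Fin m) → Witt p k (Fin m ⊕ Fin m) → Fin m ⊕ Fin m → Fin m ⊕ Fin m →
      TruncPoly p k (Fin m ⊕ Fin m) := fun D E i j =>
    ∑ l : Fin m ⊕ Fin m, sgn k l.swap • (partialD p k _ j.swap (D (x p k _ l)) *
      partialD p k _ i.swap (E (x p k _ l.swap)))
  have key : ∀ D E : Witt p k (Fin m ⊕ Fin m),
      (∀ i j, sgn k i • partialD p k _ j.swap (E (x p k _ i)) =
        sgn k j • partialD p k _ i.swap (E (x p k _ j))) → ∀ i j,
      sgn k i • partialD p k _ j.swap (D (E (x p k _ i))) =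
        T D E i j + D (sgn k i • partialD p k _ j.swap (E (x p k _ i))) := by
    intro D E hE i j
    rw [witt_apply p D (E (x p k _ i)), witt_apply p D (sgn k i • _), map_sum, Finset.smul_sum,
      ← Finset.sum_add_distrib]
    refine Finset.sum_congr rfl fun l _ => ?_
    have h := hE i l.swap
    rw [Sum.swap_swap] at h
    rw [Derivation.leibniz, Derivation.map_smul, partialD_comm p l j.swap, smul_add, smul_eq_mul,
      smul_eq_mul, ← mul_smul_comm, ← mul_smul_comm, ← mul_smul_comm, mul_smul_comm (sgn k i)
        (partialD p k _ l (E (x p k _ i))), ← smul_mul_assoc, h]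
    rw [smul_mul_assoc, mul_smul_comm (sgn k l.swap), mul_comm (partialD p k _ i.swap _), add_comm]
  have hT : ∀ i j, T E D i j = - T D E j i := by
    intro i j
    simp only [T]
    rw [← Equiv.sum_comp (Equiv.sumComm (Fin m) (Fin m)), ← Finset.sum_neg_distrib]
    refine Finset.sum_congr rfl fun l _ => ?_
    have hs : sgn k l = - sgn k l.swap := by cases l <;> simp [sgn]
    rw [Equiv.sumComm_apply, Sum.swap_swap, hs, neg_smul, mul_comm]
  simp only [Derivation.commutator_apply, map_sub, smul_sub]
  rw [key D E hE i j, key E D hD i j, key D E hE j i, key E D hD j i, hT i j, hT j i, hD i j,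
    hE i j]
  ring

/-- `H(2m)`: the derivations `∑ f_i ∂_i` (so `f_i = D(x_i)`) such that
`σ(i) ∂_{j'}(f_i) = σ(j) ∂_{i'}(f_j)` for all `i, j`. -/
noncomputable def hamiltonianFull (m : ℕ) : LieSubalgebra k (Witt p k (Fin m ⊕ Fin m)) where
  carrier := {D | ∀ i j, sgn k i • partialD p k _ j.swap (D (x p k _ i)) =
      sgn k j • partialD p k _ i.swap (D (x p k _ j))}
  add_mem' := by
    intro D E hD hE i j
    simp only [Derivation.add_apply, map_add, smul_add]
    rw [hD i j, hE i j]
  zero_mem' := by intro i j; simp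
  smul_mem' := by
    intro c D hD i j
    simp only [Derivation.smul_apply, Derivation.map_smul]
    rw [smul_comm, hD i j, smul_comm]
  lie_mem' := by
    intro D E hD hE
    exact hamiltonian_lie p k hD hE

end Hamiltonian

section Series

variable {k : Type*} [Field k] {L : Type*} [LieRing L] [LieAlgebra k L]

/-- The `j`-th derived algebra `𝔤^(j)` of a Lie subalgebra `𝔤` of `L`, again as a Lie subalgebra
of `L`. -/
def derivedSubalgebra (g : LieSubalgebra k L) (j : ℕ) : LieSubalgebra k L :=
  (LieIdeal.toLieSubalgebra k g (LieAlgebra.derivedSeries k g j)).map g.incl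

end Series

/-- The three families of Lie algebras `W(n)`, `S(n)^(1)`, `H(2m)^(2)`. -/
inductive Family : Type
  | W (n : ℕ)
  | S (n : ℕ)
  | H (m : ℕ)

namespace Family

/-- The set indexing the variables `x_i`. -/
abbrev Index : Family → Type
  | W n => Fin n
  | S n => Fin n
  | H m => Fin m ⊕ Fin m

/-- The range of parameters: `W(n)` with `n ≥ 1`, `S(n)^(1)` with `n ≥ 3`, `H(2m)^(2)` with
`m ≥ 1`, where `p ≥ 5` is required for `W(1)` and `H(2)^(2)`. -/
def Admissible (p : ℕ) : Family → Prop
  | W n => 1 ≤ n ∧ (n = 1 → 5 ≤ p)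
  | S n => 3 ≤ n
  | H m => 1 ≤ m ∧ (m = 1 → 5 ≤ p)

/-- The maximal dimension `μ(𝔤)` of tori: `n`, `n - 1` and `m` respectively. -/
def mu : Family → ℕ
  | W n => n
  | S n => n - 1
  | H m => m

variable (p : ℕ) (k : Type*) [Field k] [CharP k p]

/-- The Lie algebra `𝔤`, as a subalgebra of the algebra of all derivations of `A`. -/
noncomputable def algebra : (c : Family) → LieSubalgebra k (Witt p k c.Index)
  | W _ => ⊤
  | S n => derivedSubalgebra (specialFull p k n) 1
  | H m => derivedSubalgebra (hamiltonianFull p k m) 2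

/-- The derivation `(ε + x_i) ∂_i`, with `ε = 1` if `b` holds and `ε = 0` otherwise. -/
noncomputable def eulerD {ι : Type*} (b : Prop) [Decidable b] (i : ι) : Witt p k ι :=
  (if b then 1 + x p k ι i else x p k ι i) • partialD p k ι i

/-- The basis vectors `d_i` of the `r`-th standard torus. The variables are numbered from `0`, so
the first `r` of them have the numbers `i < r`; for type `S`, `l` is the last index. -/
def torusBasis (r : ℕ) : (c : Family) → Set (Witt p k c.Index)
  | W n => {D | ∃ i : Fin n, D = eulerD p k ((i : ℕ) < r) i}
  | S n => {D | ∃ i l : Fin n, (l : ℕ) + 1 = n ∧ i ≠ l ∧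
      D = eulerD p k ((i : ℕ) < r) i - eulerD p k False l}
  | H m => {D | ∃ i : Fin m, D =
      eulerD p k ((i : ℕ) < r) (Sum.inl i : Fin m ⊕ Fin m) - eulerD p k False (Sum.inr i)}

/-- The standard torus `𝔱_r` of `𝔤`, spanned by the `d_i` (all of which lie in `𝔤`). -/
noncomputable def torus (c : Family) (r : ℕ) : Submodule k (c.algebra p k) :=
  (Submodule.span k (torusBasis p k r c)).comap (c.algebra p k).toSubmodule.subtype

/-- The automorphism group `G` of the Lie algebra `𝔤`. -/
abbrev Aut (c : Family) : Type _ := c.algebra p k ≃ₗ⁅k⁆ c.algebra p k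

/-- The semisimple elements of `𝔤`: those `s` which lie in the span of the iterated `p`-th powers
`s^{[p]^j}`, `j ≥ 1`. The `p`-map of `𝔤` is the `p`-th power of derivations of `A`. -/
def semisimple (c : Family) : Set (c.algebra p k) :=
  {s | ((s : Witt p k c.Index) : Module.End k (TruncPoly p k c.Index)) ∈
    Submodule.span k (Set.range fun j : ℕ =>
      ((s : Witt p k c.Index) : Module.End k (TruncPoly p k c.Index)) ^ p ^ (j + 1))}

/-- The index `min {r : G.s ∩ 𝔱_r ≠ ∅}`, where `0 ≤ r ≤ μ(𝔤)`. -/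
noncomputable def index (c : Family) (s : c.algebra p k) : ℕ :=
  sInf {r | r ≤ c.mu ∧ ∃ g : c.Aut p k, g s ∈ c.torus p k r}

/-- The set `𝔱_r^{𝔤,r}` of semisimple elements of `𝔱_r` whose index is `r`. -/
def torusIndexPart (c : Family) (r : ℕ) : Set (c.algebra p k) :=
  {s | s ∈ c.torus p k r ∧ s ∈ c.semisimple p k ∧ c.index p k s = r}

/-- The normalizer `N_G(𝔱) = {g ∈ G : g(𝔱) = 𝔱}`. -/
def normalizer (c : Family) (t : Submodule k (c.algebra p k)) : Set (c.Aut p k) :=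
  {g | (g : c.algebra p k → c.algebra p k) '' t = t}

/-- `g = σ_ψ` on `𝔤`, i.e. `g(D) = ψ ∘ D ∘ ψ⁻¹` for all `D ∈ 𝔤`. -/
def IsInducedBy (c : Family) (g : c.Aut p k)
    (ψ : TruncPoly p k c.Index ≃ₐ[k] TruncPoly p k c.Index) : Prop :=
  ∀ (D : c.algebra p k) (a : TruncPoly p k c.Index),
    (g D : Witt p k c.Index) a = ψ ((D : Witt p k c.Index) (ψ.symm a))

end Family

end CartanType

/-! Write T(w) = Σ w_i z_i ∂_i. Elements of a standard torus are such T(w), and substitutions by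
monomials in the z_i act linearly on the weights w. Shifted coordinates are units with z_i^p = 1, so
they may be replaced by monomials in each other. Unshifted coordinates may be permuted and
multiplied by such monomials. The point is that an arbitrary Lie algebra automorphism taking d =
T(w) to t = T(w') can be replaced by one of these substitutions. For this, enough invariants must be
read off from the abstract orbit relation.

Independence. If the shifted weights of d satisfied a nontrivial relation over 𝔽_p, a monomial
substitution would make the weight of the last shifted variable vanish, so that d would be conjugate
into the torus with one shift less. Since the index of d is exactly r, its shifted weights are
independent over 𝔽_p (`weightIndependent_witt` and its analogues).

Invariance of the isotropy algebra. Every automorphism of 𝔤 preserves the derivations in 𝔤 that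
stabilize the maximal ideal of A. The sandwich elements, those with (ad c)² = 0, form an
automorphism-stable set inside the isotropy algebra, and a subalgebra containing them but not
contained in the isotropy algebra is all of 𝔤 (`isotropy_invariant`, `le_of_filtration`). For type H
with p = 3 the set is enlarged by elements whose squared adjoint action preserves the sandwich
elements.

Invariants. Let V be the 𝔽_p-span of the shifted weights. An eigenvector of T(w) in A with nonzero
constant term has its eigenvalue in V (`mem_weightGroup_of_eigen`). Hence V consists of the
eigenvalues of ad d on vectors congruent to d modulo the isotropy algebra. For c outside V, the
number of l with c + w_l in V is the dimension of the c-eigenspace modulo its isotropy part. Both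
are preserved, so w and w' have the same V and the same multiplicities of nonzero classes modulo V.

Construction. Therefore some permutation e fixing the shifted indices and some exponents a satisfy
w_i = w'_{e i} + Σ a_ij w'_j, the first term being absent for shifted i. Independence makes the
matrix invertible, and the substitution z_i ↦ x_{e i} z^{a_i}, or z^{a_i} for shifted i, is an
automorphism of A that normalizes the torus and takes d to t. For type S the exponents in the last
row are adjusted so that divergence is preserved. For type H classes are compared up to sign, and
the substitution of the first half of the variables is completed to one preserving the Poisson
bracket. -/

namespace CartanType

set_option linter.unusedSectionVars false

/-! ### The truncated polynomial ring: monomials, order filtration, partial derivatives. -/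

section Basics

variable {p : ℕ} {k : Type*} [Field k] [CharP k p] [Fact p.Prime] {ι : Type*}

/-- The augmentation `A → k` with `x_i ↦ 0`. -/
noncomputable def aug (p : ℕ) (k : Type*) [Field k] [Fact p.Prime] (ι : Type*) :
    TruncPoly p k ι →ₐ[k] k :=
  Ideal.Quotient.liftₐ (truncIdeal p k ι) (MvPolynomial.aeval fun _ => (0 : k)) (by
    intro a ha
    have : truncIdeal p k ι ≤ RingHom.ker (MvPolynomial.aeval (R := k) fun _ : ι => (0 : k)) := by
      rw [truncIdeal, Ideal.span_le]
      rintro _ ⟨i, rfl⟩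
      simp [(Fact.out : p.Prime).ne_zero]
    exact this ha)

@[simp] theorem aug_x (i : ι) : aug p k ι (x p k ι i) = 0 :=
  MvPolynomial.aeval_X (fun _ => (0 : k)) i

instance : Nontrivial (TruncPoly p k ι) := (aug p k ι).toRingHom.domain_nontrivial

instance : CharP (TruncPoly p k ι) p :=
  charP_of_injective_algebraMap (algebraMap k (TruncPoly p k ι)).injective p

theorem x_pow_p (i : ι) : x p k ι i ^ p = 0 := by
  rw [x, ← map_pow, Ideal.Quotient.eq_zero_iff_mem]
  exact Ideal.subset_span ⟨i, rfl⟩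

@[elab_as_elim]
theorem truncPoly_induction {P : TruncPoly p k ι → Prop} (a : TruncPoly p k ι)
    (C : ∀ c : k, P (algebraMap k _ c)) (add : ∀ a b, P a → P b → P (a + b))
    (mul_x : ∀ a i, P a → P (a * x p k ι i)) : P a := by
  obtain ⟨f, rfl⟩ := Ideal.Quotient.mk_surjective a
  induction f using MvPolynomial.induction_on with
  | C c => exact C c
  | add f g hf hg => rw [map_add]; exact add _ _ hf hg
  | mul_X f i hf => rw [map_mul]; exact mul_x _ i hf

/-- Frobenius is additive in characteristic p and kills every x_i. Consequently elements of zero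
augmentation are admissible images of the generators, and elements of nonzero augmentation are
units. -/
theorem pow_p_eq (a : TruncPoly p k ι) : a ^ p = algebraMap k _ (aug p k ι a ^ p) := by
  induction a using truncPoly_induction with
  | C c => simp
  | add a b ha hb => rw [add_pow_char, ha, hb, ← map_add, map_add (aug p k ι), add_pow_char]
  | mul_x a i ha => simp [mul_pow, x_pow_p, (Fact.out : p.Prime).ne_zero]

theorem pow_p_eq_zero {a : TruncPoly p k ι} (h : aug p k ι a = 0) : a ^ p = 0 := by
  simp [pow_p_eq, h, (Fact.out : p.Prime).ne_zero]

theorem pow_eq_zero_of_le' {a : TruncPoly p k ι} (h : aug p k ι a = 0) {n : ℕ} (hn : p ≤ n) :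
    a ^ n = 0 := pow_eq_zero_of_le hn (pow_p_eq_zero h)

theorem algHom_ext_x {B : Type*} [Semiring B] [Algebra k B] {f g : TruncPoly p k ι →ₐ[k] B}
    (h : ∀ i, f (x p k ι i) = g (x p k ι i)) (a : TruncPoly p k ι) : f a = g a := by
  induction a using truncPoly_induction with
  | C c => simp
  | add a b ha hb => simp [ha, hb]
  | mul_x a i ha => simp [ha, h]

/-- Algebra endomorphisms are determined by arbitrary images of the `x_i` in the maximal ideal. -/
theorem exists_algHom (y : ι → TruncPoly p k ι) (hy : ∀ i, aug p k ι (y i) = 0) :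
    ∃ ψ : TruncPoly p k ι →ₐ[k] TruncPoly p k ι, ∀ i, ψ (x p k ι i) = y i := by
  refine ⟨Ideal.Quotient.liftₐ (truncIdeal p k ι) (MvPolynomial.aeval y) ?_, fun i => ?_⟩
  · intro a ha
    have : truncIdeal p k ι ≤ RingHom.ker (MvPolynomial.aeval (R := k) y) := by
      refine Ideal.span_le.mpr ?_
      rintro _ ⟨i, rfl⟩
      simp [pow_p_eq_zero (hy i)]
    exact this ha
  · exact MvPolynomial.aeval_X y i

/-- The monomial `x^γ`. -/
noncomputable def mon (p : ℕ) (k : Type*) [Field k] {ι : Type*} (γ : ι →₀ ℕ) : TruncPoly p k ι :=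
  Ideal.Quotient.mk (truncIdeal p k ι) (MvPolynomial.monomial γ 1)

theorem mon_zero : mon p k (0 : ι →₀ ℕ) = 1 := by
  simp [mon]

theorem mon_add (γ δ : ι →₀ ℕ) : mon p k (γ + δ) = mon p k γ * mon p k δ := by
  rw [mon, mon, mon, ← map_mul, MvPolynomial.monomial_mul, one_mul]

theorem mon_single (i : ι) (n : ℕ) : mon p k (Finsupp.single i n) = x p k ι i ^ n := by
  rw [mon, x, ← map_pow, MvPolynomial.X_pow_eq_monomial]

theorem mon_eq_zero {γ : ι →₀ ℕ} {i : ι} (h : p ≤ γ i) : mon p k γ = 0 := by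
  have : γ = Finsupp.single i p + (γ - Finsupp.single i p) := by
    classical
    ext j
    by_cases hj : i = j
    · subst hj; simp; omega
    · simp [hj]
  rw [this, mon_add, mon_single, x_pow_p, zero_mul]

/-- The largest degree of a nonzero monomial. -/
def topDeg (p : ℕ) (ι : Type*) [Fintype ι] : ℕ := Fintype.card ι * (p - 1)

theorem degree_eq_sum' [Fintype ι] (γ : ι →₀ ℕ) : γ.degree = ∑ i, γ i := Finsupp.degree_eq_sum γ

theorem mon_eq_zero_of_degree [Fintype ι] {γ : ι →₀ ℕ} (h : topDeg p ι < γ.degree) :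
    mon p k γ = 0 := by
  obtain ⟨i, hi⟩ : ∃ i, p ≤ γ i := by
    by_contra! hc
    have : ∑ i, γ i ≤ ∑ _i : ι, (p - 1) := Finset.sum_le_sum fun i _ => by have := hc i; omega
    rw [← degree_eq_sum'] at this
    simp [topDeg] at *
    omega
  exact mon_eq_zero hi

theorem partialD_mon (i : ι) (γ : ι →₀ ℕ) :
    partialD p k ι i (mon p k γ) = (γ i : k) • mon p k (γ - Finsupp.single i 1) := by
  rw [mon, partialD_mk, MvPolynomial.pderiv_monomial, one_mul, mon]
  have : MvPolynomial.monomial (γ - Finsupp.single i 1) (γ i : k) =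
      (γ i : k) • MvPolynomial.monomial (γ - Finsupp.single i 1) 1 := by
    rw [MvPolynomial.smul_monomial, smul_eq_mul, mul_one]
  rw [this]
  rfl

/-- The span of the monomials whose degree lies in `S`. -/
noncomputable def Mon (p : ℕ) (k : Type*) [Field k] (ι : Type*) (S : Set ℕ) :
    Submodule k (TruncPoly p k ι) :=
  Submodule.span k (mon p k '' {γ : ι →₀ ℕ | γ.degree ∈ S})

theorem mon_mem {S : Set ℕ} {γ : ι →₀ ℕ} (h : γ.degree ∈ S) : mon p k γ ∈ Mon p k ι S :=
  Submodule.subset_span ⟨γ, h, rfl⟩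

theorem Mon_mono {S T : Set ℕ} (h : S ⊆ T) : Mon p k ι S ≤ Mon p k ι T :=
  Submodule.span_mono (Set.image_mono fun _ hγ => h hγ)

theorem Mon_le_iff {S : Set ℕ} {N : Submodule k (TruncPoly p k ι)} :
    Mon p k ι S ≤ N ↔ ∀ γ : ι →₀ ℕ, γ.degree ∈ S → mon p k γ ∈ N := by
  rw [Mon, Submodule.span_le]
  constructor
  · exact fun h γ hγ => h ⟨γ, hγ, rfl⟩
  · rintro h _ ⟨γ, hγ, rfl⟩; exact h γ hγ

theorem Mon_univ : Mon p k ι Set.univ = ⊤ := by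
  rw [eq_top_iff]
  intro a _
  obtain ⟨f, rfl⟩ := Ideal.Quotient.mk_surjective a
  induction f using MvPolynomial.induction_on' with
  | monomial γ c =>
    have : Ideal.Quotient.mk (truncIdeal p k ι) (MvPolynomial.monomial γ c) = c • mon p k γ := by
      have h : MvPolynomial.monomial γ c = c • MvPolynomial.monomial γ (1 : k) := by
        rw [MvPolynomial.smul_monomial, smul_eq_mul, mul_one]
      rw [h]; rfl
    rw [this]
    exact Submodule.smul_mem _ _ (mon_mem trivial)
  | add f g hf hg => rw [map_add]; exact add_mem (hf trivial) (hg trivial)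

theorem Mon_mul {S T U : Set ℕ} (h : ∀ s ∈ S, ∀ t ∈ T, s + t ∈ U) {a b : TruncPoly p k ι}
    (ha : a ∈ Mon p k ι S) (hb : b ∈ Mon p k ι T) : a * b ∈ Mon p k ι U := by
  have h1 : Mon p k ι S ≤ (Mon p k ι U).comap (LinearMap.mulRight k b) := by
    rw [Mon_le_iff]
    intro γ hγ
    have h2 : Mon p k ι T ≤ (Mon p k ι U).comap (LinearMap.mulLeft k (mon p k γ)) := by
      rw [Mon_le_iff]
      intro δ hδ
      rw [Submodule.mem_comap, LinearMap.mulLeft_apply, ← mon_add]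
      exact mon_mem (by rw [map_add]; exact h _ hγ _ hδ)
    exact h2 hb
  exact h1 ha

theorem x_mem_Mon (i : ι) : x p k ι i ∈ Mon p k ι {1} := by
  rw [← pow_one (x p k ι i), ← mon_single]
  exact mon_mem (by simp)

theorem one_mem_Mon {S : Set ℕ} (h : 0 ∈ S) : (1 : TruncPoly p k ι) ∈ Mon p k ι S := by
  rw [← mon_zero]; exact mon_mem (by simpa using h)

theorem pow_mem_Mon {a : TruncPoly p k ι} {s : ℕ} (h : a ∈ Mon p k ι {s}) (n : ℕ) :
    a ^ n ∈ Mon p k ι {n * s} := by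
  induction n with
  | zero => rw [pow_zero]; exact one_mem_Mon (by simp)
  | succ n ih =>
    rw [pow_succ]
    refine Mon_mul ?_ ih h
    rintro _ rfl _ rfl
    simp; ring

/-- The filtration of `A` by the powers of its maximal ideal. -/
noncomputable abbrev Fil (p : ℕ) (k : Type*) [Field k] (ι : Type*) (s : ℕ) :
    Submodule k (TruncPoly p k ι) := Mon p k ι (Set.Ici s)

theorem Fil_zero : Fil p k ι 0 = ⊤ := by
  rw [Fil, ← Mon_univ]; congr 1; ext; simp

theorem Fil_anti {s t : ℕ} (h : s ≤ t) : Fil p k ι t ≤ Fil p k ι s :=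
  Mon_mono (Set.Ici_subset_Ici.mpr h)

theorem Fil_mul {s t : ℕ} {a b : TruncPoly p k ι} (ha : a ∈ Fil p k ι s) (hb : b ∈ Fil p k ι t) :
    a * b ∈ Fil p k ι (s + t) :=
  Mon_mul (fun s' hs t' ht => by simp at *; omega) ha hb

theorem Fil_mul_left {s : ℕ} (a : TruncPoly p k ι) {b : TruncPoly p k ι} (hb : b ∈ Fil p k ι s) :
    a * b ∈ Fil p k ι s := by
  have : a ∈ Fil p k ι 0 := by rw [Fil_zero]; trivial
  simpa using Fil_mul this hb

theorem Fil_mul_right {s : ℕ} {a : TruncPoly p k ι} (b : TruncPoly p k ι) (ha : a ∈ Fil p k ι s) :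
    a * b ∈ Fil p k ι s := by
  rw [mul_comm]; exact Fil_mul_left b ha

theorem Fil_eq_bot [Fintype ι] {s : ℕ} (h : topDeg p ι < s) {a : TruncPoly p k ι}
    (ha : a ∈ Fil p k ι s) : a = 0 := by
  have : Fil p k ι s ≤ ⊥ := by
    rw [Mon_le_iff]
    intro γ hγ
    rw [Submodule.mem_bot]
    exact mon_eq_zero_of_degree (lt_of_lt_of_le h hγ)
  exact (Submodule.mem_bot k).mp (this ha)

theorem aug_mon {γ : ι →₀ ℕ} (h : γ ≠ 0) : aug p k ι (mon p k γ) = 0 := by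
  obtain ⟨i, hi⟩ := Finsupp.ne_iff.mp h
  have : γ = Finsupp.single i 1 + (γ - Finsupp.single i 1) := by
    classical
    ext j
    by_cases hj : i = j
    · subst hj; simp at *; omega
    · simp [hj]
  rw [this, mon_add, mon_single]
  simp

theorem mem_Fil_one {a : TruncPoly p k ι} : a ∈ Fil p k ι 1 ↔ aug p k ι a = 0 := by
  have h1 : Fil p k ι 1 ≤ LinearMap.ker (aug p k ι).toLinearMap := by
    rw [Mon_le_iff]
    intro γ hγ
    rw [LinearMap.mem_ker, AlgHom.toLinearMap_apply, aug_mon]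
    rintro rfl
    simp at hγ
  refine ⟨fun h => h1 h, fun h => ?_⟩
  have key : ∀ a : TruncPoly p k ι, a - algebraMap k _ (aug p k ι a) ∈ Fil p k ι 1 := by
    intro a
    induction a using truncPoly_induction with
    | C c => simp
    | add a b ha hb =>
      rw [map_add, map_add, add_sub_add_comm]
      exact add_mem ha hb
    | mul_x a i ha =>
      rw [map_mul, aug_x, mul_zero, map_zero, sub_zero]
      exact Fil_mul_left _ (Mon_mono (by simp) (x_mem_Mon i))
  simpa [h] using key a

theorem partialD_Mon {S T : Set ℕ} (h : ∀ s, s + 1 ∈ S → s ∈ T) (i : ι) {a : TruncPoly p k ι}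
    (ha : a ∈ Mon p k ι S) : partialD p k ι i a ∈ Mon p k ι T := by
  have : Mon p k ι S ≤ (Mon p k ι T).comap (partialD p k ι i).toLinearMap := by
    rw [Mon_le_iff]
    intro γ hγ
    change partialD p k ι i (mon p k γ) ∈ Mon p k ι T
    rw [partialD_mon]
    by_cases h0 : γ i = 0
    · simp [h0]
    · refine Submodule.smul_mem _ _ (mon_mem (h _ ?_))
      have : γ = Finsupp.single i 1 + (γ - Finsupp.single i 1) := by
        classical
        ext j
        by_cases hj : i = j
        · subst hj; simp; omega
        · simp [hj]
      have h2 := congrArg Finsupp.degree this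
      rw [map_add, Finsupp.degree_single] at h2
      rw [add_comm, ← h2]
      exact hγ
  exact this ha

theorem partialD_Fil {s : ℕ} (i : ι) {a : TruncPoly p k ι} (ha : a ∈ Fil p k ι (s + 1)) :
    partialD p k ι i a ∈ Fil p k ι s :=
  partialD_Mon (fun t ht => by simp at *; omega) i ha

theorem deriv_Fil [Fintype ι] {s t : ℕ} {D : Witt p k ι} (hD : ∀ i, D (x p k ι i) ∈ Fil p k ι s)
    {a : TruncPoly p k ι} (ha : a ∈ Fil p k ι (t + 1)) : D a ∈ Fil p k ι (s + t) := by
  rw [witt_apply p D a]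
  exact sum_mem fun i _ => Fil_mul (hD i) (partialD_Fil i ha)

theorem deriv_Fil' [Fintype ι] {s : ℕ} {D : Witt p k ι} (hD : ∀ i, D (x p k ι i) ∈ Fil p k ι s)
    (a : TruncPoly p k ι) : D a ∈ Fil p k ι s := by
  rw [witt_apply p D a]
  exact sum_mem fun i _ => Fil_mul_right _ (hD i)

theorem deriv_Fil_succ [Fintype ι] {t : ℕ} (D : Witt p k ι)
    {a : TruncPoly p k ι} (ha : a ∈ Fil p k ι (t + 1)) : D a ∈ Fil p k ι t := by
  simpa using deriv_Fil (s := 0) (D := D) (fun i => by rw [Fil_zero]; trivial) ha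

/-- Below the top degree, every monomial is a partial derivative of a monomial. -/
theorem mon_eq_partialD [Fintype ι] {γ : ι →₀ ℕ} (h : γ.degree < topDeg p ι)
    :
    ∃ (i : ι) (δ : ι →₀ ℕ) (c : k), δ.degree = γ.degree + 1 ∧ c ≠ 0 ∧ γ i + 1 < p ∧
      δ = γ + Finsupp.single i 1 ∧ partialD p k ι i (mon p k δ) = c • mon p k γ := by
  obtain ⟨i, hi⟩ : ∃ i, γ i < p - 1 := by
    by_contra! hc
    have : ∑ _i : ι, (p - 1) ≤ ∑ i, γ i := Finset.sum_le_sum fun i _ => hc i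
    rw [← degree_eq_sum'] at this
    simp [topDeg] at *
    omega
  refine ⟨i, γ + Finsupp.single i 1, (γ i + 1 : ℕ), by simp, ?_, by omega, rfl, ?_⟩
  · rw [Ne, CharP.cast_eq_zero_iff k p]
    intro hd
    have := Nat.le_of_dvd (by omega) hd
    omega
  · rw [partialD_mon]
    simp

/-- A set that is stable under all partial derivatives and on which the augmentation vanishes
contains no nonzero element. -/
theorem eq_zero_of_partialD_stable {K : Set (TruncPoly p k ι)}
    (hK : ∀ a ∈ K, ∀ i, partialD p k ι i a ∈ K) (h0 : ∀ a ∈ K, aug p k ι a = 0)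
    {a : TruncPoly p k ι} (ha : a ∈ K) : a = 0 := by
  -- The coefficient at a reduced exponent γ is reached by differentiating |γ| times. Each
  -- derivative multiplies it by a number between 1 and p - 1, which is invertible in k.
  have key : ∀ n : ℕ, ∀ γ : ι →₀ ℕ, γ.degree = n → (∀ i, γ i < p) → ∀ F : MvPolynomial ι k,
      Ideal.Quotient.mk (truncIdeal p k ι) F ∈ K → MvPolynomial.coeff γ F = 0 := by
    intro n
    induction n with
    | zero =>
      intro γ hγ _ F hF
      have : γ = 0 := (Finsupp.degree_eq_zero_iff γ).mp hγ
      subst this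
      have := h0 _ hF
      rw [← MvPolynomial.constantCoeff_eq]
      have h2 : aug p k ι (Ideal.Quotient.mk (truncIdeal p k ι) F) =
        MvPolynomial.aeval (fun _ => (0 : k)) F := rfl
      rw [h2] at this
      simpa [MvPolynomial.aeval_zero'] using this
    | succ n ih =>
      intro γ hγ hp F hF
      obtain ⟨i, hi⟩ : ∃ i, γ i ≠ 0 := by
        by_contra! hc
        have : γ = 0 := Finsupp.ext hc
        simp [this] at hγ
      have h1 : γ = (γ - Finsupp.single i 1) + Finsupp.single i 1 := by
        classical
        ext j
        by_cases hj : i = j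
        · subst hj; simp; omega
        · simp [hj]
      have h2 := congrArg Finsupp.degree h1
      rw [map_add, Finsupp.degree_single] at h2
      have h3 := ih (γ - Finsupp.single i 1) (by omega)
        (fun j => lt_of_le_of_lt (by simp) (hp j)) (MvPolynomial.pderiv i F)
        (by rw [← partialD_mk]; exact hK _ hF i)
      rw [MvPolynomial.coeff_pderiv, ← h1] at h3
      refine (mul_eq_zero.mp h3).resolve_right ?_
      have h4 : ((((γ - Finsupp.single i 1 : ι →₀ ℕ) i : ℕ)) : k) + 1 = ((γ i : ℕ) : k) := by
        rw [← Nat.cast_succ]; congr 1; simp; omega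
      rw [h4]
      intro hd
      rw [CharP.cast_eq_zero_iff k p] at hd
      have := Nat.le_of_dvd (by omega) hd
      have := hp i
      omega
  obtain ⟨F, rfl⟩ := Ideal.Quotient.mk_surjective a
  rw [Ideal.Quotient.eq_zero_iff_mem]
  have h1 : truncIdeal p k ι = Ideal.span ((fun s => MvPolynomial.monomial s (1 : k)) ''
      Set.range fun i : ι => Finsupp.single i p) := by
    rw [truncIdeal, ← Set.range_comp]
    congr 2
    ext i
    simp [MvPolynomial.X_pow_eq_monomial]
  rw [h1, MvPolynomial.mem_ideal_span_monomial_image]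
  intro γ hγ
  by_contra! hc
  rw [MvPolynomial.mem_support_iff] at hγ
  refine hγ (key _ γ rfl (fun i => ?_) F ha)
  by_contra! hi
  exact hc _ ⟨i, rfl⟩ (by simpa using hi)

theorem eq_algebraMap_of_partialD_eq_zero {a : TruncPoly p k ι}
    (h : ∀ i, partialD p k ι i a = 0) : a = algebraMap k _ (aug p k ι a) := by
  rw [← sub_eq_zero]
  refine eq_zero_of_partialD_stable (K := {0, a - algebraMap k _ (aug p k ι a)}) ?_ ?_
    (Or.inr rfl)
  · rintro _ (rfl | rfl) i
    · simp
    · left; simp [h]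
  · rintro _ (rfl | rfl) <;> simp

theorem finite_truncPoly [Finite ι] : Module.Finite k (TruncPoly p k ι) := by
  cases nonempty_fintype ι
  have h : Mon p k ι Set.univ ≤ Submodule.span k (Set.range fun γ : ι → Fin p =>
      mon p k (Finsupp.equivFunOnFinite.symm fun i => (γ i : ℕ))) := by
    rw [Mon_le_iff]
    intro γ _
    by_cases h : ∃ i, p ≤ γ i
    · obtain ⟨i, hi⟩ := h
      rw [mon_eq_zero hi]; exact zero_mem _
    · push Not at h
      have hγ : γ = Finsupp.equivFunOnFinite.symm
          (fun i => (((fun i => ⟨γ i, h i⟩ : ι → Fin p) i : Fin p) : ℕ)) := by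
        ext i
        simp
      rw [hγ]
      exact Submodule.subset_span (Set.mem_range_self (fun i => ⟨γ i, h i⟩ : ι → Fin p))
  rw [Mon_univ] at h
  exact Module.finite_def.mpr (Submodule.fg_def.mpr ⟨_, Set.finite_range _, top_le_iff.mp h⟩)

end Basics

/-! ### The isotropy algebra, sandwich elements, and a criterion for invariance. -/

section Isotropy

variable {p : ℕ} {k : Type*} [Field k] [CharP k p] [Fact p.Prime] {ι : Type*} [Fintype ι]

theorem aug_deriv (D : Witt p k ι) (a : TruncPoly p k ι) :
    aug p k ι (D a) = ∑ i, aug p k ι (D (x p k ι i)) * aug p k ι (partialD p k ι i a) := by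
  rw [witt_apply p D a, map_sum]
  exact Finset.sum_congr rfl fun i _ => map_mul _ _ _

/-- The isotropy subalgebra: the derivations that preserve the maximal ideal of `A`. -/
noncomputable def isotropy (p : ℕ) (k : Type*) [Field k] [CharP k p] [Fact p.Prime] (ι : Type*)
    [Fintype ι] : LieSubalgebra k (Witt p k ι) where
  carrier := {D | ∀ i, aug p k ι (D (x p k ι i)) = 0}
  add_mem' := by
    intro D E hD hE i
    rw [Derivation.add_apply, map_add, hD i, hE i, add_zero]
  zero_mem' := by intro i; simp
  smul_mem' := by
    intro c D hD i
    rw [Derivation.smul_apply, map_smul, hD i, smul_zero]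
  lie_mem' := by
    intro D E hD hE i
    have hD' : ∀ i, aug p k ι (D (x p k ι i)) = 0 := hD
    have hE' : ∀ i, aug p k ι (E (x p k ι i)) = 0 := hE
    change aug p k ι (⁅D, E⁆ (x p k ι i)) = 0
    rw [Derivation.commutator_apply, map_sub, aug_deriv D, aug_deriv E]
    simp [hD', hE']

theorem mem_isotropy {D : Witt p k ι} :
    D ∈ isotropy p k ι ↔ ∀ i, aug p k ι (D (x p k ι i)) = 0 := Iff.rfl

/-- The map `D ↦ (D(x_i)(0))_i`. -/
noncomputable def evalZero (p : ℕ) (k : Type*) [Field k] [CharP k p] [Fact p.Prime] (ι : Type*) :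
    Witt p k ι →ₗ[k] (ι → k) where
  toFun D i := aug p k ι (D (x p k ι i))
  map_add' D E := by ext i; simp
  map_smul' c D := by ext i; simp

@[simp] theorem evalZero_apply (D : Witt p k ι) (i : ι) :
    evalZero p k ι D i = aug p k ι (D (x p k ι i)) := rfl

theorem mem_isotropy_iff_evalZero {D : Witt p k ι} : D ∈ isotropy p k ι ↔ evalZero p k ι D = 0 :=
  ⟨fun h => funext h, fun h i => congrFun h i⟩

/-- In the constant term only those products survive in which each of the n derivatives hits a
different factor u. -/
theorem aug_iterate_pow_mul (D : Witt p k ι) {u : TruncPoly p k ι} (hu : aug p k ι u = 0) (n : ℕ) :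
    ∀ g : TruncPoly p k ι, aug p k ι (D^[n] (u ^ n * g)) =
      (n.factorial : k) * aug p k ι (D u) ^ n * aug p k ι g := by
  induction n with
  | zero => intro g; simp
  | succ n ih =>
    intro g
    have h1 : D (u ^ (n + 1) * g) = u ^ n * (((n + 1 : ℕ) : TruncPoly p k ι) * D u * g) +
        u ^ n * (u * D g) := by
      rw [Derivation.leibniz, Derivation.leibniz_pow]
      simp only [smul_eq_mul, nsmul_eq_mul, Nat.add_sub_cancel]
      ring
    have h2 : ∀ a b : TruncPoly p k ι, D^[n] (a + b) = D^[n] a + D^[n] b := fun a b =>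
      iterate_map_add D n a b
    rw [Function.iterate_succ_apply, h1, h2, map_add, ih, ih]
    simp only [map_mul, map_natCast, hu, zero_mul, mul_zero, add_zero]
    rw [Nat.factorial_succ]
    push_cast
    ring

/-- To leading order ad D acts on the coefficients of c simply by D. The correction, c applied to
D(x_i), has the order of c, one more than the leading term. -/
theorem ad_iterate_Fil (D c : Witt p k ι) {s : ℕ} (hc : ∀ i, c (x p k ι i) ∈ Fil p k ι s) :
    ∀ t ≤ s, (∀ i, ((fun y => ⁅D, y⁆)^[t] c) (x p k ι i) ∈ Fil p k ι (s - t)) ∧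
      ∀ i, ((fun y => ⁅D, y⁆)^[t] c) (x p k ι i) - D^[t] (c (x p k ι i)) ∈
        Fil p k ι (s - t + 1) := by
  intro t
  induction t with
  | zero => intro _; exact ⟨by simpa using hc, by simp⟩
  | succ t ih =>
    intro ht
    obtain ⟨h1, h2⟩ := ih (by omega)
    have e : s - t = s - (t + 1) + 1 := by omega
    simp only [Function.iterate_succ_apply']
    generalize (fun y => ⁅D, y⁆)^[t] c = c' at *
    constructor
    · intro i
      rw [Derivation.commutator_apply]
      refine sub_mem (deriv_Fil_succ D (by rw [← e]; exact h1 i)) ?_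
      exact Fil_anti (by omega) (deriv_Fil' h1 _)
    · intro i
      rw [Derivation.commutator_apply, sub_right_comm, ← map_sub, ← e]
      exact sub_mem (deriv_Fil_succ D (h2 i)) (deriv_Fil' h1 _)

theorem evalZero_ad_iterate (D c : Witt p k ι) {s : ℕ} (hc : ∀ i, c (x p k ι i) ∈ Fil p k ι s)
    (i : ι) : evalZero p k ι ((fun y => ⁅D, y⁆)^[s] c) i = aug p k ι (D^[s] (c (x p k ι i))) := by
  have h := (ad_iterate_Fil D c hc s le_rfl).2 i
  rw [Nat.sub_self, mem_Fil_one, map_sub, sub_eq_zero] at h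
  exact h

theorem ad_iterate_mem (M : LieSubalgebra k (Witt p k ι)) {D c : Witt p k ι} (hD : D ∈ M)
    (hc : c ∈ M) (s : ℕ) : (fun y => ⁅D, y⁆)^[s] c ∈ M := by
  induction s with
  | zero => exact hc
  | succ s ih => rw [Function.iterate_succ_apply']; exact M.lie_mem hD ih

/-- The elements `c` of `L` with `(ad c)² = 0` on `L`. -/
def sandwich (L : LieSubalgebra k (Witt p k ι)) : Set (Witt p k ι) :=
  {c | c ∈ L ∧ ∀ y ∈ L, ⁅c, ⁅c, y⁆⁆ = 0}

theorem lie_lie_apply (c y : Witt p k ι) (a : TruncPoly p k ι) :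
    ⁅c, ⁅c, y⁆⁆ a = c (c (y a)) - 2 * c (y (c a)) + y (c (c a)) := by
  simp only [Derivation.commutator_apply, map_sub]
  ring

/-- Evaluate [c, [c, y]] = 0 at x_l and take constant terms. Since y has order at least 2, only
c(c(y x_l)) contributes, and it gives 2s·(c x_i)(0)². -/
theorem sandwich_subset_isotropy (hp : p ≠ 2) {L : LieSubalgebra k (Witt p k ι)}
    (hL : ∀ i, ∃ y ∈ L, (∀ j, y (x p k ι j) ∈ Fil p k ι 2) ∧ ∃ l, ∃ s : k, s ≠ 0 ∧
      y (x p k ι l) = s • x p k ι i ^ 2) : sandwich L ⊆ isotropy p k ι := by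
  rintro c ⟨_, hc⟩ i
  obtain ⟨y, hy, hy2, l, s, hs, hyl⟩ := hL i
  have h := congrArg (aug p k ι) (DFunLike.congr_fun (hc y hy) (x p k ι l))
  rw [lie_lie_apply, map_add, map_sub, map_mul, Derivation.zero_apply, map_zero,
    mem_Fil_one.mp (deriv_Fil_succ c (deriv_Fil' hy2 _)),
    mem_Fil_one.mp (Fil_anti one_le_two (deriv_Fil' hy2 _)), hyl, Derivation.map_smul,
    Derivation.map_smul, map_smul] at h
  have h2 := aug_iterate_pow_mul c (aug_x i) 2 1
  simp only [Function.iterate_succ_apply, Function.iterate_zero, id, mul_one, map_one] at h2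
  rw [h2] at h
  have h2k : (2 : k) ≠ 0 := by
    intro h0
    have : ((2 : ℕ) : k) = 0 := by exact_mod_cast h0
    rw [CharP.cast_eq_zero_iff k p] at this
    exact hp ((Nat.prime_dvd_prime_iff_eq Fact.out Nat.prime_two).mp this)
  simpa [hs, h2k, Nat.factorial] using h

/-- Every term of [c, [c, y]] contains c twice. Even when y lowers the order by one in between, the
result has order at least 2s, beyond the top degree. -/
theorem mem_sandwich_of_Fil {L : LieSubalgebra k (Witt p k ι)} {c : Witt p k ι} (hc : c ∈ L) {s : ℕ}
    (hs : ∀ i, c (x p k ι i) ∈ Fil p k ι (s + 1)) (h : topDeg p ι < s + s) : c ∈ sandwich L := by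
  refine ⟨hc, fun y _ => witt_ext p fun i => ?_⟩
  have h1 : c (y (c (x p k ι i))) = 0 := by
    obtain ⟨r, rfl⟩ : ∃ r, s = r + 1 := ⟨s - 1, by omega⟩
    exact Fil_eq_bot (by omega) (deriv_Fil hs (deriv_Fil_succ y (hs i)))
  have h2 : ∀ a, c (c a) = 0 := fun a => Fil_eq_bot (by omega) (deriv_Fil hs (deriv_Fil' hs a))
  rw [lie_lie_apply, h1, h2, h2]
  simp

/-- With f = u^a, both f² and f·y(f) vanish, the latter because it contains u^(2a-1). Applying E,
which kills f, gives f·E(y f) = 0 as well, and every term of the double bracket contains one of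
these products. -/
theorem mem_sandwich_of_pow_smul {L : LieSubalgebra k (Witt p k ι)} {u : TruncPoly p k ι}
    {E : Witt p k ι} (hu : aug p k ι u = 0) (hE : E u = 0) {a : ℕ} (ha : p < 2 * a)
    (hL : u ^ a • E ∈ L) : u ^ a • E ∈ sandwich L := by
  refine ⟨hL, fun y _ => witt_ext p fun i => ?_⟩
  have hf : u ^ a * u ^ a = 0 := by
    rw [← pow_add]; exact pow_eq_zero_of_le' hu (by omega)
  have hEf : E (u ^ a) = 0 := by rw [Derivation.leibniz_pow, hE]; simp
  have hfy : u ^ a * y (u ^ a) = 0 := by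
    rw [Derivation.leibniz_pow, smul_eq_mul, nsmul_eq_mul]
    have : u ^ a * u ^ (a - 1) = 0 := by
      rw [← pow_add]; exact pow_eq_zero_of_le' hu (by omega)
    linear_combination (a : TruncPoly p k ι) * y u * this
  have hEy : u ^ a * E (y (u ^ a)) = 0 := by
    have := congrArg E hfy
    rw [Derivation.leibniz, hEf, map_zero] at this
    simpa using this
  rw [lie_lie_apply]
  simp only [Derivation.smul_apply, smul_eq_mul, Derivation.leibniz, hEf, map_add,
    Derivation.zero_apply, map_zero]
  linear_combination (E (E (y (x p k ι i))) - 2 * E (y (E (x p k ι i))) +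
    y (E (E (x p k ι i)))) * hf - 2 * E (x p k ι i) * hEy + 0 * hfy

theorem evalZero_surj_of {M : LieSubalgebra k (Witt p k ι)}
    (h : M.toSubmodule.map (evalZero p k ι) = ⊤) (v : ι → k) : ∃ e ∈ M, evalZero p k ι e = v := by
  have : v ∈ M.toSubmodule.map (evalZero p k ι) := by rw [h]; trivial
  exact this

/-- A transitive subalgebra that contains the deepest term of a suitable filtration of `L` is all
of `L`. -/
theorem le_of_filtration {L M : LieSubalgebra k (Witt p k ι)} (hML : M ≤ L)
    (hM : M.toSubmodule.map (evalZero p k ι) = ⊤) (hdL : ∀ i, partialD p k ι i ∈ L)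
    (P : ℕ → Submodule k (Witt p k ι)) (N : ℕ)
    (hN : P N ≤ M.toSubmodule)
    (step : ∀ s < N, P s ≤ Submodule.span k {D | ∃ i, ∃ y ∈ P (s + 1), D = ⁅partialD p k ι i, y⁆} ⊔
      P (s + 1))
    (stable : ∀ s < N, ∀ h ∈ L, h ∈ isotropy p k ι → ∀ y ∈ P (s + 1), ⁅h, y⁆ ∈ P (s + 1))
    (hL : L.toSubmodule ≤ P 0) : L ≤ M := by
  have key : ∀ t ≤ N, P (N - t) ≤ M.toSubmodule := by
    intro t
    induction t with
    | zero => intro _; exact hN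
    | succ t ih =>
      intro ht
      have ih' := ih (by omega)
      have e : N - t = N - (t + 1) + 1 := by omega
      rw [e] at ih'
      refine (step _ (by omega)).trans (sup_le ?_ ih')
      rw [Submodule.span_le]
      rintro _ ⟨i, y, hy, rfl⟩
      -- By transitivity ∂_i is replaced by an element e of M with the same constant part. The
      -- difference lies in the isotropy algebra, which maps the deeper filtration term to itself.
      obtain ⟨e, he, hev⟩ := evalZero_surj_of hM (evalZero p k ι (partialD p k ι i))
      have h1 : partialD p k ι i - e ∈ isotropy p k ι := by
        rw [mem_isotropy_iff_evalZero]
        exact (LinearMap.map_sub (evalZero p k ι) (partialD p k ι i) e).trans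
          (by rw [hev, sub_self])
      have h2 : ⁅partialD p k ι i, y⁆ = ⁅e, y⁆ + ⁅partialD p k ι i - e, y⁆ := by
        ext a
        simp only [Derivation.commutator_apply, Derivation.add_apply, Derivation.sub_apply, map_sub]
        ring
      rw [h2]
      exact add_mem (M.lie_mem he (ih' hy))
        (ih' (stable _ (by omega) _ (sub_mem (hdL i) (hML he)) h1 _ hy))
  have := key N le_rfl
  rw [Nat.sub_self] at this
  exact fun D hD => this (hL hD)

/-- If the isotropy algebra of `L` is the only maximal subalgebra that contains some invariant set,
then it is invariant under all automorphisms. -/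
theorem isotropy_invariant {L : LieSubalgebra k (Witt p k ι)} (C : Set (Witt p k ι))
    (hCL : C ⊆ L) (hC : ∀ g : L ≃ₗ⁅k⁆ L, ∀ c : L, (c : Witt p k ι) ∈ C → (g c : Witt p k ι) ∈ C)
    (hC0 : C ⊆ isotropy p k ι) (hL0 : ¬ L ≤ isotropy p k ι)
    (gen : ∀ M : LieSubalgebra k (Witt p k ι), M ≤ L → C ⊆ M → ¬ M ≤ isotropy p k ι → L ≤ M)
    (g : L ≃ₗ⁅k⁆ L) (D : L) (hD : (D : Witt p k ι) ∈ isotropy p k ι) :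
    (g D : Witt p k ι) ∈ isotropy p k ι := by
  -- M is the image under g of the isotropy part of L. It contains C, because C is stable under the
  -- inverse of g. If M left the isotropy algebra, then M = L, and injectivity of g would put L
  -- inside the isotropy algebra.
  let M : LieSubalgebra k (Witt p k ι) :=
    ((isotropy p k ι).comap L.incl).map (L.incl.comp g.toLieHom)
  have hM : ∀ E, E ∈ M ↔ ∃ F : L, (F : Witt p k ι) ∈ isotropy p k ι ∧ (g F : Witt p k ι) = E :=
    fun E => LieSubalgebra.mem_map _ _ _
  have hML : M ≤ L := by
    intro E hE
    obtain ⟨F, _, rfl⟩ := (hM E).mp hE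
    exact (g F).2
  by_contra hc
  have h1 := gen M hML (fun c hcC => by
    refine (hM c).mpr ⟨g.symm ⟨c, hCL hcC⟩, hC0 (hC g.symm ⟨c, hCL hcC⟩ hcC), ?_⟩
    rw [LieEquiv.apply_symm_apply]) (fun h => hc (h ((hM _).mpr ⟨D, hD, rfl⟩)))
  refine hL0 fun E hE => ?_
  obtain ⟨F, hF, hFE⟩ := (hM _).mp (h1 (g ⟨E, hE⟩).2)
  have : F = ⟨E, hE⟩ := g.injective (Subtype.ext hFE)
  rw [this] at hF
  exact hF

theorem sandwich_invariant {L : LieSubalgebra k (Witt p k ι)} (g : L ≃ₗ⁅k⁆ L) (c : L)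
    (hc : (c : Witt p k ι) ∈ sandwich L) : (g c : Witt p k ι) ∈ sandwich L := by
  refine ⟨(g c).2, fun y hy => ?_⟩
  have h1 : ⁅c, ⁅c, g.symm ⟨y, hy⟩⁆⁆ = 0 := Subtype.ext (hc.2 _ (g.symm ⟨y, hy⟩).2)
  have h2 := congrArg g h1
  rw [LieEquiv.map_lie, LieEquiv.map_lie, LieEquiv.apply_symm_apply, map_zero] at h2
  exact congrArg Subtype.val h2

end Isotropy

/-! ### Derived algebras: brackets, weight vectors, functoriality. -/

section Derived

variable {k : Type*} [Field k] {L : Type*} [LieRing L] [LieAlgebra k L] {g : LieSubalgebra k L}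

theorem mem_derivedSubalgebra {j : ℕ} {D : L} :
    D ∈ derivedSubalgebra g j ↔ ∃ E ∈ LieAlgebra.derivedSeries k g j, (E : L) = D :=
  LieSubalgebra.mem_map _ _ _

theorem mem_derivedSubalgebra_zero {D : L} : D ∈ derivedSubalgebra g 0 ↔ D ∈ g := by
  rw [mem_derivedSubalgebra]
  constructor
  · rintro ⟨E, _, rfl⟩; exact E.2
  · intro h; exact ⟨⟨D, h⟩, trivial, rfl⟩

theorem lie_mem_derivedSubalgebra_succ {j : ℕ} {D E : L} (hD : D ∈ derivedSubalgebra g j)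
    (hE : E ∈ derivedSubalgebra g j) : ⁅D, E⁆ ∈ derivedSubalgebra g (j + 1) := by
  obtain ⟨D, hD', rfl⟩ := mem_derivedSubalgebra.mp hD
  obtain ⟨E, hE', rfl⟩ := mem_derivedSubalgebra.mp hE
  refine mem_derivedSubalgebra.mpr ⟨⁅D, E⁆, ?_, rfl⟩
  rw [LieAlgebra.derivedSeries_def, LieAlgebra.derivedSeriesOfIdeal_succ]
  exact LieSubmodule.lie_mem_lie hD' hE'

theorem derivedSubalgebra_succ_le {j : ℕ} {S : Submodule k L}
    (h : ∀ D ∈ derivedSubalgebra g j, ∀ E ∈ derivedSubalgebra g j, ⁅D, E⁆ ∈ S) :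
    (derivedSubalgebra g (j + 1)).toSubmodule ≤ S := by
  rintro _ hD
  obtain ⟨E, hE, rfl⟩ := mem_derivedSubalgebra.mp hD
  rw [LieAlgebra.derivedSeries_def, LieAlgebra.derivedSeriesOfIdeal_succ] at hE
  have h1 : E ∈ (⁅LieAlgebra.derivedSeries k g j, LieAlgebra.derivedSeries k g j⁆ :
    LieIdeal k g).toSubmodule := hE
  rw [LieSubmodule.lieIdeal_oper_eq_linear_span'] at h1
  have h2 : Submodule.span k {x : g | ∃ y ∈ LieAlgebra.derivedSeries k g j,
      ∃ z ∈ LieAlgebra.derivedSeries k g j, ⁅y, z⁆ = x} ≤ S.comap g.toSubmodule.subtype := by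
    rw [Submodule.span_le]
    rintro _ ⟨y, hy, z, hz, rfl⟩
    exact h _ (mem_derivedSubalgebra.mpr ⟨y, hy, rfl⟩) _ (mem_derivedSubalgebra.mpr ⟨z, hz, rfl⟩)
  exact h2 h1

theorem derivedSubalgebra_succ_le_self (j : ℕ) :
    derivedSubalgebra g (j + 1) ≤ derivedSubalgebra g j := fun _ hD =>
  derivedSubalgebra_succ_le (S := (derivedSubalgebra g j).toSubmodule)
    (fun _ hD _ hE => (derivedSubalgebra g j).lie_mem hD hE) hD

theorem derivedSubalgebra_le (j : ℕ) : derivedSubalgebra g j ≤ g := by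
  induction j with
  | zero => exact fun _ h => mem_derivedSubalgebra_zero.mp h
  | succ j ih => exact (derivedSubalgebra_succ_le_self j).trans ih

/-- Weight vectors of nonzero weight for an element of a derived algebra lie in it as well. -/
theorem mem_derivedSubalgebra_of_lie_eq {j : ℕ} {d D : L} {c : k} (hc : c ≠ 0)
    (hd : d ∈ derivedSubalgebra g j) (hD : D ∈ g) (h : ⁅d, D⁆ = c • D) :
    D ∈ derivedSubalgebra g j := by
  induction j with
  | zero => exact mem_derivedSubalgebra_zero.mpr hD
  | succ j ih =>
    have hd' := derivedSubalgebra_succ_le_self j hd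
    have h1 := lie_mem_derivedSubalgebra_succ hd' (ih hd')
    rw [h] at h1
    have := (derivedSubalgebra g (j + 1)).smul_mem c⁻¹ h1
    rwa [smul_smul, inv_mul_cancel₀ hc, one_smul] at this

theorem derivedSubalgebra_map_mem (σ : L ≃ₗ⁅k⁆ L) (h : ∀ D ∈ g, σ D ∈ g) {j : ℕ} :
    ∀ D ∈ derivedSubalgebra g j, σ D ∈ derivedSubalgebra g j := by
  induction j with
  | zero => simpa only [mem_derivedSubalgebra_zero] using h
  | succ j ih =>
    intro D hD
    refine derivedSubalgebra_succ_le (S := (derivedSubalgebra g (j + 1)).toSubmodule.comap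
      (σ : L →ₗ[k] L)) ?_ hD
    intro D hD E hE
    change σ ⁅D, E⁆ ∈ derivedSubalgebra g (j + 1)
    rw [LieEquiv.map_lie]
    exact lie_mem_derivedSubalgebra_succ (ih D hD) (ih E hE)

end Derived

/-! ### Generating all constant directions. -/

section Transitive

variable {p : ℕ} {k : Type*} [Field k] [CharP k p] [Fact p.Prime] {ι : Type*} [Fintype ι]

theorem witt_sum_smul_partialD (D : Witt p k ι) :
    D = ∑ i, D (x p k ι i) • partialD p k ι i := by
  ext a
  rw [witt_sum_apply, witt_apply p D a]
  rfl

theorem partialD_x_self (i : ι) : partialD p k ι i (x p k ι i) = 1 := by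
  classical rw [partialD_x, if_pos rfl]

theorem partialD_x_ne {i j : ι} (h : j ≠ i) : partialD p k ι i (x p k ι j) = 0 := by
  classical rw [partialD_x, if_neg h]

theorem natCast_ne_zero_of_lt {n : ℕ} (h0 : n ≠ 0) (h : n < p) : (n : k) ≠ 0 := by
  rw [Ne, CharP.cast_eq_zero_iff k p]
  intro hd
  have := Nat.le_of_dvd (by omega) hd
  omega

theorem factorial_ne_zero_of_lt {n : ℕ} (h : n < p) : (n.factorial : k) ≠ 0 := by
  rw [Ne, CharP.cast_eq_zero_iff k p, (Fact.out : p.Prime).dvd_factorial]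
  omega

theorem Mon_le_partialD {s : ℕ} (hs : s < topDeg p ι) {a : TruncPoly p k ι}
    (ha : a ∈ Fil p k ι s) :
    a ∈ Submodule.span k {b | ∃ i, ∃ γ : ι →₀ ℕ, γ.degree = s + 1 ∧
      b = partialD p k ι i (mon p k γ)} ⊔ Fil p k ι (s + 1) := by
  revert a
  change Fil p k ι s ≤ _
  rw [Mon_le_iff]
  intro γ hγ
  rcases (show s ≤ γ.degree from hγ).eq_or_lt with h | h
  · obtain ⟨i, δ, c, h1, hc, -, -, h2⟩ := mon_eq_partialD (p := p) (k := k) (h ▸ hs)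
    refine Submodule.mem_sup_left ?_
    have : mon p k γ = c⁻¹ • partialD p k ι i (mon p k δ) := by
      rw [h2, smul_smul, inv_mul_cancel₀ hc, one_smul]
    rw [this]
    exact Submodule.smul_mem _ _ (Submodule.subset_span ⟨i, δ, by omega, rfl⟩)
  · exact Submodule.mem_sup_right (mon_mem h)

/-- If `M` contains an element `D` with `D(x_i)(0) ≠ 0` and all `x_i^{p-1} ∂_l` with `l ≠ i`, then
it is transitive. -/
theorem transitive_of_pow {M : LieSubalgebra k (Witt p k ι)} (hM : ¬ M ≤ isotropy p k ι)
    (h : ∀ i l, l ≠ i → x p k ι i ^ (p - 1) • partialD p k ι l ∈ M) :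
    M.toSubmodule.map (evalZero p k ι) = ⊤ := by
  classical
  obtain ⟨D, hD, hD0⟩ := SetLike.not_le_iff_exists.mp hM
  rw [mem_isotropy] at hD0
  push Not at hD0
  obtain ⟨i, hi⟩ := hD0
  set V := M.toSubmodule.map (evalZero p k ι) with hV
  have h1 : ∀ l, l ≠ i → Pi.single l (1 : k) ∈ V := by
    intro l hl
    set c := x p k ι i ^ (p - 1) • partialD p k ι l with hc
    have hcF : ∀ j, c (x p k ι j) ∈ Fil p k ι (p - 1) := by
      intro j
      refine Fil_mul_right _ (Mon_mono ?_ (pow_mem_Mon (x_mem_Mon i) (p - 1)))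
      simp
    have h2 : evalZero p k ι ((fun y => ⁅D, y⁆)^[p - 1] c) ∈ V :=
      ⟨_, ad_iterate_mem M hD (h i l hl) _, rfl⟩
    -- Each of the p - 1 brackets removes one factor x_i, leaving (p-1)!·(D x_i)(0)^(p-1) times the
    -- direction l. This scalar is nonzero.
    have h3 : evalZero p k ι ((fun y => ⁅D, y⁆)^[p - 1] c) =
        (((p - 1).factorial : k) * aug p k ι (D (x p k ι i)) ^ (p - 1)) •
          (Pi.single l (1 : k) : ι → k) := by
      ext j
      rw [evalZero_ad_iterate D c hcF, hc, Derivation.smul_apply, smul_eq_mul,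
        aug_iterate_pow_mul D (aug_x i), partialD_x]
      by_cases hj : j = l
      · subst hj; simp
      · simp [hj]
    rw [h3] at h2
    refine (Submodule.smul_mem_iff _ (mul_ne_zero (factorial_ne_zero_of_lt (p := p) ?_)
      (pow_ne_zero _ hi))).mp h2
    have := (Fact.out : p.Prime).pos
    omega
  -- The remaining direction is what is left of D itself after subtracting the directions already
  -- found.
  have h4 : Pi.single i (1 : k) ∈ V := by
    have h5 : evalZero p k ι D ∈ V := ⟨D, hD, rfl⟩
    have h6 : evalZero p k ι D = aug p k ι (D (x p k ι i)) • (Pi.single i (1 : k) : ι → k) +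
        ∑ l ∈ Finset.univ.erase i, aug p k ι (D (x p k ι l)) • (Pi.single l (1 : k) : ι → k) := by
      rw [Finset.add_sum_erase _ (fun l => aug p k ι (D (x p k ι l)) • (Pi.single l (1 : k) : ι → k))
        (Finset.mem_univ i)]
      ext j
      simp [Finset.sum_apply, Pi.single_apply]
    have h7 : ∑ l ∈ Finset.univ.erase i, aug p k ι (D (x p k ι l)) •
        (Pi.single l (1 : k) : ι → k) ∈ V :=
      sum_mem fun l hl => V.smul_mem _ (h1 l (Finset.ne_of_mem_erase hl))
    rw [h6] at h5
    exact (Submodule.smul_mem_iff _ hi).mp ((Submodule.add_mem_iff_left _ h7).mp h5)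
  rw [eq_top_iff]
  intro v _
  rw [← Finset.univ_sum_single v]
  refine sum_mem fun l _ => ?_
  have : (Pi.single l (v l) : ι → k) = v l • Pi.single l 1 := by
    rw [← Pi.single_smul', smul_eq_mul, mul_one]
  rw [this]
  refine V.smul_mem _ ?_
  by_cases hl : l = i
  · rw [hl]; exact h4
  · exact h1 l hl

end Transitive

/-! ### Invariance of the isotropy algebra for W(n). -/

section JacobsonWitt

variable {p : ℕ} {k : Type*} [Field k] [CharP k p] [Fact p.Prime] {ι : Type*} [Fintype ι]

/-- Multiplication of a derivation by elements of `A`, as a `k`-linear map. -/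
noncomputable def smulWitt (E : Witt p k ι) : TruncPoly p k ι →ₗ[k] Witt p k ι where
  toFun a := a • E
  map_add' a b := by ext; simp [add_mul]
  map_smul' c a := by ext; simp

@[simp] theorem smulWitt_apply (E : Witt p k ι) (a : TruncPoly p k ι) : smulWitt E a = a • E := rfl

theorem smul_partialD_x [DecidableEq ι] (a : TruncPoly p k ι) (i j : ι) :
    (a • partialD p k ι i) (x p k ι j) = if j = i then a else 0 := by
  rw [Derivation.smul_apply, partialD_x]
  split_ifs <;> simp

theorem partialD_notMem_isotropy (i : ι) : partialD p k ι i ∉ isotropy p k ι := by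
  intro h
  have := h i
  rw [partialD_x_self, map_one] at this
  exact one_ne_zero this

theorem x_pow_mem_Fil (i : ι) (n : ℕ) : x p k ι i ^ n ∈ Fil p k ι n :=
  Mon_mono (by simp) (pow_mem_Mon (x_mem_Mon i) n)

theorem lie_partialD_x (i : ι) (D : Witt p k ι) (j : ι) :
    ⁅partialD p k ι i, D⁆ (x p k ι j) = partialD p k ι i (D (x p k ι j)) := by
  classical
  rw [Derivation.commutator_apply, partialD_x, sub_eq_self]
  split_ifs <;> simp

/-- The standard filtration of `W`. -/
noncomputable def wittFil (p : ℕ) (k : Type*) [Field k] [CharP k p] [Fact p.Prime] (ι : Type*)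
    (s : ℕ) : Submodule k (Witt p k ι) where
  carrier := {D | ∀ i, D (x p k ι i) ∈ Fil p k ι s}
  add_mem' h1 h2 i := add_mem (h1 i) (h2 i)
  zero_mem' _ := zero_mem _
  smul_mem' c _ h i := Submodule.smul_mem _ c (h i)

theorem lie_mem_wittFil {h y : Witt p k ι} {s : ℕ} (hh : h ∈ isotropy p k ι)
    (hy : y ∈ wittFil p k ι (s + 1)) : ⁅h, y⁆ ∈ wittFil p k ι (s + 1) := by
  intro i
  rw [Derivation.commutator_apply]
  have h1 : ∀ i, h (x p k ι i) ∈ Fil p k ι 1 := fun i => mem_Fil_one.mpr (hh i)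
  refine sub_mem ?_ (deriv_Fil' hy _)
  rw [add_comm s 1]
  exact deriv_Fil h1 (hy i)

theorem wittFil_le_span {s : ℕ} (hs : s < topDeg p ι) : wittFil p k ι s ≤
    Submodule.span k {D | ∃ i, ∃ y ∈ wittFil p k ι (s + 1), D = ⁅partialD p k ι i, y⁆} ⊔
      wittFil p k ι (s + 1) := by
  classical
  intro D hD
  rw [witt_sum_smul_partialD D]
  refine sum_mem fun i _ => ?_
  have h1 := Submodule.mem_map_of_mem (f := smulWitt (partialD p k ι i))
    (Mon_le_partialD hs (hD i))
  rw [Submodule.map_sup, Submodule.map_span] at h1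
  refine SetLike.le_def.mp (sup_le_sup ?_ ?_) h1
  · refine Submodule.span_mono ?_
    rintro _ ⟨_, ⟨j, γ, hγ, rfl⟩, rfl⟩
    refine ⟨j, mon p k γ • partialD p k ι i, fun l => ?_, witt_ext p fun l => ?_⟩
    · rw [smul_partialD_x]
      split_ifs
      · exact mon_mem (by simp [hγ])
      · exact zero_mem _
    · rw [lie_partialD_x, smulWitt_apply, smul_partialD_x, smul_partialD_x]
      split_ifs <;> simp
  · rintro _ ⟨a, ha, rfl⟩ l
    rw [smulWitt_apply, smul_partialD_x]
    split_ifs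
    · exact ha
    · exact zero_mem _

theorem isotropy_invariant_witt (hp : 3 ≤ p) (h1 : 1 ≤ Fintype.card ι)
    (h5 : Fintype.card ι = 1 → 5 ≤ p) (g : (⊤ : LieSubalgebra k (Witt p k ι)) ≃ₗ⁅k⁆
      (⊤ : LieSubalgebra k (Witt p k ι))) (D : (⊤ : LieSubalgebra k (Witt p k ι)))
    (hD : (D : Witt p k ι) ∈ isotropy p k ι) : (g D : Witt p k ι) ∈ isotropy p k ι := by
  classical
  -- The deepest filtration term consists of sandwich elements as soon as the top degree exceeds 2.
  -- The excluded case n = 1, p = 3 has top degree 2.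
  have htop : 4 ≤ topDeg p ι := by
    rw [topDeg]
    rcases h1.eq_or_lt with h | h
    · have := h5 h.symm; rw [← h]; omega
    · calc 4 = 2 * 2 := rfl
        _ ≤ _ := Nat.mul_le_mul h (by omega)
  have hne : Nonempty ι := Fintype.card_pos_iff.mp h1
  refine isotropy_invariant (sandwich ⊤) (fun _ h => h.1) (fun g c => sandwich_invariant g c)
    (sandwich_subset_isotropy (by omega) fun i => ?_) ?_ ?_ g D hD
  · refine ⟨x p k ι i ^ 2 • partialD p k ι i, trivial, fun j => ?_, i, 1, one_ne_zero, ?_⟩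
    · exact Fil_mul_right _ (x_pow_mem_Fil i 2)
    · rw [smul_partialD_x, if_pos rfl, one_smul]
  · exact fun h => partialD_notMem_isotropy hne.some (h trivial)
  · intro M _ hCM hM
    refine le_of_filtration le_top (transitive_of_pow hM fun i l hl => hCM ?_) (fun _ => trivial)
      (wittFil p k ι) (topDeg p ι) (fun D hD => hCM ?_) (fun s hs => wittFil_le_span hs)
      (fun s _ h _ hh y hy => lie_mem_wittFil hh hy) ?_
    · exact mem_sandwich_of_pow_smul (aug_x i) (partialD_x_ne (Ne.symm hl)) (by omega) trivial
    · refine mem_sandwich_of_Fil (s := topDeg p ι - 1) trivial (fun i => ?_) (by omega)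
      rw [Nat.sub_add_cancel (by omega)]
      exact hD i
    · intro D _ i
      rw [Fil_zero]; trivial

end JacobsonWitt

/-! ### Invariance of the isotropy algebra for S(n)^(1). -/

section Special

variable {p : ℕ} {k : Type*} [Field k] [CharP k p] [Fact p.Prime] {n : ℕ}

theorem mem_specialFull {D : Witt p k (Fin n)} : D ∈ specialFull p k n ↔ divergence p k D = 0 :=
  Iff.rfl

theorem divergence_smul (a : TruncPoly p k (Fin n)) (D : Witt p k (Fin n)) :
    divergence p k (a • D) = a * divergence p k D + D a := by
  rw [divergence, divergence, Finset.mul_sum, witt_apply p D a, ← Finset.sum_add_distrib]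
  refine Finset.sum_congr rfl fun i _ => ?_
  rw [Derivation.smul_apply, smul_eq_mul, Derivation.leibniz, smul_eq_mul, smul_eq_mul]

theorem divergence_partialD (i : Fin n) : divergence p k (partialD p k (Fin n) i) = 0 := by
  rw [divergence]
  refine Finset.sum_eq_zero fun j _ => ?_
  rw [partialD_x]
  split_ifs <;> simp

theorem smul_partialD_mem_specialFull {a : TruncPoly p k (Fin n)} {i : Fin n}
    (h : partialD p k (Fin n) i a = 0) : a • partialD p k (Fin n) i ∈ specialFull p k n := by
  rw [mem_specialFull, divergence_smul, divergence_partialD, h, mul_zero, add_zero]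

/-- The derivation `∂_j(f) ∂_i - ∂_i(f) ∂_j`. -/
noncomputable def curl (i j : Fin n) : TruncPoly p k (Fin n) →ₗ[k] Witt p k (Fin n) where
  toFun f := partialD p k (Fin n) j f • partialD p k (Fin n) i -
    partialD p k (Fin n) i f • partialD p k (Fin n) j
  map_add' f g := by
    ext a
    simp only [map_add, Derivation.sub_apply, Derivation.add_apply, Derivation.smul_apply,
      smul_eq_mul]
    ring
  map_smul' c f := by
    ext a
    simp [smul_sub]

theorem curl_apply (i j : Fin n) (f : TruncPoly p k (Fin n)) :
    curl i j f = partialD p k (Fin n) j f • partialD p k (Fin n) i -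
      partialD p k (Fin n) i f • partialD p k (Fin n) j := rfl

theorem curl_x (i j l : Fin n) (f : TruncPoly p k (Fin n)) :
    curl i j f (x p k (Fin n) l) = (if l = i then partialD p k (Fin n) j f else 0) -
      (if l = j then partialD p k (Fin n) i f else 0) := by
  rw [curl_apply, Derivation.sub_apply, smul_partialD_x, smul_partialD_x]

/-- For D of divergence zero, D f = Σ ∂_j(D(x_j) f); this is applied to both halves of the
commutator. The formula bounds the order of the potentials by the sum of the orders of D and E,
which gives stability of the filtration. -/
theorem lie_eq_sum_curl {D E : Witt p k (Fin n)} (hD : D ∈ specialFull p k n)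
    (hE : E ∈ specialFull p k n) :
    ⁅D, E⁆ = ∑ i, ∑ j, curl i j (D (x p k (Fin n) j) * E (x p k (Fin n) i)) := by
  refine witt_ext p fun l => ?_
  have h1 : ∀ (D E : Witt p k (Fin n)), D ∈ specialFull p k n →
      ∑ j, partialD p k (Fin n) j (D (x p k (Fin n) j) * E (x p k (Fin n) l)) =
        D (E (x p k (Fin n) l)) := by
    intro D E hD
    have h2 := mem_specialFull.mp hD
    rw [divergence] at h2
    have h3 : ∑ j, E (x p k (Fin n) l) * partialD p k (Fin n) j (D (x p k (Fin n) j)) = 0 := by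
      rw [← Finset.mul_sum, h2, mul_zero]
    rw [witt_apply p D (E _), ← add_zero (∑ i, D _ * _), ← h3, ← Finset.sum_add_distrib]
    refine Finset.sum_congr rfl fun j _ => ?_
    rw [Derivation.leibniz, smul_eq_mul, smul_eq_mul]
  rw [Derivation.commutator_apply, witt_sum_apply, ← h1 D E hD, ← h1 E D hE]
  simp only [witt_sum_apply, curl_x, Finset.sum_sub_distrib]
  congr 1
  · rw [Finset.sum_comm]
    refine Finset.sum_congr rfl fun j _ => ?_
    simp
  · refine Finset.sum_congr rfl fun j _ => ?_
    simp [mul_comm]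

/-- The span of all `∂_j(f) ∂_i - ∂_i(f) ∂_j` with `f` of order at least `s`. -/
noncomputable def curlSpan (p : ℕ) (k : Type*) [Field k] [CharP k p] [Fact p.Prime] (n s : ℕ) :
    Submodule k (Witt p k (Fin n)) :=
  Submodule.span k {D | ∃ i j : Fin n, ∃ f ∈ Fil p k (Fin n) s, D = curl i j f}

theorem curl_mem_curlSpan {i j : Fin n} {s : ℕ} {f : TruncPoly p k (Fin n)}
    (hf : f ∈ Fil p k (Fin n) s) : curl i j f ∈ curlSpan p k n s :=
  Submodule.subset_span ⟨i, j, f, hf, rfl⟩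

/-- Split a monomial as f·g, with f its x_j-part and g free of x_j. For i ≠ j both f ∂_i and g ∂_j
have divergence zero, and their bracket is the curl up to sign. -/
theorem curl_mem_special (i j : Fin n) (f : TruncPoly p k (Fin n)) :
    curl i j f ∈ derivedSubalgebra (specialFull p k n) 1 := by
  have h : Mon p k (Fin n) Set.univ ≤
      (derivedSubalgebra (specialFull p k n) 1).toSubmodule.comap (curl i j) := by
    rw [Mon_le_iff]
    intro γ _
    change curl i j (mon p k γ) ∈ derivedSubalgebra (specialFull p k n) 1
    by_cases hij : i = j
    · have : curl i j (mon p k γ) = 0 := by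
        refine witt_ext p fun l => ?_
        rw [curl_x, hij, sub_self]; simp
      rw [this]; exact zero_mem _
    set f := mon p k (Finsupp.single j (γ j)) with hf
    set g := mon p k (γ.erase j) with hg
    have hfg : mon p k γ = f * g := by
      rw [hf, hg, ← mon_add, Finsupp.single_add_erase]
    have h1 : partialD p k (Fin n) i f = 0 := by
      rw [hf, partialD_mon, Finsupp.single_apply, if_neg (Ne.symm hij)]; simp
    have h2 : partialD p k (Fin n) j g = 0 := by
      rw [hg, partialD_mon, Finsupp.erase_same]; simp
    have h3 := lie_mem_derivedSubalgebra_succ (j := 0)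
      (mem_derivedSubalgebra_zero.mpr (smul_partialD_mem_specialFull h1))
      (mem_derivedSubalgebra_zero.mpr (smul_partialD_mem_specialFull h2))
    have h4 : curl i j (mon p k γ) = -⁅f • partialD p k (Fin n) i, g • partialD p k (Fin n) j⁆ := by
      refine witt_ext p fun l => ?_
      rw [curl_x, hfg, Derivation.neg_apply, Derivation.commutator_apply, smul_partialD_x,
        smul_partialD_x]
      simp only [Derivation.leibniz, Derivation.smul_apply, h1, h2, smul_eq_mul, mul_zero,
        add_zero, zero_add]
      by_cases hi : l = i
      · subst hi; simp [hij]
      · by_cases hj : l = j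
        · simp [hj, Ne.symm hij]
        · simp [hi, hj]
    rw [h4]
    exact neg_mem h3
  rw [Mon_univ] at h
  exact h (show f ∈ ⊤ from trivial)

theorem curlSpan_le (s : ℕ) :
    curlSpan p k n s ≤ (derivedSubalgebra (specialFull p k n) 1).toSubmodule := by
  rw [curlSpan, Submodule.span_le]
  rintro _ ⟨i, j, f, _, rfl⟩
  exact curl_mem_special i j f

theorem special_le_curlSpan :
    (derivedSubalgebra (specialFull p k n) 1).toSubmodule ≤ curlSpan p k n 0 := by
  refine derivedSubalgebra_succ_le fun D hD E hE => ?_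
  rw [mem_derivedSubalgebra_zero] at hD hE
  rw [lie_eq_sum_curl hD hE]
  exact sum_mem fun i _ => sum_mem fun j _ => curl_mem_curlSpan (by rw [Fil_zero]; trivial)

theorem curlSpan_le_wittFil (s : ℕ) : curlSpan p k n (s + 1) ≤ wittFil p k (Fin n) s := by
  rw [curlSpan, Submodule.span_le]
  rintro _ ⟨i, j, f, hf, rfl⟩ l
  rw [curl_x]
  refine sub_mem ?_ ?_ <;> split_ifs
  · exact partialD_Fil j hf
  · exact zero_mem _
  · exact partialD_Fil i hf
  · exact zero_mem _

theorem lie_partialD_curl (l i j : Fin n) (f : TruncPoly p k (Fin n)) :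
    ⁅partialD p k (Fin n) l, curl i j f⁆ = curl i j (partialD p k (Fin n) l f) := by
  refine witt_ext p fun q => ?_
  rw [lie_partialD_x, curl_x, curl_x, map_sub, partialD_comm p i l, partialD_comm p j l]
  split_ifs <;> simp

theorem curlSpan_le_span {s : ℕ} (hs : s < topDeg p (Fin n)) : curlSpan p k n s ≤
    Submodule.span k {D | ∃ i, ∃ y ∈ curlSpan p k n (s + 1), D = ⁅partialD p k (Fin n) i, y⁆} ⊔
      curlSpan p k n (s + 1) := by
  conv_lhs => rw [curlSpan]
  rw [Submodule.span_le]
  rintro _ ⟨i, j, f, hf, rfl⟩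
  have h1 := Submodule.mem_map_of_mem (f := curl i j) (Mon_le_partialD hs hf)
  rw [Submodule.map_sup, Submodule.map_span] at h1
  refine SetLike.le_def.mp (sup_le_sup ?_ ?_) h1
  · refine Submodule.span_mono ?_
    rintro _ ⟨_, ⟨l, γ, hγ, rfl⟩, rfl⟩
    exact ⟨l, curl i j (mon p k γ), curl_mem_curlSpan (mon_mem (by simp [hγ])),
      (lie_partialD_curl l i j _).symm⟩
  · rintro _ ⟨a, ha, rfl⟩
    exact curl_mem_curlSpan ha

theorem smul_partialD_mem_special {a : TruncPoly p k (Fin n)} {l j : Fin n} (hlj : l ≠ j)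
    (hl : partialD p k (Fin n) l a = 0) (hj : partialD p k (Fin n) j a = 0) :
    a • partialD p k (Fin n) l ∈ derivedSubalgebra (specialFull p k n) 1 := by
  have : a • partialD p k (Fin n) l = curl l j (x p k (Fin n) j * a) := by
    rw [curl_apply, Derivation.leibniz, Derivation.leibniz, hl, hj, partialD_x_self,
      partialD_x_ne (Ne.symm hlj)]
    ext b
    simp
  rw [this]
  exact curl_mem_special _ _ _

theorem isotropy_invariant_special (hp : 3 ≤ p) (hn : 3 ≤ n)
    (g : derivedSubalgebra (specialFull p k n) 1 ≃ₗ⁅k⁆ derivedSubalgebra (specialFull p k n) 1)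
    (D : derivedSubalgebra (specialFull p k n) 1)
    (hD : (D : Witt p k (Fin n)) ∈ isotropy p k (Fin n)) :
    (g D : Witt p k (Fin n)) ∈ isotropy p k (Fin n) := by
  have htop : 6 ≤ topDeg p (Fin n) := by
    rw [topDeg, Fintype.card_fin]
    calc 6 = 3 * 2 := rfl
      _ ≤ _ := Nat.mul_le_mul hn (by omega)
  -- A third index j is where n ≥ 3 enters: x_i^a ∂_l is the curl of x_j x_i^a in the directions l
  -- and j, hence lies in the derived algebra.
  have hthird : ∀ i l : Fin n, ∃ j, j ≠ i ∧ j ≠ l := by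
    intro i l
    obtain ⟨j, hj⟩ := Finset.exists_mem_notMem_of_card_lt_card
      (s := ({i, l} : Finset (Fin n))) (t := Finset.univ)
      (lt_of_le_of_lt Finset.card_le_two (by simp; omega))
    exact ⟨j, by simpa using hj.2⟩
  have hpow : ∀ (i l : Fin n) (a : ℕ), l ≠ i →
      x p k (Fin n) i ^ a • partialD p k (Fin n) l ∈ derivedSubalgebra (specialFull p k n) 1 := by
    intro i l a hl
    obtain ⟨j, hj1, hj2⟩ := hthird i l
    refine smul_partialD_mem_special hj2.symm ?_ ?_ <;> rw [Derivation.leibniz_pow, partialD_x_ne]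
    · simp
    · exact hl.symm
    · simp
    · exact hj1.symm
  have hd : ∀ i, partialD p k (Fin n) i ∈ derivedSubalgebra (specialFull p k n) 1 := by
    intro i
    obtain ⟨j, hj, -⟩ := hthird i i
    simpa using hpow j i 0 hj.symm
  refine isotropy_invariant (sandwich _) (fun _ h => h.1) (fun g c => sandwich_invariant g c)
    (sandwich_subset_isotropy (by omega) fun i => ?_) ?_ ?_ g D hD
  · obtain ⟨l, hl, -⟩ := hthird i i
    refine ⟨_, hpow i l 2 hl, fun j => ?_, l, 1, one_ne_zero, ?_⟩
    · exact Fil_mul_right _ (x_pow_mem_Fil i 2)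
    · rw [smul_partialD_x, if_pos rfl, one_smul]
  · exact fun h => partialD_notMem_isotropy ⟨0, by omega⟩ (h (hd _))
  · intro M hML hCM hM
    refine le_of_filtration hML (transitive_of_pow hM fun i l hl => hCM ?_) hd
      (curlSpan p k n) (topDeg p (Fin n)) (fun D hD => hCM ?_) (fun s hs => curlSpan_le_span hs)
      (fun s _ h hh hh0 y hy => ?_) special_le_curlSpan
    · exact mem_sandwich_of_pow_smul (aug_x i) (partialD_x_ne (Ne.symm hl)) (by omega)
        (hpow i l _ hl)
    -- A potential of order `topDeg` has curl of order `topDeg - 1`, which is s + 1 for this s.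
    · refine mem_sandwich_of_Fil (s := topDeg p (Fin n) - 2) (curlSpan_le _ hD) ?_ (by omega)
      refine curlSpan_le_wittFil _ ?_
      have : topDeg p (Fin n) - 2 + 1 + 1 = topDeg p (Fin n) := by omega
      rw [this]
      exact hD
    · rw [lie_eq_sum_curl (derivedSubalgebra_le _ hh) (derivedSubalgebra_le _ (curlSpan_le _ hy))]
      refine sum_mem fun i _ => sum_mem fun j _ => curl_mem_curlSpan ?_
      rw [add_comm s 1]
      exact Fil_mul (mem_Fil_one.mpr (hh0 j)) (curlSpan_le_wittFil s hy i)

end Special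

/-! ### Hamiltonian derivations and the structure of H(2m)^(2). -/

section Hamiltonian

variable {p : ℕ} {k : Type*} [Field k] [CharP k p] [Fact p.Prime] {m : ℕ}

theorem sgn_swap (i : Fin m ⊕ Fin m) : sgn k i.swap = - sgn k i := by
  cases i <;> simp [sgn]

theorem sgn_mul_self (i : Fin m ⊕ Fin m) : sgn k i * sgn k i = 1 := by
  cases i <;> simp [sgn]

theorem sgn_ne_zero (i : Fin m ⊕ Fin m) : sgn k i ≠ 0 := by
  intro h
  have := sgn_mul_self (k := k) i
  rw [h, mul_zero] at this
  exact zero_ne_one this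

theorem swap_ne (i : Fin m ⊕ Fin m) : i.swap ≠ i := by
  cases i <;> simp

theorem smul_eq_algebraMap_mul {ι : Type*} (c : k) (a : TruncPoly p k ι) :
    c • a = algebraMap k _ c * a := Algebra.smul_def c a

/-- The Hamiltonian derivation `D_f = ∑ σ(i) ∂_i(f) ∂_{i'}`. -/
noncomputable def ham : TruncPoly p k (Fin m ⊕ Fin m) →ₗ[k] Witt p k (Fin m ⊕ Fin m) where
  toFun f := ∑ i, (sgn k i • partialD p k _ i f) • partialD p k (Fin m ⊕ Fin m) i.swap
  map_add' f g := by
    ext a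
    simp only [witt_sum_apply, Derivation.add_apply, ← Finset.sum_add_distrib]
    refine Finset.sum_congr rfl fun i _ => ?_
    simp [add_mul, smul_mul_assoc]
  map_smul' c f := by
    ext a
    simp only [witt_sum_apply, Derivation.smul_apply, RingHom.id_apply, Finset.smul_sum]
    refine Finset.sum_congr rfl fun i _ => ?_
    rw [Derivation.map_smul, smul_comm, smul_assoc]

noncomputable instance : CoeFun (TruncPoly p k (Fin m ⊕ Fin m) →ₗ[k] Witt p k (Fin m ⊕ Fin m))
    fun _ => TruncPoly p k (Fin m ⊕ Fin m) → Witt p k (Fin m ⊕ Fin m) := ⟨DFunLike.coe⟩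

theorem ham_apply (f g : TruncPoly p k (Fin m ⊕ Fin m)) :
    ham f g = ∑ i, sgn k i • (partialD p k _ i f * partialD p k _ i.swap g) := by
  change (∑ i, (sgn k i • partialD p k _ i f) • partialD p k (Fin m ⊕ Fin m) i.swap) g = _
  rw [witt_sum_apply]
  simp

theorem sum_swap {M : Type*} [AddCommMonoid M] (F : Fin m ⊕ Fin m → M) :
    ∑ i : Fin m ⊕ Fin m, F i.swap = ∑ i, F i :=
  Equiv.sum_comp (Equiv.sumComm (Fin m) (Fin m)) F

/-- `ham f g` is the Poisson bracket {f, g}. Antisymmetry transfers the derivation property from g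
to f. -/
theorem ham_antisymm (f g : TruncPoly p k (Fin m ⊕ Fin m)) : ham f g = - ham g f := by
  rw [ham_apply, ham_apply, ← sum_swap, ← Finset.sum_neg_distrib]
  refine Finset.sum_congr rfl fun i _ => ?_
  rw [sgn_swap, Sum.swap_swap, neg_smul, mul_comm]

theorem ham_x (f : TruncPoly p k (Fin m ⊕ Fin m)) (j : Fin m ⊕ Fin m) :
    ham f (x p k _ j) = sgn k j.swap • partialD p k _ j.swap f := by
  rw [ham_apply, Finset.sum_eq_single j.swap]
  · rw [Sum.swap_swap, partialD_x_self, mul_one]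
  · intro i _ hi
    rw [partialD_x_ne, mul_zero, smul_zero]
    rintro rfl
    exact hi (Sum.swap_swap i).symm
  · simp

theorem ham_self (f : TruncPoly p k (Fin m ⊕ Fin m)) (hp : p ≠ 2) : ham f f = 0 := by
  have h := ham_antisymm f f
  rw [eq_neg_iff_add_eq_zero, ← two_mul] at h
  have h2 : (2 : k) ≠ 0 := by
    have := (Fact.out : p.Prime).two_le
    exact_mod_cast natCast_ne_zero_of_lt (k := k) (n := 2) (p := p) (by omega) (by omega)
  have h3 : (2 : k) • ham f f = 0 := by
    rw [smul_eq_algebraMap_mul, map_ofNat, h]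
  exact (smul_eq_zero.mp h3).resolve_left h2

theorem ham_mul (f g : TruncPoly p k (Fin m ⊕ Fin m)) : ham (f * g) = f • ham g + g • ham f := by
  ext a
  rw [ham_antisymm, Derivation.leibniz, Derivation.add_apply, Derivation.smul_apply,
    Derivation.smul_apply, ham_antisymm g, ham_antisymm f]
  simp only [smul_eq_mul]
  ring

theorem ham_mul_apply (f g a : TruncPoly p k (Fin m ⊕ Fin m)) :
    ham (f * g) a = f * ham g a + g * ham f a := by
  rw [ham_mul]; rfl

theorem ham_pow (f : TruncPoly p k (Fin m ⊕ Fin m)) (n : ℕ) :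
    ham (f ^ (n + 1)) = f ^ n • ((n + 1 : k) • ham f) := by
  ext a
  rw [ham_antisymm, Derivation.leibniz_pow, ham_antisymm a f, Nat.add_sub_cancel,
    Derivation.smul_apply, Derivation.smul_apply, smul_eq_algebraMap_mul (n + 1 : k)]
  simp only [smul_eq_mul, nsmul_eq_mul, map_add, map_natCast, map_one]
  push_cast
  ring

theorem mem_hamiltonianFull {D : Witt p k (Fin m ⊕ Fin m)} : D ∈ hamiltonianFull p k m ↔
    ∀ i j, sgn k i • partialD p k _ j.swap (D (x p k _ i)) =
      sgn k j • partialD p k _ i.swap (D (x p k _ j)) := Iff.rfl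

theorem ham_mem_full (f : TruncPoly p k (Fin m ⊕ Fin m)) : ham f ∈ hamiltonianFull p k m := by
  intro i j
  rw [ham_x, ham_x, Derivation.map_smul, Derivation.map_smul, smul_smul, smul_smul, sgn_swap,
    sgn_swap, partialD_comm p j.swap, mul_neg, mul_neg, sgn_mul_self, sgn_mul_self]

theorem ham_x_eq (j : Fin m ⊕ Fin m) :
    ham (x p k _ j) = sgn k j • partialD p k (Fin m ⊕ Fin m) j.swap := by
  refine witt_ext p fun l => ?_
  rw [ham_x, Derivation.smul_apply, partialD_x, partialD_x]
  by_cases h : l = j.swap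
  · subst h; simp
  · have : j ≠ l.swap := by rintro rfl; simp at h
    simp [h, this]

theorem partialD_eq_ham (i : Fin m ⊕ Fin m) :
    partialD p k (Fin m ⊕ Fin m) i = sgn k i.swap • ham (x p k _ i.swap) := by
  rw [ham_x_eq, Sum.swap_swap, smul_smul, sgn_mul_self, one_smul]

theorem deriv_partialD_of_mem_full {D : Witt p k (Fin m ⊕ Fin m)} (hD : D ∈ hamiltonianFull p k m)
    (i j : Fin m ⊕ Fin m) : partialD p k _ j.swap (D (x p k _ i)) =
      (sgn k i * sgn k j) • partialD p k _ i.swap (D (x p k _ j)) := by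
  rw [mul_smul, ← mem_hamiltonianFull.mp hD i j, smul_smul, sgn_mul_self, one_smul]

/-- Elements of H(2m) are derivations of the Poisson bracket: the defining symmetry cancels the
terms in which a derivative falls on the coefficients of D. -/
theorem lie_ham {D : Witt p k (Fin m ⊕ Fin m)} (hD : D ∈ hamiltonianFull p k m)
    (f : TruncPoly p k (Fin m ⊕ Fin m)) : ⁅D, ham f⁆ = ham (D f) := by
  refine witt_ext p fun j => ?_
  rw [Derivation.commutator_apply, ham_x, ham_x, Derivation.map_smul, witt_apply p D f, map_sum,
    witt_apply p D (partialD p k _ j.swap f), ham_apply, Finset.smul_sum, Finset.smul_sum,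
    ← Finset.sum_sub_distrib]
  refine Finset.sum_congr rfl fun i _ => ?_
  rw [Derivation.leibniz, partialD_comm p i j.swap, deriv_partialD_of_mem_full hD i j, sgn_swap,
    smul_eq_mul, smul_eq_mul, smul_add, sub_eq_add_neg, mul_smul_comm, smul_smul]
  congr 1
  have : -sgn k j * (sgn k i * sgn k j) = - sgn k i := by
    linear_combination (- sgn k i) * sgn_mul_self (k := k) j
  rw [this, neg_smul]

/-- A commutator of derivations preserving the symplectic form is always Hamiltonian, with the
pairing of the two under the form as its function. -/
theorem lie_eq_ham {D E : Witt p k (Fin m ⊕ Fin m)} (hD : D ∈ hamiltonianFull p k m)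
    (hE : E ∈ hamiltonianFull p k m) :
    ⁅D, E⁆ = ham (∑ i, sgn k i • (D (x p k _ i) * E (x p k _ i.swap))) := by
  refine witt_ext p fun j => ?_
  rw [Derivation.commutator_apply, ham_x, map_sum, witt_apply p D (E _), witt_apply p E (D _),
    Finset.smul_sum, ← sum_swap (fun i => E (x p k _ i) * _), ← Finset.sum_sub_distrib]
  refine Finset.sum_congr rfl fun i _ => ?_
  have h2 := deriv_partialD_of_mem_full hE i.swap j
  rw [Sum.swap_swap, sgn_swap] at h2
  rw [Derivation.map_smul, Derivation.leibniz, deriv_partialD_of_mem_full hD i j, h2, sgn_swap]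
  simp only [smul_eq_mul, smul_add, mul_smul_comm, smul_smul]
  have e1 : -sgn k j * (sgn k i * (-sgn k i * sgn k j)) = 1 := by
    linear_combination (sgn k i * sgn k i) * sgn_mul_self (k := k) j + sgn_mul_self (k := k) i
  have e2 : -sgn k j * (sgn k i * (sgn k i * sgn k j)) = -1 := by
    linear_combination (-sgn k i * sgn k i) * sgn_mul_self (k := k) j - sgn_mul_self (k := k) i
  rw [e1, e2, one_smul, neg_smul, one_smul, sub_eq_add_neg]

/-- The symmetry condition for i and i' says that the two contributions to the divergence are
opposite, so D has divergence zero. Since D f is then a sum of partial derivatives, it contains no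
monomial of top degree. -/
theorem deriv_eq_sum_partialD {D : Witt p k (Fin m ⊕ Fin m)} (hp : p ≠ 2)
    (hD : D ∈ hamiltonianFull p k m) (f : TruncPoly p k (Fin m ⊕ Fin m)) :
    D f = ∑ i, partialD p k _ i (D (x p k _ i) * f) := by
  have h0 : ∑ i, partialD p k _ i (D (x p k _ i)) = 0 := by
    have h1 : ∑ i, partialD p k _ i (D (x p k _ i)) =
        - ∑ i, partialD p k _ i (D (x p k _ i)) := by
      conv_lhs => rw [← sum_swap]
      rw [← Finset.sum_neg_distrib]
      refine Finset.sum_congr rfl fun i _ => ?_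
      have := deriv_partialD_of_mem_full hD i.swap i
      rw [Sum.swap_swap, sgn_swap, neg_mul, sgn_mul_self, neg_smul, one_smul] at this
      exact this
    rw [eq_neg_iff_add_eq_zero, ← two_mul] at h1
    have h2 : (2 : k) ≠ 0 := by
      have := (Fact.out : p.Prime).two_le
      exact_mod_cast natCast_ne_zero_of_lt (k := k) (n := 2) (p := p) (by omega) (by omega)
    rw [← map_ofNat (algebraMap k (TruncPoly p k (Fin m ⊕ Fin m))), ← smul_eq_algebraMap_mul] at h1
    exact (smul_eq_zero.mp h1).resolve_left h2
  have h3 : ∑ i, f * partialD p k _ i (D (x p k _ i)) = 0 := by rw [← Finset.mul_sum, h0, mul_zero]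
  rw [witt_apply p D f, ← add_zero (∑ i, D _ * _), ← h3, ← Finset.sum_add_distrib]
  refine Finset.sum_congr rfl fun i _ => ?_
  rw [Derivation.leibniz, smul_eq_mul, smul_eq_mul]

/-- The span of the monomials of degree at least `s` below the top degree. -/
noncomputable abbrev MonLow (p : ℕ) (k : Type*) [Field k] (m s : ℕ) :
    Submodule k (TruncPoly p k (Fin m ⊕ Fin m)) :=
  Mon p k _ (Set.Ico s (topDeg p (Fin m ⊕ Fin m)))

theorem Fil_le_Icc {ι : Type*} [Fintype ι] (s : ℕ) :
    Fil p k ι s ≤ Mon p k ι (Set.Icc s (topDeg p ι)) := by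
  rw [Mon_le_iff]
  intro γ hγ
  by_cases h : γ.degree ≤ topDeg p ι
  · exact mon_mem ⟨hγ, h⟩
  · rw [mon_eq_zero_of_degree (by omega)]; exact zero_mem _

theorem deriv_mem_MonLow {D : Witt p k (Fin m ⊕ Fin m)} (hp : p ≠ 2)
    (hD : D ∈ hamiltonianFull p k m) {f : TruncPoly p k (Fin m ⊕ Fin m)} {s : ℕ}
    (h : ∀ i, D (x p k _ i) * f ∈ Fil p k _ s) : D f ∈ MonLow p k m (s - 1) := by
  rw [deriv_eq_sum_partialD hp hD]
  refine sum_mem fun i _ => partialD_Mon (fun t ht => ?_) i (Fil_le_Icc s (h i))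
  simp only [Set.mem_Icc, Set.mem_Ico] at *
  omega

theorem lie_partialD_ham (i : Fin m ⊕ Fin m) (f : TruncPoly p k (Fin m ⊕ Fin m)) :
    ⁅partialD p k _ i, ham f⁆ = ham (partialD p k _ i f) := by
  refine lie_ham ?_ f
  rw [partialD_eq_ham]
  exact (hamiltonianFull p k m).smul_mem _ (ham_mem_full _)

theorem x_mul_partialD_mon {ι : Type*} (i : ι) (γ : ι →₀ ℕ) :
    x p k ι i * partialD p k ι i (mon p k γ) = (γ i : k) • mon p k γ := by
  rw [partialD_mon, mul_smul_comm]
  by_cases h : γ i = 0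
  · simp [h]
  · rw [← pow_one (x p k ι i), ← mon_single, ← mon_add]
    congr 2
    classical
    ext j
    by_cases hj : i = j
    · subst hj; simp; omega
    · simp [hj]

theorem ham_mem_derived_succ {j : ℕ} (hd : ∀ i, partialD p k _ i ∈
      derivedSubalgebra (hamiltonianFull p k m) j) {γ : Fin m ⊕ Fin m →₀ ℕ}
    (hγ : γ.degree < topDeg p (Fin m ⊕ Fin m)) (h : ∀ δ : Fin m ⊕ Fin m →₀ ℕ,
      δ.degree = γ.degree + 1 → ham (mon p k δ) ∈ derivedSubalgebra (hamiltonianFull p k m) j) :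
    ham (mon p k γ) ∈ derivedSubalgebra (hamiltonianFull p k m) (j + 1) := by
  obtain ⟨i, δ, c, h1, hc, -, -, h2⟩ := mon_eq_partialD (p := p) (k := k) hγ
  have h3 := lie_mem_derivedSubalgebra_succ (hd i) (h δ h1)
  rw [lie_partialD_ham, h2, map_smul] at h3
  have := LieSubalgebra.smul_mem _ c⁻¹ h3
  rwa [smul_smul, inv_mul_cancel₀ hc, one_smul] at this

theorem ham_mem_derived_one {f : TruncPoly p k (Fin m ⊕ Fin m)} (hf : f ∈ MonLow p k m 0) :
    ham f ∈ derivedSubalgebra (hamiltonianFull p k m) 1 := by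
  have h : MonLow p k m 0 ≤
      (derivedSubalgebra (hamiltonianFull p k m) 1).toSubmodule.comap ham := by
    rw [Mon_le_iff]
    intro γ hγ
    refine ham_mem_derived_succ (j := 0) (fun i => mem_derivedSubalgebra_zero.mpr ?_) hγ.2
      (fun δ _ => mem_derivedSubalgebra_zero.mpr (ham_mem_full _))
    rw [partialD_eq_ham]
    exact (hamiltonianFull p k m).smul_mem _ (ham_mem_full _)
  exact h hf

/-- More than one degree below the top, x^γ is a partial derivative of a monomial whose Hamiltonian
derivation already lies in the first derived algebra. One degree below the top that monomial would
be the top one, so another bracket is needed: there all exponents are p - 1 except for one, γ i = p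
- 2. -/
theorem ham_mem_derived_two (hp : 3 ≤ p) (htop : 8 ≤ topDeg p (Fin m ⊕ Fin m))
    {f : TruncPoly p k (Fin m ⊕ Fin m)} (hf : f ∈ MonLow p k m 0) :
    ham f ∈ derivedSubalgebra (hamiltonianFull p k m) 2 := by
  have h : MonLow p k m 0 ≤
      (derivedSubalgebra (hamiltonianFull p k m) 2).toSubmodule.comap ham := by
    rw [Mon_le_iff]
    intro γ hγ
    by_cases hγ1 : γ.degree + 1 < topDeg p (Fin m ⊕ Fin m)
    · refine ham_mem_derived_succ (j := 1) (fun i => ?_) hγ.2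
        (fun δ hδ => ham_mem_derived_one (mon_mem ⟨Nat.zero_le _, by omega⟩))
      rw [partialD_eq_ham]
      refine LieSubalgebra.smul_mem _ _ (ham_mem_derived_one (Mon_mono ?_ (x_mem_Mon _)))
      simp only [Set.singleton_subset_iff, Set.mem_Ico]
      omega
    · have hγ2 : γ.degree + 1 = topDeg p (Fin m ⊕ Fin m) := by
        have : γ.degree < topDeg p (Fin m ⊕ Fin m) := hγ.2
        omega
      by_cases hred : ∃ i, p ≤ γ i
      · obtain ⟨i, hi⟩ := hred
        rw [mon_eq_zero hi]; exact zero_mem _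
      push Not at hred
      obtain ⟨i, hi⟩ : ∃ i, γ i < p - 1 := by
        by_contra! hc
        have : ∑ _i : Fin m ⊕ Fin m, (p - 1) ≤ ∑ i, γ i := Finset.sum_le_sum fun i _ => hc i
        rw [← degree_eq_sum'] at this
        simp [topDeg] at *
        omega
      have hsum : ∑ j ∈ Finset.univ.erase i, (p - 1 - γ j) + (p - 1 - γ i) = 1 := by
        rw [Finset.sum_erase_add _ _ (Finset.mem_univ i)]
        have h1 : ∑ j, (p - 1 - γ j) + ∑ j, γ j = topDeg p (Fin m ⊕ Fin m) := by
          rw [← Finset.sum_add_distrib, topDeg, ← smul_eq_mul, ← Finset.card_univ,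
            ← Finset.sum_const]
          exact Finset.sum_congr rfl fun j _ => by have := hred j; omega
        rw [← degree_eq_sum'] at h1
        omega
      have hi' : γ i = p - 2 := by omega
      have hother : γ i.swap = p - 1 := by
        have h1 : p - 1 - γ i.swap ≤ ∑ j ∈ Finset.univ.erase i, (p - 1 - γ j) :=
          Finset.single_le_sum (f := fun j => p - 1 - γ j) (fun _ _ => Nat.zero_le _)
            (Finset.mem_erase.mpr ⟨swap_ne i, Finset.mem_univ _⟩)
        have := hred i.swap
        omega
      set δ := γ - Finsupp.single i.swap 1 with hδ
      have hγδ : γ = δ + Finsupp.single i.swap 1 := by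
        rw [hδ, tsub_add_cancel_of_le]
        rw [Finsupp.single_le_iff]; omega
      have hδdeg : δ.degree + 1 = γ.degree := by
        conv_rhs => rw [hγδ]
        simp
      have hδi : δ i = p - 2 := by
        rw [hδ, Finsupp.tsub_apply, Finsupp.single_eq_of_ne (swap_ne i).symm, hi', Nat.sub_zero]
      have hδi' : δ i.swap = p - 2 := by
        rw [hδ, Finsupp.tsub_apply, Finsupp.single_eq_same, hother]; omega
      have hmul : mon p k δ * x p k _ i.swap = mon p k γ := by
        rw [hγδ, mon_add, mon_single, pow_one]
      -- Both exponents of δ at the pair i, i' equal p - 2. The two terms of the bracket have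
      -- coefficients 2(p-2) and p - 2 with opposite signs, so p - 2 survives, nonzero modulo p.
      have h1 : ham (x p k _ i * x p k _ i.swap ^ 2) (mon p k δ) =
          (-(sgn k i) * ((p - 2 : ℕ) : k)) • mon p k γ := by
        have e1 := x_mul_partialD_mon (p := p) (k := k) i δ
        have e2 := x_mul_partialD_mon (p := p) (k := k) i.swap δ
        rw [hδi] at e1
        rw [hδi'] at e2
        rw [pow_two, ham_mul_apply, ham_mul_apply, ham_x_eq, ham_x_eq, Sum.swap_swap, sgn_swap]
        simp only [Derivation.smul_apply, smul_eq_algebraMap_mul, map_neg, map_mul] at e1 e2 ⊢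
        rw [← hmul]
        linear_combination (-2 * algebraMap k _ (sgn k i) * x p k _ i.swap) * e1 +
          (algebraMap k _ (sgn k i) * x p k _ i.swap) * e2
      have hc : -(sgn k i) * ((p - 2 : ℕ) : k) ≠ 0 :=
        mul_ne_zero (neg_ne_zero.mpr (sgn_ne_zero i))
          (natCast_ne_zero_of_lt (p := p) (by omega) (by omega))
      have h3 : x p k _ i * x p k _ i.swap ^ 2 ∈ MonLow p k m 0 := by
        refine Mon_mul (S := {1}) (T := {2}) ?_ (x_mem_Mon _)
          (by simpa using pow_mem_Mon (x_mem_Mon _) 2)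
        rintro _ rfl _ rfl
        simp only [Set.mem_Ico]
        omega
      have h4 := lie_mem_derivedSubalgebra_succ (ham_mem_derived_one h3)
        (ham_mem_derived_one (mon_mem (p := p) (k := k) (γ := δ)
          (S := Set.Ico 0 (topDeg p (Fin m ⊕ Fin m))) ⟨Nat.zero_le _, by omega⟩))
      rw [lie_ham (ham_mem_full _), h1, map_smul] at h4
      have := LieSubalgebra.smul_mem _ (-(sgn k i) * ((p - 2 : ℕ) : k))⁻¹ h4
      rw [smul_smul, inv_mul_cancel₀ hc, one_smul] at this
      exact this
  exact h hf

/-- The derivations `D_f` with `f` a combination of monomials of degree at least `s` below the top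
degree. -/
noncomputable abbrev hamSpace (p : ℕ) (k : Type*) [Field k] [CharP k p] [Fact p.Prime] (m s : ℕ) :
    Submodule k (Witt p k (Fin m ⊕ Fin m)) := (MonLow p k m s).map ham

/-- The first derived algebra consists of Hamiltonian derivations. A bracket of two of its elements
is D_{D g} with D of divergence zero, and D g has no top-degree part. -/
theorem derived_two_le (hp : p ≠ 2) :
    (derivedSubalgebra (hamiltonianFull p k m) 2).toSubmodule ≤ hamSpace p k m 0 := by
  have h1 : (derivedSubalgebra (hamiltonianFull p k m) 1).toSubmodule ≤ LinearMap.range ham := by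
    refine derivedSubalgebra_succ_le fun D hD E hE => ?_
    rw [mem_derivedSubalgebra_zero] at hD hE
    exact ⟨_, (lie_eq_ham hD hE).symm⟩
  refine derivedSubalgebra_succ_le fun D hD E hE => ?_
  obtain ⟨g, rfl⟩ := h1 hE
  have hD' := derivedSubalgebra_le _ hD
  rw [lie_ham hD']
  exact ⟨_, deriv_mem_MonLow hp hD' (s := 0) fun i => by rw [Fil_zero]; trivial, rfl⟩

theorem hamSpace_le_wittFil (s : ℕ) : hamSpace p k m (s + 1) ≤ wittFil p k _ s := by
  rintro _ ⟨f, hf, rfl⟩ l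
  rw [ham_x]
  exact Submodule.smul_mem _ _ (partialD_Fil _ (Mon_mono (fun t ht => ht.1) hf))

theorem hamSpace_le_span {s : ℕ} (hs : s + 1 < topDeg p (Fin m ⊕ Fin m)) : hamSpace p k m s ≤
    Submodule.span k {D | ∃ i, ∃ y ∈ hamSpace p k m (s + 1), D = ⁅partialD p k (Fin m ⊕ Fin m) i, y⁆} ⊔
      hamSpace p k m (s + 1) := by
  rw [hamSpace, Submodule.map_le_iff_le_comap, Mon_le_iff]
  intro γ hγ
  rcases (show s ≤ γ.degree from hγ.1).eq_or_lt with h | h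
  · obtain ⟨i, δ, c, h1, hc, -, -, h2⟩ := mon_eq_partialD (p := p) (k := k) hγ.2
    refine Submodule.mem_sup_left ?_
    have : ham (mon p k γ) = c⁻¹ • ham (partialD p k _ i (mon p k δ)) := by
      rw [h2, map_smul, smul_smul, inv_mul_cancel₀ hc, one_smul]
    rw [this]
    refine Submodule.smul_mem _ _ (Submodule.subset_span ⟨i, ham (mon p k δ),
      ⟨_, mon_mem ⟨?_, ?_⟩, rfl⟩, (lie_partialD_ham i (mon p k δ)).symm⟩) <;> omega
  · exact Submodule.mem_sup_right ⟨_, mon_mem ⟨h, hγ.2⟩, rfl⟩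

/-- If (D u)(0) ≠ 0, applying ad D to D_{u^(p-1)} p - 2 times leaves a nonzero multiple of the
constant part of D_u. Suitable linear forms u give all directions. -/
theorem transitive_of_ham_pow (hp : 3 ≤ p) {M : LieSubalgebra k (Witt p k (Fin m ⊕ Fin m))}
    (hM : ¬ M ≤ isotropy p k _)
    (h : ∀ u ∈ Mon p k (Fin m ⊕ Fin m) {1}, ham (u ^ (p - 1)) ∈ M) :
    M.toSubmodule.map (evalZero p k _) = ⊤ := by
  obtain ⟨D, hD, hD0⟩ := SetLike.not_le_iff_exists.mp hM
  rw [mem_isotropy] at hD0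
  push Not at hD0
  obtain ⟨i, hi⟩ := hD0
  set V := M.toSubmodule.map (evalZero p k (Fin m ⊕ Fin m)) with hV
  have hp2 : p - 1 = (p - 2) + 1 := by omega
  have key : ∀ u ∈ Mon p k (Fin m ⊕ Fin m) {1}, aug p k _ (D u) ≠ 0 →
      evalZero p k _ (ham u) ∈ V := by
    intro u hu hDu
    have hu0 : aug p k _ u = 0 := mem_Fil_one.mp (Mon_mono (by simp) hu)
    have h1 : ∀ j, ham (u ^ (p - 1)) (x p k _ j) ∈ Fil p k _ (p - 2) := by
      intro j
      rw [hp2, ham_pow, Derivation.smul_apply, smul_eq_mul]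
      exact Fil_mul_right _ (Mon_mono (by simp) (pow_mem_Mon hu (p - 2)))
    have h2 : evalZero p k _ ((fun y => ⁅D, y⁆)^[p - 2] (ham (u ^ (p - 1)))) ∈ V :=
      ⟨_, ad_iterate_mem M hD (h u hu) _, rfl⟩
    have h3 : evalZero p k _ ((fun y => ⁅D, y⁆)^[p - 2] (ham (u ^ (p - 1)))) =
        (((p - 2).factorial : k) * aug p k _ (D u) ^ (p - 2) * ((p - 2 : ℕ) + 1)) •
          evalZero p k _ (ham u) := by
      ext j
      rw [evalZero_ad_iterate D _ h1, hp2, ham_pow, Derivation.smul_apply, smul_eq_mul,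
        aug_iterate_pow_mul D hu0, Derivation.smul_apply, map_smul]
      simp [mul_assoc]
    rw [h3] at h2
    refine (Submodule.smul_mem_iff _ (mul_ne_zero (mul_ne_zero (factorial_ne_zero_of_lt (p := p) ?_)
      (pow_ne_zero _ hDu)) ?_)).mp h2
    · omega
    · exact_mod_cast natCast_ne_zero_of_lt (k := k) (p := p) (n := p - 2 + 1) (by omega) (by omega)
  have key2 : ∀ l, evalZero p k _ (ham (x p k _ l)) ∈ V := by
    intro l
    by_cases hl : aug p k _ (D (x p k _ l)) = 0
    -- When D kills x_l to leading order, the form x_i + x_l is used instead, and the direction from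
    -- x_i is subtracted.
    · have h1 := key _ (add_mem (x_mem_Mon i) (x_mem_Mon l)) (by
        rw [map_add, map_add, hl, add_zero]; exact hi)
      rw [map_add, map_add] at h1
      exact (Submodule.add_mem_iff_right _ (key _ (x_mem_Mon i) hi)).mp h1
    · exact key _ (x_mem_Mon l) hl
  rw [eq_top_iff]
  intro v _
  rw [← Finset.univ_sum_single v]
  refine sum_mem fun l _ => ?_
  have h1 := key2 l.swap
  have h2 : (Pi.single l (v l) : Fin m ⊕ Fin m → k) =
      (v l * sgn k l.swap) • evalZero p k _ (ham (x p k _ l.swap)) := by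
    ext j
    rw [ham_x_eq, Sum.swap_swap, Pi.smul_apply, evalZero_apply, Derivation.smul_apply, partialD_x]
    by_cases hj : j = l
    · subst hj
      simp [mul_assoc, sgn_mul_self]
    · simp [hj]
  rw [h2]
  exact V.smul_mem _ h1

theorem eq_of_ham_eq_zero {f : TruncPoly p k (Fin m ⊕ Fin m)} (h : ham f = 0) :
    f = algebraMap k _ (aug p k _ f) := by
  refine eq_algebraMap_of_partialD_eq_zero fun i => ?_
  have h1 := DFunLike.congr_fun h (x p k _ i.swap)
  rw [ham_x, Sum.swap_swap, Derivation.zero_apply] at h1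
  exact (smul_eq_zero.mp h1).resolve_left (sgn_ne_zero i)

end Hamiltonian

/-! ### Identities for derivations with square-zero or cube-zero coefficients. -/

section SquareZero

variable {k A : Type*} [Field k] [CommRing A] [Algebra k A]

theorem derivation_ofNat (D : Derivation k A A) (n : ℕ) [n.AtLeastTwo] :
    D (OfNat.ofNat n : A) = 0 := by
  rw [← Nat.cast_ofNat]; exact D.map_natCast _

/-- Applied with U = D_u, V = D_F and Q = D_{4u²F} in characteristic 3. -/
theorem apply_apply_eq_zero_of_cube_of_sq {U V Q : Derivation k A A} {u F : A}
    (hQ : ∀ a, Q a = 4 * (u ^ 2 * V a + F * (2 * u * U a))) (hUu : U u = 0) (hVu : V u = 0)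
    (hUF : U F = 0) (hVF : V F = 0) (hu : u ^ 3 = 0) (hF : F ^ 2 = 0) (g : A) : Q (Q g) = 0 := by
  rw [hQ, hQ]
  simp only [Derivation.leibniz, map_add, smul_eq_mul, derivation_ofNat U 2,
    derivation_ofNat V 2, derivation_ofNat U 4, derivation_ofNat V 4, hVF, hUF, hVu, hUu,
    pow_two, mul_zero, add_zero]
  linear_combination (16 * u * V (V g) + 32 * F * V (U g) +
    32 * F * U (V g)) * hu + 64 * u ^ 2 * U (U g) * hF

/-- Applied with U = D_a, V = D_c and Q = D_{a²c²} for Poisson-commuting variables a and c in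
characteristic 3. -/
theorem apply_apply_eq_zero_of_cube_of_cube {U V Q : Derivation k A A} {a c : A}
    (hQ : ∀ g, Q g = 2 * a ^ 2 * c * V g + 2 * c ^ 2 * a * U g) (hUa : U a = 0) (hUc : U c = 0)
    (hVa : V a = 0) (hVc : V c = 0) (ha : a ^ 3 = 0) (hc : c ^ 3 = 0) (g : A) : Q (Q g) = 0 := by
  rw [hQ, hQ]
  simp only [Derivation.leibniz, map_add, smul_eq_mul, derivation_ofNat U 2,
    derivation_ofNat V 2, hUa, hUc, hVa, hVc,
    pow_two, mul_zero, add_zero, zero_add]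
  linear_combination (4 * a * c ^ 2 * V (V g) + 4 * c ^ 3 * V (U g) +
      4 * c ^ 3 * U (V g)) * ha + (4 * a ^ 2 * c * U (U g)) * hc

/-- Applying U twice to (U f)² = 0 gives 2(U U f)² plus terms containing U³ f. -/
theorem sq_apply_apply_eq_zero {U : Derivation k A A} (h2 : (2 : k) ≠ 0) {f : A}
    (hf : U f ^ 2 = 0) (hU : U (U (U f)) = 0) : U (U f) ^ 2 = 0 := by
  have h := congrArg (fun a => U (U a)) hf
  simp only [pow_two, Derivation.leibniz, smul_eq_mul, map_add, map_zero, hU] at h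
  have h3 : (2 : k) • U (U f) ^ 2 = 0 := by
    rw [Algebra.smul_def, map_ofNat, ← h]
    ring
  exact (smul_eq_zero.mp h3).resolve_left h2

theorem apply_apply_mul_eq {U Q : Derivation k A A} {u : A} (hQ : ∀ a, Q a = 2 * u * U a)
    (hu : U u = 0) (f : A) : Q (Q f) = 4 * (u ^ 2 * U (U f)) := by
  rw [hQ, hQ, Derivation.leibniz, Derivation.leibniz, hu, derivation_ofNat]
  simp only [smul_eq_mul, mul_zero, add_zero]
  ring

theorem apply_apply_sq_mul_sq (D : Derivation k A A) (a c : A) :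
    D (D (a ^ 2 * c ^ 2)) =
      c ^ 2 * D (D (a ^ 2)) + a * (8 * c * D a * D c + a * D (D (c ^ 2))) := by
  simp only [pow_two, Derivation.leibniz, smul_eq_mul, map_add]
  ring

theorem apply_apply_sq (D : Derivation k A A) (a : A) :
    D (D (a ^ 2)) = 2 * D a ^ 2 + 2 * a * D (D a) := by
  simp only [pow_two, Derivation.leibniz, smul_eq_mul, map_add]
  ring

theorem apply_apply_sq_mul (D : Derivation k A A) {c : A} (hc : D c = 1) (v : A) :
    D (D (c ^ 2 * v)) = 2 * v + c * (4 * D v + c * D (D v)) := by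
  simp only [pow_two, Derivation.leibniz, smul_eq_mul, map_add, hc, Derivation.map_one_eq_zero]
  ring

end SquareZero

/-! ### Invariance of the isotropy algebra for H(2m)^(2). -/

section HamiltonianInvariance

variable {p : ℕ} {k : Type*} [Field k] [CharP k p] [Fact p.Prime] {m : ℕ}

theorem two_ne_zero_of_ne (hp : p ≠ 2) : (2 : k) ≠ 0 := by
  have := (Fact.out : p.Prime).two_le
  exact_mod_cast natCast_ne_zero_of_lt (k := k) (n := 2) (p := p) (by omega) (by omega)

theorem mem_MonLow_zero {d : ℕ} {u : TruncPoly p k (Fin m ⊕ Fin m)} (hu : u ∈ Mon p k _ {d})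
    (hd : d < topDeg p (Fin m ⊕ Fin m)) : u ∈ MonLow p k m 0 :=
  Mon_mono (by simpa using hd) hu

theorem le_of_ham_pow_mem (hp : 3 ≤ p) (htop : 8 ≤ topDeg p (Fin m ⊕ Fin m))
    {M : LieSubalgebra k (Witt p k (Fin m ⊕ Fin m))}
    (hML : M ≤ derivedSubalgebra (hamiltonianFull p k m) 2)
    (hCM : sandwich (derivedSubalgebra (hamiltonianFull p k m) 2) ⊆ M)
    (hM : ¬ M ≤ isotropy p k _)
    (h : ∀ u ∈ Mon p k (Fin m ⊕ Fin m) {1}, ham (u ^ (p - 1)) ∈ M) :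
    derivedSubalgebra (hamiltonianFull p k m) 2 ≤ M := by
  refine le_of_filtration hML (transitive_of_ham_pow hp hM h) (fun i => ?_) (hamSpace p k m)
    (topDeg p (Fin m ⊕ Fin m) - 1) ?_ (fun s hs => hamSpace_le_span (by omega)) ?_
    (derived_two_le (by omega))
  · rw [partialD_eq_ham]
    exact LieSubalgebra.smul_mem _ _
      (ham_mem_derived_two hp htop (mem_MonLow_zero (x_mem_Mon _) (by omega)))
  · rintro _ ⟨f, hf, rfl⟩
    -- A function of order `topDeg - 1` gives a derivation of order `topDeg - 2`, which is s + 1.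
    -- The sandwich condition then needs a top degree above 6.
    refine hCM (mem_sandwich_of_Fil (s := topDeg p (Fin m ⊕ Fin m) - 3)
      (ham_mem_derived_two hp htop (Mon_mono (Set.Ico_subset_Ico_left (Nat.zero_le _)) hf)) ?_
      (by omega))
    have e : topDeg p (Fin m ⊕ Fin m) - 3 + 1 + 1 = topDeg p (Fin m ⊕ Fin m) - 1 := by omega
    refine hamSpace_le_wittFil _ ?_
    rw [e]
    exact ⟨f, hf, rfl⟩
  · rintro s hs D hD hD0 _ ⟨f, hf, rfl⟩
    have hD' := derivedSubalgebra_le _ hD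
    rw [lie_ham hD']
    refine ⟨_, ?_, rfl⟩
    -- An isotropy element contributes order 1 and f order s + 1; one order is lost in writing D f
    -- as a sum of derivatives.
    have := deriv_mem_MonLow (s := s + 2) (by omega) hD' (f := f) (fun i => ?_)
    · exact this
    · have h1 := Fil_mul (mem_Fil_one.mpr (hD0 i)) (Mon_mono (fun t ht => ht.1) hf)
      exact Fil_anti (by omega) h1

theorem sandwich_subset_isotropy_ham (hp : 3 ≤ p) (htop : 8 ≤ topDeg p (Fin m ⊕ Fin m)) :
    sandwich (derivedSubalgebra (hamiltonianFull p k m) 2) ⊆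
      (isotropy p k (Fin m ⊕ Fin m) : Set (Witt p k (Fin m ⊕ Fin m))) := by
  refine sandwich_subset_isotropy (by omega) fun i => ?_
  have hmem : x p k _ i ^ 2 * x p k _ i.swap ∈ Mon p k (Fin m ⊕ Fin m) {3} := by
    refine Mon_mul (S := {2}) (T := {1}) ?_ (by simpa using pow_mem_Mon (x_mem_Mon _) 2)
      (x_mem_Mon _)
    rintro _ rfl _ rfl
    rfl
  refine ⟨_, ham_mem_derived_two hp htop (mem_MonLow_zero hmem (by omega)), fun j => ?_, i,
    sgn k i.swap, sgn_ne_zero _, ?_⟩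
  · rw [ham_x]
    exact Submodule.smul_mem _ _ (partialD_Mon (by simp) _ hmem)
  · rw [ham_x, Derivation.leibniz, Derivation.leibniz_pow, partialD_x_self,
      partialD_x_ne (swap_ne i).symm]
    simp

theorem mem_sandwich_of_ham_sq {f : TruncPoly p k (Fin m ⊕ Fin m)} (hp : p ≠ 2)
    (hf : ham f ∈ derivedSubalgebra (hamiltonianFull p k m) 2) (h : ∀ g, ham f (ham f g) = 0) :
    ham f ∈ sandwich (derivedSubalgebra (hamiltonianFull p k m) 2) := by
  refine ⟨hf, fun y hy => ?_⟩
  obtain ⟨g, -, rfl⟩ := derived_two_le hp hy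
  rw [lie_ham (ham_mem_full f), lie_ham (ham_mem_full f), h, map_zero]

/-- D_{u^(p-1)} is a multiple of u^(p-2) D_u, which is a sandwich element once p < 2(p-2), that is,
for p ≥ 5. -/
theorem isotropy_invariant_ham_of_five_le (hp : 5 ≤ p) (htop : 8 ≤ topDeg p (Fin m ⊕ Fin m))
    (hm : 1 ≤ m) (g : derivedSubalgebra (hamiltonianFull p k m) 2 ≃ₗ⁅k⁆
      derivedSubalgebra (hamiltonianFull p k m) 2)
    (D : derivedSubalgebra (hamiltonianFull p k m) 2)
    (hD : (D : Witt p k (Fin m ⊕ Fin m)) ∈ isotropy p k _) :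
    (g D : Witt p k (Fin m ⊕ Fin m)) ∈ isotropy p k _ := by
  have hp1 : p - 1 < topDeg p (Fin m ⊕ Fin m) := by
    rw [topDeg, Fintype.card_sum, Fintype.card_fin]
    calc p - 1 < 2 * (p - 1) := by omega
      _ ≤ _ := Nat.mul_le_mul_right _ (by omega)
  refine isotropy_invariant (sandwich _) (fun _ h => h.1) (fun g c => sandwich_invariant g c)
    (sandwich_subset_isotropy_ham (by omega) htop) (fun h => ?_) (fun M hML hCM hM => ?_) g D hD
  · refine partialD_notMem_isotropy (Sum.inl ⟨0, by omega⟩) (h (x := partialD p k _ _) ?_)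
    rw [partialD_eq_ham]
    exact LieSubalgebra.smul_mem _ _
      (ham_mem_derived_two (by omega) htop (mem_MonLow_zero (x_mem_Mon _) (by omega)))
  · refine le_of_ham_pow_mem (by omega) htop hML hCM hM fun u hu => hCM ?_
    have h1 : ham (u ^ (p - 1)) ∈ derivedSubalgebra (hamiltonianFull p k m) 2 :=
      ham_mem_derived_two (by omega) htop
        (mem_MonLow_zero (by simpa using pow_mem_Mon hu (p - 1)) hp1)
    have e : p - 1 = (p - 2) + 1 := by omega
    rw [e, ham_pow] at h1 ⊢
    refine mem_sandwich_of_pow_smul (mem_Fil_one.mp (Mon_mono (by simp) hu)) ?_ (by omega) h1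
    rw [Derivation.smul_apply, ham_self _ (by omega), smul_zero]

/-- Linear forms `u` satisfy `{f, u}² = 0` whenever `D_f` is a sandwich element. -/
theorem sandwich_apply_sq_eq_zero (hp : 3 ≤ p) (htop : 8 ≤ topDeg p (Fin m ⊕ Fin m))
    {c : Witt p k (Fin m ⊕ Fin m)} (hc : c ∈ sandwich (derivedSubalgebra (hamiltonianFull p k m) 2))
    {u : TruncPoly p k (Fin m ⊕ Fin m)} (hu : u ∈ Mon p k _ {1}) : c u ^ 2 = 0 := by
  have hc0 := sandwich_subset_isotropy_ham hp htop hc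
  have hcf := derivedSubalgebra_le _ hc.1
  have hu0 : u ∈ Fil p k _ 1 := Mon_mono (by simp) hu
  have hcu : aug p k _ (c u) = 0 := by
    have := deriv_Fil (fun i => mem_Fil_one.mpr (hc0 i)) (t := 0) hu0
    exact mem_Fil_one.mp this
  -- The double bracket of c with D_v is D_{c(c v)}. Its vanishing makes c(c v) constant.
  have key : ∀ d : ℕ, d < topDeg p (Fin m ⊕ Fin m) → ∀ v ∈ Mon p k (Fin m ⊕ Fin m) {d},
      c (c v) = algebraMap k _ (aug p k _ (c (c v))) := by
    intro d hd v hv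
    have := hc.2 _ (ham_mem_derived_two hp htop (mem_MonLow_zero hv hd))
    rw [lie_ham hcf, lie_ham hcf] at this
    exact eq_of_ham_eq_zero this
  have h1 := key 1 (by omega) u hu
  have h2 := key 2 (by omega) (u ^ 2) (by simpa using pow_mem_Mon hu 2)
  set κ := aug p k _ (c (c u)) with hκ
  have h3 : c (c (u ^ 2)) = 2 * c u ^ 2 + 2 * u * c (c u) := by
    simp only [pow_two, Derivation.leibniz, smul_eq_mul, map_add]
    ring
  have h4 : aug p k _ (c (c (u ^ 2))) = 0 := by
    rw [h3]
    simp [hcu, mem_Fil_one.mp hu0]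
  rw [h4, map_zero, h3, h1] at h2
  have h5 : c u ^ 2 = -(κ • u) := by
    have h6 : (2 : k) • (c u ^ 2 + κ • u) = 0 := by
      rw [smul_eq_algebraMap_mul, smul_eq_algebraMap_mul, map_ofNat, ← h2]
      ring
    exact eq_neg_of_add_eq_zero_left
      ((smul_eq_zero.mp h6).resolve_left (two_ne_zero_of_ne (by omega)))
  by_cases hκ0 : κ = 0
  · rw [h5, hκ0, zero_smul, neg_zero]
  -- Now (c u)² = -κu. The left side is the square of an element of the maximal ideal and has no
  -- linear part, so for κ ≠ 0 the linear form u must vanish.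
  have h7 : ∀ i, partialD p k _ i u = 0 := by
    intro i
    have h8 := congrArg (fun a => aug p k _ (partialD p k _ i a)) h5
    simp only [Derivation.leibniz_pow, map_neg, Derivation.map_smul, map_smul] at h8
    have h9 : aug p k _ (partialD p k _ i u) = 0 := by
      simpa [hcu, hκ0] using h8
    have h10 : partialD p k _ i u ∈ Mon p k (Fin m ⊕ Fin m) {0} :=
      partialD_Mon (fun s hs => by simpa using hs) i hu
    have h11 : Mon p k (Fin m ⊕ Fin m) {0} ≤ Submodule.span k {1} := by
      rw [Mon_le_iff]
      intro γ hγ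
      have : γ = 0 := (Finsupp.degree_eq_zero_iff γ).mp hγ
      rw [this, mon_zero]
      exact Submodule.mem_span_singleton_self _
    obtain ⟨a, ha⟩ := Submodule.mem_span_singleton.mp (h11 h10)
    rw [← ha] at h9 ⊢
    rw [map_smul, map_one, smul_eq_mul, mul_one] at h9
    rw [h9, zero_smul]
  have h8 := eq_algebraMap_of_partialD_eq_zero h7
  rw [mem_Fil_one.mp hu0, map_zero] at h8
  rw [h8]; simp

/-- The cube of a derivation is a derivation in characteristic 3, and D_u for a linear form u has
constant coefficients, so the cube kills all generators. -/
theorem ham_cube_eq_zero (hp : p = 3) {u : TruncPoly p k (Fin m ⊕ Fin m)}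
    (hu : u ∈ Mon p k _ {1}) (a : TruncPoly p k (Fin m ⊕ Fin m)) :
    ham u (ham u (ham u a)) = 0 := by
  have h3 : (3 : TruncPoly p k (Fin m ⊕ Fin m)) = 0 := by
    have h := CharP.cast_eq_zero (TruncPoly p k (Fin m ⊕ Fin m)) p
    have e : ((p : ℕ) : TruncPoly p k (Fin m ⊕ Fin m)) = ((3 : ℕ) : TruncPoly p k (Fin m ⊕ Fin m)) :=
      congrArg _ hp
    rw [e] at h
    exact_mod_cast h
  let E : Witt p k (Fin m ⊕ Fin m) := Derivation.mk'
    ((ham u : TruncPoly p k (Fin m ⊕ Fin m) →ₗ[k] TruncPoly p k (Fin m ⊕ Fin m)) ∘ₗ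
      (ham u : TruncPoly p k (Fin m ⊕ Fin m) →ₗ[k] TruncPoly p k (Fin m ⊕ Fin m)) ∘ₗ
      (ham u : TruncPoly p k (Fin m ⊕ Fin m) →ₗ[k] TruncPoly p k (Fin m ⊕ Fin m))) (by
    intro a b
    simp only [LinearMap.comp_apply, Derivation.coeFn_coe, Derivation.leibniz, map_add, smul_eq_mul]
    linear_combination (ham u a * ham u (ham u b) + ham u b * ham u (ham u a)) * h3)
  have hE : E = 0 := by
    refine witt_ext p fun i => ?_
    change ham u (ham u (ham u (x p k _ i))) = 0
    have h10 : partialD p k _ i.swap u ∈ Mon p k (Fin m ⊕ Fin m) {0} :=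
      partialD_Mon (fun s hs => by simpa using hs) _ hu
    have h11 : Mon p k (Fin m ⊕ Fin m) {0} ≤ Submodule.span k {1} := by
      rw [Mon_le_iff]
      intro γ hγ
      have : γ = 0 := (Finsupp.degree_eq_zero_iff γ).mp hγ
      rw [this, mon_zero]
      exact Submodule.mem_span_singleton_self _
    obtain ⟨a, ha⟩ := Submodule.mem_span_singleton.mp (h11 h10)
    rw [ham_x, ← ha]
    simp
  exact DFunLike.congr_fun hE a

/-- The elements of `L` whose squared adjoint action preserves the set of sandwich elements. -/
def sandwichStabilizer {ι : Type*} [Fintype ι] (L : LieSubalgebra k (Witt p k ι)) :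
    Set (Witt p k ι) :=
  {y | y ∈ L ∧ ∀ c ∈ sandwich L, ⁅y, ⁅y, c⁆⁆ ∈ sandwich L}

theorem sandwichStabilizer_invariant {ι : Type*} [Fintype ι] {L : LieSubalgebra k (Witt p k ι)}
    (g : L ≃ₗ⁅k⁆ L) (y : L) (hy : (y : Witt p k ι) ∈ sandwichStabilizer L) :
    (g y : Witt p k ι) ∈ sandwichStabilizer L := by
  refine ⟨(g y).2, fun c hc => ?_⟩
  have h1 := sandwich_invariant g.symm ⟨c, hc.1⟩ hc
  have h2 := hy.2 _ h1
  have h3 := sandwich_invariant g ⁅y, ⁅y, g.symm ⟨c, hc.1⟩⁆⁆ h2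
  rw [LieEquiv.map_lie, LieEquiv.map_lie, LieEquiv.apply_symm_apply] at h3
  exact h3

-- For p = 3 the criterion placing D_{u^(p-1)} among the sandwich elements no longer applies. Its
-- squared adjoint action sends D_f to D_{4u²F} with F = {u, {u, f}}. If D_f is a sandwich element,
-- then {u, f}² = 0, hence F² = 0; together with u³ = 0 and {u, F} = 0 this makes D_{4u²F} a
-- sandwich element.
set_option maxHeartbeats 1000000 in
theorem ham_sq_mem_sandwichStabilizer (hp : p = 3) (htop : 8 ≤ topDeg p (Fin m ⊕ Fin m))
    {u : TruncPoly p k (Fin m ⊕ Fin m)} (hu : u ∈ Mon p k _ {1}) :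
    ham (u ^ 2) ∈ sandwichStabilizer (derivedSubalgebra (hamiltonianFull p k m) 2) := by
  have hL : ham (u ^ 2) ∈ derivedSubalgebra (hamiltonianFull p k m) 2 :=
    ham_mem_derived_two (by omega) htop
      (mem_MonLow_zero (by simpa using pow_mem_Mon hu 2) (by omega))
  refine ⟨hL, fun c hc => ?_⟩
  obtain ⟨f, -, rfl⟩ := derived_two_le (by omega) hc.1
  have h1 : ham u f ^ 2 = 0 := by
    have h := sandwich_apply_sq_eq_zero (by omega) htop hc hu
    rw [ham_antisymm] at h
    linear_combination h
  have hu3 : u ^ 3 = 0 := by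
    rw [← hp]; exact pow_p_eq_zero (mem_Fil_one.mp (Mon_mono (by simp) hu))
  have hcube := ham_cube_eq_zero hp hu
  have huu : ham u u = 0 := ham_self u (by omega)
  have hsq : ∀ a, ham (u ^ 2) a = 2 * u * ham u a := by
    intro a
    rw [pow_two, ham_mul_apply]; ring
  set F := ham u (ham u f) with hF
  have hF2 : F ^ 2 = 0 := sq_apply_apply_eq_zero (two_ne_zero_of_ne (p := p) (by omega)) h1 (hcube f)
  have hmem : ⁅ham (u ^ 2), ⁅ham (u ^ 2), ham f⁆⁆ ∈ derivedSubalgebra (hamiltonianFull p k m) 2 :=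
    LieSubalgebra.lie_mem _ hL (LieSubalgebra.lie_mem _ hL hc.1)
  rw [lie_ham (ham_mem_full _), lie_ham (ham_mem_full _)] at hmem ⊢
  have e : ham (u ^ 2) (ham (u ^ 2) f) = 4 * (u ^ 2 * F) := apply_apply_mul_eq hsq huu f
  refine mem_sandwich_of_ham_sq (by omega) hmem fun g => ?_
  have hFF : ham F F = 0 := ham_self F (by omega)
  have huF : ham u F = 0 := hcube f
  have hFu : ham F u = 0 := by rw [ham_antisymm, huF, neg_zero]
  have e2 : ∀ a, ham (4 * (u ^ 2 * F)) a = 4 * (u ^ 2 * ham F a + F * (2 * u * ham u a)) := by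
    intro a
    rw [ham_mul_apply, ham_mul_apply, hsq]
    have : ham (4 : TruncPoly p k (Fin m ⊕ Fin m)) a = 0 := by
      rw [ham_antisymm, derivation_ofNat, neg_zero]
    rw [this]; ring
  rw [e]
  exact apply_apply_eq_zero_of_cube_of_sq e2 huu hFu huF hFF hu3 hF2 g

/-- Suppose (D x_i)(0) ≠ 0. As m ≥ 2, there is a variable x_b different from x_i and its conjugate,
and D_{x_i² x_b²} is a sandwich element. Then D_h with h = D²(x_i² x_b²) is one too, which forces
(∂_b h)² = 0 and (∂_b h)(0) = 0, hence (∂_b² h)(0) = 0. But this constant is 4(D x_i)(0)². -/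
theorem sandwichStabilizer_subset_isotropy (hp : p = 3) (hm : 2 ≤ m)
    (htop : 8 ≤ topDeg p (Fin m ⊕ Fin m)) :
    sandwichStabilizer (derivedSubalgebra (hamiltonianFull p k m) 2) ⊆
      (isotropy p k (Fin m ⊕ Fin m) : Set (Witt p k (Fin m ⊕ Fin m))) := by
  rintro D ⟨hD, hDs⟩ i
  by_contra hi
  obtain ⟨b, hbi, hbi'⟩ : ∃ b : Fin m ⊕ Fin m, b ≠ i ∧ b ≠ i.swap := by
    obtain ⟨j, hj⟩ := Finset.exists_mem_notMem_of_card_lt_card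
      (s := ({i, i.swap} : Finset (Fin m ⊕ Fin m))) (t := Finset.univ)
      (lt_of_le_of_lt Finset.card_le_two (by simp; omega))
    exact ⟨j, by simpa using hj.2⟩
  set a := x p k (Fin m ⊕ Fin m) i with ha
  set c := x p k (Fin m ⊕ Fin m) b with hc
  have hmem : a ^ 2 * c ^ 2 ∈ Mon p k (Fin m ⊕ Fin m) {4} := by
    refine Mon_mul (S := {2}) (T := {2}) ?_ (by simpa using pow_mem_Mon (x_mem_Mon _) 2)
      (by simpa using pow_mem_Mon (x_mem_Mon _) 2)
    rintro _ rfl _ rfl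
    rfl
  have hac : ham a c = 0 := by
    rw [ham_x_eq, Derivation.smul_apply, partialD_x_ne hbi', smul_zero]
  have hca : ham c a = 0 := by rw [ham_antisymm, hac, neg_zero]
  have haa : ham a a = 0 := ham_self a (by omega)
  have hcc : ham c c = 0 := ham_self c (by omega)
  have ha3 : a ^ 3 = 0 := by rw [← hp]; exact pow_p_eq_zero (aug_x i)
  have hc3 : c ^ 3 = 0 := by rw [← hp]; exact pow_p_eq_zero (aug_x b)
  have hsand : ham (a ^ 2 * c ^ 2) ∈ sandwich (derivedSubalgebra (hamiltonianFull p k m) 2) := by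
    refine mem_sandwich_of_ham_sq (by omega)
      (ham_mem_derived_two (by omega) htop (mem_MonLow_zero hmem (by omega))) fun g => ?_
    have e : ∀ g, ham (a ^ 2 * c ^ 2) g = 2 * a ^ 2 * c * ham c g + 2 * c ^ 2 * a * ham a g := by
      intro g
      rw [pow_two, pow_two, ham_mul_apply, ham_mul_apply, ham_mul_apply]; ring
    exact apply_apply_eq_zero_of_cube_of_cube e haa hac hca hcc ha3 hc3 g
  have h1 := hDs _ hsand
  have hDf := derivedSubalgebra_le _ hD
  rw [lie_ham hDf, lie_ham hDf] at h1
  set h := D (D (a ^ 2 * c ^ 2)) with hh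
  have h2 := sandwich_apply_sq_eq_zero (by omega) htop h1 (x_mem_Mon b.swap)
  have h3 := sandwich_subset_isotropy_ham (by omega) htop h1 b.swap
  rw [ham_x, Sum.swap_swap] at h2 h3
  rw [map_smul, smul_eq_mul] at h3
  have h3' := (mul_eq_zero.mp h3).resolve_left (sgn_ne_zero b)
  rw [smul_pow] at h2
  have h2' := (smul_eq_zero.mp h2).resolve_left (pow_ne_zero _ (sgn_ne_zero b))
  have h4 : aug p k _ (partialD p k _ b (partialD p k _ b h)) = 0 := by
    have h5 := congrArg (fun a => aug p k _ (partialD p k _ b (partialD p k _ b a))) h2'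
    simp only [pow_two, Derivation.leibniz, smul_eq_mul, map_add, map_zero, map_mul, h3', zero_mul,
      mul_zero, zero_add, add_zero] at h5
    rw [← two_mul] at h5
    exact mul_self_eq_zero.mp ((mul_eq_zero.mp h5).resolve_left (two_ne_zero_of_ne (by omega)))
  have hb1 : partialD p k _ b c = 1 := partialD_x_self b
  have hb0 : partialD p k _ b a = 0 := partialD_x_ne hbi.symm
  have hA : ∀ v : TruncPoly p k (Fin m ⊕ Fin m),
      aug p k _ (partialD p k _ b (partialD p k _ b (c ^ 2 * v))) = 2 * aug p k _ v := by
    intro v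
    rw [apply_apply_sq_mul _ hb1, map_add, map_mul, map_mul, map_ofNat, hc, aug_x, zero_mul,
      add_zero]
  have hB : ∀ v : TruncPoly p k (Fin m ⊕ Fin m),
      aug p k _ (partialD p k _ b (partialD p k _ b (a * v))) = 0 := by
    intro v
    rw [Derivation.leibniz, hb0, smul_zero, add_zero, smul_eq_mul, Derivation.leibniz, hb0, smul_zero, add_zero,
      smul_eq_mul, map_mul, ha, aug_x, zero_mul]
  have e : h = c ^ 2 * D (D (a ^ 2)) + a * (8 * c * D a * D c + a * D (D (c ^ 2))) := by
    rw [hh]; exact apply_apply_sq_mul_sq D a c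
  have e2 : aug p k _ (D (D (a ^ 2))) = 2 * aug p k _ (D a) ^ 2 := by
    rw [apply_apply_sq, map_add, map_mul, map_mul, map_mul, map_ofNat, map_pow, ha, aug_x]
    ring
  rw [e, map_add, map_add, map_add, hA, hB, e2, add_zero] at h4
  have h2k := two_ne_zero_of_ne (k := k) (p := p) (by omega)
  exact hi (pow_eq_zero_iff (two_ne_zero)|>.mp
    ((mul_eq_zero.mp ((mul_eq_zero.mp h4).resolve_left h2k)).resolve_left h2k))

theorem isotropy_invariant_ham_three (hp : p = 3) (hm : 2 ≤ m)
    (htop : 8 ≤ topDeg p (Fin m ⊕ Fin m))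
    (g : derivedSubalgebra (hamiltonianFull p k m) 2 ≃ₗ⁅k⁆
      derivedSubalgebra (hamiltonianFull p k m) 2)
    (D : derivedSubalgebra (hamiltonianFull p k m) 2)
    (hD : (D : Witt p k (Fin m ⊕ Fin m)) ∈ isotropy p k _) :
    (g D : Witt p k (Fin m ⊕ Fin m)) ∈ isotropy p k _ := by
  refine isotropy_invariant (sandwich _ ∪ sandwichStabilizer _)
    (Set.union_subset (fun _ h => h.1) (fun _ h => h.1))
    (fun g c h => h.imp (sandwich_invariant g c) (sandwichStabilizer_invariant g c))
    (Set.union_subset (sandwich_subset_isotropy_ham (by omega) htop)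
      (sandwichStabilizer_subset_isotropy hp hm htop))
    (fun h => ?_) (fun M hML hCM hM => ?_) g D hD
  · refine partialD_notMem_isotropy (Sum.inl ⟨0, by omega⟩) (h (x := partialD p k _ _) ?_)
    rw [partialD_eq_ham]
    exact LieSubalgebra.smul_mem _ _
      (ham_mem_derived_two (by omega) htop (mem_MonLow_zero (x_mem_Mon _) (by omega)))
  · refine le_of_ham_pow_mem (by omega) htop hML (Set.subset_union_left.trans hCM) hM fun u hu => ?_
    have e : p - 1 = 2 := by omega
    rw [e]
    exact hCM (Or.inr (ham_sq_mem_sandwichStabilizer hp htop hu))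

theorem isotropy_invariant_ham (hp : 3 ≤ p) (hm : 1 ≤ m) (h5 : m = 1 → 5 ≤ p)
    (g : derivedSubalgebra (hamiltonianFull p k m) 2 ≃ₗ⁅k⁆
      derivedSubalgebra (hamiltonianFull p k m) 2)
    (D : derivedSubalgebra (hamiltonianFull p k m) 2)
    (hD : (D : Witt p k (Fin m ⊕ Fin m)) ∈ isotropy p k _) :
    (g D : Witt p k (Fin m ⊕ Fin m)) ∈ isotropy p k _ := by
  have htop : 8 ≤ topDeg p (Fin m ⊕ Fin m) := by
    rw [topDeg, Fintype.card_sum, Fintype.card_fin]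
    rcases hm.eq_or_lt with h | h
    · have := h5 h.symm
      rw [← h]; omega
    · calc 8 = 4 * 2 := rfl
        _ ≤ _ := Nat.mul_le_mul (by omega) (by omega)
  by_cases hp3 : p = 3
  · exact isotropy_invariant_ham_three hp3
      (by by_contra hc; have := h5 (by omega); omega) htop g D hD
  · have : p ≠ 4 := by
      rintro rfl
      exact absurd (Fact.out : Nat.Prime 4) (by norm_num)
    exact isotropy_invariant_ham_of_five_le (by omega) htop hm g D hD

end HamiltonianInvariance

/-! ### Toral derivations and their eigenvectors, the monomials in the z_i. -/

section EulerDerivations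

variable {p : ℕ} {k : Type*} [Field k] [CharP k p] [Fact p.Prime] {ι : Type*} [Fintype ι]
  (b : ι → Prop) [DecidablePred b]

/-- The coordinate `z_i`, equal to `1 + x_i` if `b i` and to `x_i` otherwise. -/
noncomputable def zc (p : ℕ) (k : Type*) [Field k] {ι : Type*} (b : ι → Prop) [DecidablePred b]
    (i : ι) : TruncPoly p k ι :=
  if b i then 1 + x p k ι i else x p k ι i

/-- The toral derivation `∑ u_i z_i ∂_i`. -/
noncomputable def toral (p : ℕ) (k : Type*) [Field k] [CharP k p] {ι : Type*} [Fintype ι]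
    (b : ι → Prop) [DecidablePred b] : (ι → k) →ₗ[k] Witt p k ι :=
  Fintype.linearCombination k fun i => Family.eulerD p k (b i) i

/-- The monomial `∏ z_i ^ a_i`. -/
noncomputable def zmon (p : ℕ) (k : Type*) [Field k] {ι : Type*} [Fintype ι]
    (b : ι → Prop) [DecidablePred b] (a : ι → ℕ) : TruncPoly p k ι :=
  ∏ i, zc p k b i ^ a i

variable {b}

theorem eulerD_eq (i : ι) : Family.eulerD p k (b i) i = zc p k b i • partialD p k ι i := rfl

theorem toral_eq (u : ι → k) :
    toral p k b u = ∑ i, u i • (zc p k b i • partialD p k ι i) := by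
  rw [toral, Fintype.linearCombination_apply]; rfl

theorem toral_apply (u : ι → k) (f : TruncPoly p k ι) :
    toral p k b u f = ∑ i, u i • (zc p k b i * partialD p k ι i f) := by
  rw [toral_eq, witt_sum_apply]; rfl

theorem partialD_zc [DecidableEq ι] (i j : ι) :
    partialD p k ι i (zc p k b j) = if j = i then 1 else 0 := by
  rw [zc]
  split_ifs with h1 h2 h2 <;> simp [partialD_x, h2]

theorem deriv_zc (D : Witt p k ι) (i : ι) : D (zc p k b i) = D (x p k ι i) := by
  rw [zc]
  split_ifs with h
  · rw [map_add, Derivation.map_one_eq_zero, zero_add]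
  · rfl

theorem toral_zc (u : ι → k) (i : ι) : toral p k b u (zc p k b i) = u i • zc p k b i := by
  classical
  rw [toral_apply, Finset.sum_eq_single i]
  · rw [partialD_zc, if_pos rfl, mul_one]
  · intro j _ hj
    rw [partialD_zc, if_neg hj.symm, mul_zero, smul_zero]
  · simp

theorem toral_x (u : ι → k) (i : ι) : toral p k b u (x p k ι i) = u i • zc p k b i := by
  rw [← deriv_zc (b := b), toral_zc]

theorem aug_zc (i : ι) : aug p k ι (zc p k b i) = if b i then 1 else 0 := by
  rw [zc]
  split_ifs <;> simp [aug_x]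

theorem eigen_mul {A : Type*} [CommRing A] [Algebra k A] {D : Derivation k A A} {f g : A}
    {α β : k} (hf : D f = α • f) (hg : D g = β • g) : D (f * g) = (α + β) • (f * g) := by
  rw [Derivation.leibniz, hf, hg, smul_eq_mul, smul_eq_mul, mul_smul_comm, mul_smul_comm, add_smul,
    mul_comm g f, add_comm]

theorem eigen_pow {A : Type*} [CommRing A] [Algebra k A] {D : Derivation k A A} {f : A}
    {α : k} (hf : D f = α • f) (n : ℕ) : D (f ^ n) = ((n : k) * α) • f ^ n := by
  induction n with
  | zero => simp
  | succ n ih =>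
    rw [pow_succ, eigen_mul ih hf]
    congr 1
    push_cast; ring

theorem eigen_prod {A α : Type*} [CommRing A] [Algebra k A] {D : Derivation k A A} {f : α → A}
    {c : α → k} (s : Finset α) (hf : ∀ i ∈ s, D (f i) = c i • f i) :
    D (∏ i ∈ s, f i) = (∑ i ∈ s, c i) • ∏ i ∈ s, f i := by
  classical
  induction s using Finset.induction_on with
  | empty => simp
  | insert i s hi ih =>
    rw [Finset.prod_insert hi, Finset.sum_insert hi]
    exact eigen_mul (hf i (Finset.mem_insert_self _ _))
      (ih fun j hj => hf j (Finset.mem_insert_of_mem hj))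

theorem toral_zmon (u : ι → k) (a : ι → ℕ) :
    toral p k b u (zmon p k b a) = (∑ i, (a i : k) * u i) • zmon p k b a :=
  eigen_prod _ fun i _ => eigen_pow (toral_zc u i) (a i)

theorem aug_zmon {a : ι → ℕ} (ha : ∀ i, ¬ b i → a i = 0) : aug p k ι (zmon p k b a) = 1 := by
  rw [zmon, map_prod]
  refine Finset.prod_eq_one fun i _ => ?_
  rw [map_pow, aug_zc]
  by_cases h : b i
  · simp [h]
  · simp [ha i h]

theorem isUnit_of_aug {f : TruncPoly p k ι} (h : aug p k ι f ≠ 0) : IsUnit f := by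
  have h1 : f ^ p = algebraMap k _ (aug p k ι f ^ p) := pow_p_eq f
  refine isUnit_of_dvd_unit (dvd_pow_self f (Fact.out : p.Prime).ne_zero) ?_
  rw [h1]
  exact (IsUnit.mk0 _ (pow_ne_zero _ h)).map _

theorem partialD_zmon_of_eq_zero {a : ι → ℕ} {l : ι} (ha : a l = 0) :
    partialD p k ι l (zmon p k b a) = 0 := by
  classical
  have h := eigen_prod (D := partialD p k ι l) (f := fun i => zc p k b i ^ a i) (c := fun _ => 0)
    Finset.univ fun i _ => ?_
  · rw [Finset.sum_const_zero, zero_smul] at h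
    exact h
  · rw [zero_smul, Derivation.leibniz_pow, partialD_zc]
    by_cases hi : i = l
    · rw [hi, ha, zero_smul]
    · rw [if_neg hi, smul_zero, smul_zero]

theorem span_zmon : Submodule.span k (Set.range (zmon p k (ι := ι) b)) = ⊤ := by
  classical
  have hz : ∀ i, ∀ f ∈ Submodule.span k (Set.range (zmon p k (ι := ι) b)),
      f * zc p k b i ∈ Submodule.span k (Set.range (zmon p k (ι := ι) b)) := by
    intro i f hf
    refine Submodule.span_induction (p := fun f _ => f * zc p k b i ∈
      Submodule.span k (Set.range (zmon p k (ι := ι) b))) ?_ ?_ ?_ ?_ hf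
    · rintro _ ⟨a, rfl⟩
      refine Submodule.subset_span ⟨a + Pi.single i 1, ?_⟩
      simp only [zmon, Pi.add_apply, pow_add, Finset.prod_mul_distrib]
      congr 1
      rw [Finset.prod_eq_single i]
      · simp
      · intro j _ hj; simp [hj]
      · simp
    · simp
    · intro f g _ _ hf hg
      rw [add_mul]; exact add_mem hf hg
    · intro c f _ hf
      rw [smul_mul_assoc]; exact Submodule.smul_mem _ _ hf
  rw [eq_top_iff]
  rintro f -
  induction f using truncPoly_induction with
  | C c =>
    have : algebraMap k (TruncPoly p k ι) c = c • zmon p k b 0 := by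
      rw [smul_eq_algebraMap_mul]; simp [zmon]
    rw [this]
    exact Submodule.smul_mem _ _ (Submodule.subset_span ⟨_, rfl⟩)
  | add f g hf hg => exact add_mem hf hg
  | mul_x f i hf =>
    have h := hz i f hf
    by_cases hb : b i
    · rw [zc, if_pos hb, mul_add, mul_one] at h
      exact (Submodule.add_mem_iff_right _ hf).mp h
    · rwa [zc, if_neg hb] at h

end EulerDerivations

/-! ### The weight group and multiplicities as invariants modulo isotropy. -/

section WeightGroup

variable {p : ℕ} {k : Type*} [Field k] [CharP k p] [Fact p.Prime] {ι : Type*} [Fintype ι]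

/-- The `𝔽_p`-span of the `w_i` with `b i`. -/
def weightGroup (p : ℕ) {k : Type*} [Field k] [CharP k p] [Fact p.Prime] {ι : Type*} [Fintype ι]
    (b : ι → Prop) (w : ι → k) : AddSubgroup k where
  carrier := {c | ∃ a : ι → ℕ, (∀ i, ¬ b i → a i = 0) ∧ c = ∑ i, (a i : k) * w i}
  zero_mem' := ⟨0, by simp, by simp⟩
  add_mem' := by
    rintro _ _ ⟨a, ha, rfl⟩ ⟨a', ha', rfl⟩
    refine ⟨a + a', fun i hi => by simp [ha i hi, ha' i hi], ?_⟩
    rw [← Finset.sum_add_distrib]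
    refine Finset.sum_congr rfl fun i _ => ?_
    push_cast [Pi.add_apply]; ring
  neg_mem' := by
    rintro _ ⟨a, ha, rfl⟩
    -- The factor p - 1 represents -1, so natural numbers suffice as coefficients.
    refine ⟨fun i => (p - 1) * a i, fun i hi => by simp [ha i hi], ?_⟩
    rw [← Finset.sum_neg_distrib]
    refine Finset.sum_congr rfl fun i _ => ?_
    have h1 : 1 ≤ p := (Fact.out : p.Prime).one_le
    rw [Nat.cast_mul, Nat.cast_sub h1, CharP.cast_eq_zero k p]
    push_cast; ring

variable {b : ι → Prop}

theorem weight_mem_weightGroup {w : ι → k} {i : ι} (hi : b i) : w i ∈ weightGroup p b w := by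
  classical
  refine ⟨Pi.single i 1, fun j hj => ?_, ?_⟩
  · rw [Pi.single_eq_of_ne]; rintro rfl; exact hj hi
  · rw [Finset.sum_eq_single i]
    · simp
    · intro j _ hj; simp [hj]
    · simp

variable [DecidablePred b]

/-- An eigenvector of a toral derivation with a nonzero constant term has its eigenvalue in the
weight group. -/
theorem mem_weightGroup_of_eigen {w : ι → k} {f : TruncPoly p k ι} {c : k}
    (h : toral p k b w f = c • f) (hf : aug p k ι f ≠ 0) : c ∈ weightGroup p b w := by
  set d : Module.End k (TruncPoly p k ι) := (toral p k b w).toLinearMap with hd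
  -- Every f has a polynomial P, with all its roots in the weight group, such that P(T) and all its
  -- multiples send f into the maximal ideal. For z^a supported on shifted indices, P is X minus the
  -- eigenvalue; every other z^a already has zero constant term. Evaluating on an eigenvector forces
  -- its eigenvalue to be a root of P.
  have key : ∀ f : TruncPoly p k ι, ∃ P : Polynomial k, (∀ c ∉ weightGroup p b w, P.eval c ≠ 0) ∧
      ∀ R : Polynomial k, aug p k ι (Polynomial.aeval d (P * R) f) = 0 := by
    intro f
    have hmem : f ∈ Submodule.span k (Set.range (zmon p k (ι := ι) b)) := by
      rw [span_zmon]; trivial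
    induction hmem using Submodule.span_induction with
    | mem f hf =>
      obtain ⟨a, rfl⟩ := hf
      have he : d (zmon p k b a) = (∑ i, (a i : k) * w i) • zmon p k b a := toral_zmon w a
      by_cases ha : ∀ i, ¬ b i → a i = 0
      · refine ⟨Polynomial.X - Polynomial.C (∑ i, (a i : k) * w i), fun c hc h0 => hc ?_, fun R => ?_⟩
        · rw [Polynomial.eval_sub, Polynomial.eval_X, Polynomial.eval_C, sub_eq_zero] at h0
          exact ⟨a, ha, h0⟩
        · rw [mul_comm, map_mul, Module.End.mul_apply]
          have : Polynomial.aeval d (Polynomial.X - Polynomial.C (∑ i, (a i : k) * w i))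
              (zmon p k b a) = 0 := by
            rw [map_sub, Polynomial.aeval_X, Polynomial.aeval_C, LinearMap.sub_apply, he,
              Module.algebraMap_end_apply, sub_self]
          rw [this, map_zero, map_zero]
      · push Not at ha
        obtain ⟨i, hbi, hai⟩ := ha
        refine ⟨1, fun c _ => by simp, fun R => ?_⟩
        have h0 : aug p k ι (zmon p k b a) = 0 := by
          rw [zmon, map_prod]
          refine Finset.prod_eq_zero (Finset.mem_univ i) ?_
          rw [map_pow, aug_zc, if_neg hbi, zero_pow hai]
        rw [one_mul, Module.End.aeval_apply_of_mem_apply_eq_smul he, map_smul, h0, smul_zero]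
    | zero => exact ⟨1, fun c _ => by simp, fun R => by simp⟩
    | add f g _ _ hf hg =>
      obtain ⟨P, hP, hP'⟩ := hf
      obtain ⟨Q, hQ, hQ'⟩ := hg
      refine ⟨P * Q, fun c hc => ?_, fun R => ?_⟩
      · rw [Polynomial.eval_mul]; exact mul_ne_zero (hP c hc) (hQ c hc)
      · rw [map_add, map_add, mul_assoc, hP', mul_left_comm, hQ', add_zero]
    | smul c f _ hf =>
      obtain ⟨P, hP, hP'⟩ := hf
      exact ⟨P, hP, fun R => by rw [map_smul, map_smul, hP', smul_zero]⟩
  by_contra hc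
  obtain ⟨P, hP, hP'⟩ := key f
  have h1 := hP' 1
  rw [mul_one, Module.End.aeval_apply_of_mem_apply_eq_smul (f := d) h, map_smul, smul_eq_mul] at h1
  exact (mul_ne_zero (hP c hc) hf) h1

theorem toral_apply_x_of_lie {w : ι → k} {D : Witt p k ι} {c : k} (h : ⁅toral p k b w, D⁆ = c • D)
    (l : ι) : toral p k b w (D (x p k ι l)) = (c + w l) • D (x p k ι l) := by
  have h1 : ⁅toral p k b w, D⁆ (zc p k b l) = c • D (zc p k b l) := by rw [h]; rfl
  rw [Derivation.commutator_apply, toral_zc, Derivation.map_smul, deriv_zc] at h1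
  rw [add_smul, ← h1, sub_add_cancel]

theorem add_mem_weightGroup {w : ι → k} {D : Witt p k ι} {c : k} (h : ⁅toral p k b w, D⁆ = c • D)
    {l : ι} (hl : aug p k ι (D (x p k ι l)) ≠ 0) : c + w l ∈ weightGroup p b w :=
  mem_weightGroup_of_eigen (toral_apply_x_of_lie h l) hl

/-- D(x_i) has constant term w_i ≠ 0 and T(w)-eigenvalue c + w_i, so c + w_i lies in the weight
group, as does w_i. -/
theorem mem_weightGroup_of_shift {w : ι → k} {D : Witt p k ι} {c : k}
    (h : ⁅toral p k b w, D⁆ = c • D) (hD : D - toral p k b w ∈ isotropy p k ι) {i : ι} (hi : b i)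
    (hw : w i ≠ 0) : c ∈ weightGroup p b w := by
  have h1 := mem_isotropy.mp hD i
  rw [Derivation.sub_apply, map_sub, toral_x, map_smul, aug_zc, if_pos hi, smul_eq_mul, mul_one,
    sub_eq_zero] at h1
  have h2 := add_mem_weightGroup h (l := i) (by rwa [h1])
  simpa using sub_mem h2 (weight_mem_weightGroup hi)

variable {L : LieSubalgebra k (Witt p k ι)}

/-- Congruence to d modulo isotropy is carried by g to congruence to d'. A vector realizing c for d
therefore realizes it for d'. -/
theorem weightGroup_le_of_lieEquiv {w w' : ι → k} {d d' : L} (hd : (d : Witt p k ι) = toral p k b w)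
    (hd' : (d' : Witt p k ι) = toral p k b w') (g : L ≃ₗ⁅k⁆ L)
    (hg : ∀ D : L, (D : Witt p k ι) ∈ isotropy p k ι → (g D : Witt p k ι) ∈ isotropy p k ι)
    (hgd : g d = d') (hw' : ∀ i, b i → w' i ≠ 0)
    (hL : ∀ c ∈ weightGroup p b w, ∃ D ∈ L, ⁅toral p k b w, D⁆ = c • D ∧
      D - toral p k b w ∈ isotropy p k ι) :
    weightGroup p b w ≤ weightGroup p b w' := by
  intro c hc
  by_cases hb : ∃ i, b i
  · obtain ⟨i, hi⟩ := hb
    obtain ⟨D, hD, h1, h2⟩ := hL c hc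
    rw [← hd] at h1 h2
    have h3 : ⁅d, (⟨D, hD⟩ : L)⁆ = c • (⟨D, hD⟩ : L) := Subtype.ext h1
    have h4 := congrArg (fun y => (g y : Witt p k ι)) h3
    simp only [LieEquiv.map_lie, hgd, map_smul] at h4
    have h5 := hg (⟨D, hD⟩ - d) h2
    rw [map_sub, hgd] at h5
    have h6 : ⁅(d' : Witt p k ι), (g ⟨D, hD⟩ : Witt p k ι)⁆ = c • (g ⟨D, hD⟩ : Witt p k ι) := h4
    have h7 : (g ⟨D, hD⟩ : Witt p k ι) - (d' : Witt p k ι) ∈ isotropy p k ι := h5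
    rw [hd'] at h6 h7
    exact mem_weightGroup_of_shift h6 h7 hi (hw' i hi)
  · obtain ⟨a, ha, rfl⟩ := hc
    rw [Finset.sum_eq_zero fun i _ => by rw [ha i fun hi => hb ⟨i, hi⟩, Nat.cast_zero, zero_mul]]
    exact zero_mem _

theorem card_le_of_lieEquiv {w w' : ι → k} {d d' : L} (hd : (d : Witt p k ι) = toral p k b w)
    (hd' : (d' : Witt p k ι) = toral p k b w') (g : L ≃ₗ⁅k⁆ L)
    (hg : ∀ D : L, (D : Witt p k ι) ∈ isotropy p k ι →
      (g.symm D : Witt p k ι) ∈ isotropy p k ι)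
    (hgd : g d = d') {c : k} [DecidableEq ι]
    (hL : ∀ l, c + w l ∈ weightGroup p b w → ∃ D ∈ L, ⁅toral p k b w, D⁆ = c • D ∧
      ∃ a : k, a ≠ 0 ∧ ∀ j, aug p k ι (D (x p k ι j)) = if j = l then a else 0) :
    Nat.card {l // c + w l ∈ weightGroup p b w} ≤ Nat.card {l // c + w' l ∈ weightGroup p b w'} := by
  classical
  choose! D hDL hD a ha hDx using hL
  let E : {l // c + w l ∈ weightGroup p b w} → L := fun l => ⟨D l, hDL l l.2⟩
  have hE : ∀ l, ⁅toral p k b w', (g (E l) : Witt p k ι)⁆ = c • (g (E l) : Witt p k ι) := by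
    intro l
    have h1 : ⁅d, E l⁆ = c • E l := by
      refine Subtype.ext ?_
      have := hD l l.2
      rw [← hd] at this
      exact this
    have h2 := congrArg (fun y => (g y : Witt p k ι)) h1
    simp only [LieEquiv.map_lie, hgd, map_smul] at h2
    rw [← hd']
    exact h2
  let v : {l // c + w l ∈ weightGroup p b w} → ({l // c + w' l ∈ weightGroup p b w'} → k) :=
    fun l j => aug p k ι ((g (E l) : Witt p k ι) (x p k ι j))
  -- A linear relation would put a combination of the images g(E_l) into the isotropy algebra.
  -- Pulling it back by the inverse of g contradicts the independent constant parts of the E_l.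
  -- Coordinates outside the target index set vanish automatically.
  have hv : LinearIndependent k v := by
    rw [Fintype.linearIndependent_iff]
    intro α hα l
    have h1 : ((∑ l, α l • g (E l) : L) : Witt p k ι) ∈ isotropy p k ι := by
      rw [mem_isotropy]
      intro j
      have e : (((∑ l, α l • g (E l) : L) : Witt p k ι)) =
          ∑ l, α l • (g (E l) : Witt p k ι) := by
        simp
      rw [e, witt_sum_apply, map_sum]
      by_cases hj : c + w' j ∈ weightGroup p b w'
      · have := congrFun hα ⟨j, hj⟩
        rw [Finset.sum_apply] at this
        simpa [v] using this
      · refine Finset.sum_eq_zero fun l _ => ?_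
        rw [Derivation.smul_apply, map_smul]
        by_contra h0
        exact hj (add_mem_weightGroup (hE l) fun h => h0 (by rw [h, smul_zero]))
    have h2 := hg _ h1
    have e : ((g.symm (∑ l, α l • g (E l)) : L) : Witt p k ι) = ∑ l, α l • D l := by
      simp [E]
    rw [e, mem_isotropy] at h2
    have h3 := h2 l
    rw [witt_sum_apply, map_sum, Finset.sum_eq_single l] at h3
    · rw [Derivation.smul_apply, map_smul, hDx l l.2, if_pos rfl, smul_eq_mul] at h3
      exact (mul_eq_zero.mp h3).resolve_right (ha l l.2)
    · intro l' _ hl'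
      rw [Derivation.smul_apply, map_smul, hDx l' l'.2, if_neg (fun h => hl' (Subtype.ext h.symm)),
        smul_zero]
    · simp
  have := hv.fintype_card_le_finrank
  rwa [Module.finrank_fintype_fun_eq_card, ← Nat.card_eq_fintype_card,
    ← Nat.card_eq_fintype_card] at this

end WeightGroup

/-! ### Permutations from equal fibre sizes. -/

section Fibers

/-- Two functions on a finite type whose fibres have the same size, except possibly over one value,
differ by a permutation, which fixes a given set of points lying over the exceptional value. -/
theorem exists_perm_of_card_fiber {α β : Type*} [Finite α] {f f' : α → β} (b : α → Prop) (c₀ : β)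
    (hb : ∀ i, b i → f i = c₀) (hb' : ∀ i, b i → f' i = c₀)
    (h : ∀ c, c ≠ c₀ → Nat.card {i // f i = c} = Nat.card {i // f' i = c}) :
    ∃ e : Equiv.Perm α, (∀ i, b i → e i = i) ∧ ∀ i, f' (e i) = f i := by
  classical
  cases nonempty_fintype α
  let S := {i // ¬ b i}
  have hc : ∀ (φ : α → β) (hφ : ∀ i, b i → φ i = c₀) (c : β), c ≠ c₀ →
      Nonempty ({i : {i : S // φ i ≠ c₀} // φ i = c} ≃ {i // φ i = c}) := by
    intro φ hφ c hc
    refine ⟨⟨fun i => ⟨i.1.1.1, i.2⟩, fun i => ⟨⟨⟨i.1, fun hi => hc ?_⟩, ?_⟩, i.2⟩,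
      fun i => rfl, fun i => rfl⟩⟩
    · rw [← i.2, hφ _ hi]
    · rw [i.2]; exact hc
  have hfib : ∀ c : {c // c ≠ c₀}, Nonempty
      ({i : {i : S // f i ≠ c₀} // f i = c} ≃ {i : {i : S // f' i ≠ c₀} // f' i = c}) := by
    rintro ⟨c, hcc⟩
    obtain ⟨e1⟩ := hc f hb c hcc
    obtain ⟨e2⟩ := hc f' hb' c hcc
    obtain ⟨e3⟩ := Finite.card_eq.mp (h c hcc)
    exact ⟨e1.trans (e3.trans e2.symm)⟩
  let E := fun c => Classical.choice (hfib c)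
  let e₀ : {i : S // f i ≠ c₀} ≃ {i : S // f' i ≠ c₀} :=
    Equiv.ofFiberEquiv (f := fun i => (⟨f i, i.2⟩ : {c // c ≠ c₀}))
      (g := fun i => (⟨f' i, i.2⟩ : {c // c ≠ c₀})) fun c =>
      (Equiv.subtypeEquivRight fun i => Subtype.ext_iff).trans
        ((E c).trans (Equiv.subtypeEquivRight fun _ =>
          ⟨fun h => Subtype.ext h, fun h => congrArg Subtype.val h⟩))
  have he₀ : ∀ i, f' (e₀ i) = f i := fun i =>
    congrArg Subtype.val (Equiv.ofFiberEquiv_map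
      (f := fun i : {i : S // f i ≠ c₀} => (⟨f i, i.2⟩ : {c // c ≠ c₀}))
      (g := fun i : {i : S // f' i ≠ c₀} => (⟨f' i, i.2⟩ : {c // c ≠ c₀})) _ i)
  -- The matching of points off the exceptional value extends to all of S, and the remaining points
  -- of both functions lie over c₀, where any matching will do.
  let e : Equiv.Perm S := e₀.extendSubtype
  have he : ∀ i : S, f' (e i) = f i := by
    intro i
    by_cases hi : f i ≠ c₀
    · rw [show e i = e₀ ⟨i, hi⟩ from Equiv.extendSubtype_apply_of_mem e₀ i hi, he₀]
    · have := Equiv.extendSubtype_not_mem e₀ i hi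
      push Not at hi this
      rw [hi]; exact this
  refine ⟨Equiv.Perm.ofSubtype e, fun i hi => ?_, fun i => ?_⟩
  · exact Equiv.Perm.ofSubtype_apply_of_not_mem _ (by simpa using hi)
  · by_cases hi : b i
    · rw [Equiv.Perm.ofSubtype_apply_of_not_mem _ (by simpa using hi), hb i hi, hb' i hi]
    · have h1 : Equiv.Perm.ofSubtype e i = e ⟨i, hi⟩ := Equiv.Perm.ofSubtype_apply_of_mem e hi
      rw [h1]
      exact he ⟨i, hi⟩

end Fibers

/-! ### Existence of enough eigenvectors, and the case of W(n). -/

section Saturated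

variable {p : ℕ} {k : Type*} [Field k] [CharP k p] [Fact p.Prime] {ι : Type*} [Fintype ι]
  [DecidableEq ι] {b : ι → Prop} [DecidablePred b]

/-- `L` has enough eigenvectors of the toral derivation of weight `w` for the weight group and the
multiplicities of weights modulo it to be visible in `L`. -/
structure HasEigenvectors (L : LieSubalgebra k (Witt p k ι)) (b : ι → Prop) [DecidablePred b]
    (w : ι → k) : Prop where
  shift : ∀ c ∈ weightGroup p b w, ∃ D ∈ L, ⁅toral p k b w, D⁆ = c • D ∧
    D - toral p k b w ∈ isotropy p k ι
  eval : ∀ c ∉ weightGroup p b w, ∀ l, c + w l ∈ weightGroup p b w →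
    ∃ D ∈ L, ⁅toral p k b w, D⁆ = c • D ∧
      ∃ a : k, a ≠ 0 ∧ ∀ j, aug p k ι (D (x p k ι j)) = if j = l then a else 0

theorem lie_smul_eq (a : TruncPoly p k ι) (D E : Witt p k ι) :
    ⁅D, a • E⁆ = D a • E + a • ⁅D, E⁆ := by
  ext f
  simp only [Derivation.commutator_apply, Derivation.smul_apply, Derivation.add_apply,
    Derivation.leibniz, smul_eq_mul]
  ring

theorem lie_toral_toral (u v : ι → k) : ⁅toral p k b u, toral p k b v⁆ = 0 := by
  refine witt_ext p fun i => ?_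
  rw [Derivation.commutator_apply, toral_x, toral_x, Derivation.map_smul, Derivation.map_smul,
    toral_zc, toral_zc, smul_smul, smul_smul, mul_comm, sub_self]
  rfl

theorem lie_toral_partialD (u : ι → k) (l : ι) :
    ⁅toral p k b u, partialD p k ι l⁆ = -u l • partialD p k ι l := by
  refine witt_ext p fun i => ?_
  rw [Derivation.commutator_apply, toral_x, Derivation.map_smul, partialD_zc, Derivation.smul_apply,
    partialD_x]
  split_ifs with h
  · rw [Derivation.map_one_eq_zero, zero_sub, neg_smul, h]
  · simp

theorem lie_toral_smul {w : ι → k} {f : TruncPoly p k ι} {E : Witt p k ι} {α β : k}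
    (hf : toral p k b w f = α • f) (hE : ⁅toral p k b w, E⁆ = β • E) :
    ⁅toral p k b w, f • E⁆ = (α + β) • (f • E) := by
  rw [lie_smul_eq, hf, hE]
  ext a
  simp only [Derivation.smul_apply, Derivation.add_apply, smul_eq_mul, smul_eq_algebraMap_mul,
    map_add]
  ring

theorem lie_toral_zmon_smul_toral {w : ι → k} (a : ι → ℕ) (u : ι → k) :
    ⁅toral p k b w, zmon p k b a • toral p k b u⁆ =
      (∑ i, (a i : k) * w i) • (zmon p k b a • toral p k b u) := by
  have h := lie_toral_smul (E := toral p k b u) (β := 0) (toral_zmon w a)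
    (by rw [lie_toral_toral, zero_smul])
  rwa [add_zero] at h

theorem lie_toral_zmon_smul_partialD {w : ι → k} (a : ι → ℕ) (l : ι) :
    ⁅toral p k b w, zmon p k b a • partialD p k ι l⁆ =
      (∑ i, (a i : k) * w i - w l) • (zmon p k b a • partialD p k ι l) := by
  rw [lie_toral_smul (toral_zmon w a) (lie_toral_partialD w l), sub_eq_add_neg]

theorem aug_zmon_smul_partialD {a : ι → ℕ} (ha : ∀ i, ¬ b i → a i = 0) (l j : ι) :
    aug p k ι ((zmon p k b a • partialD p k ι l) (x p k ι j)) = if j = l then 1 else 0 := by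
  rw [smul_partialD_x]
  split_ifs
  · exact aug_zmon ha
  · exact map_zero _

theorem hasEigenvectors_top (w : ι → k) :
    HasEigenvectors (⊤ : LieSubalgebra k (Witt p k ι)) b w where
  shift := by
    rintro c ⟨a, ha, rfl⟩
    refine ⟨zmon p k b a • toral p k b w, LieSubalgebra.mem_top _, lie_toral_zmon_smul_toral a w, ?_⟩
    rw [mem_isotropy]
    intro i
    rw [Derivation.sub_apply, Derivation.smul_apply, smul_eq_mul, map_sub, map_mul, aug_zmon ha,
      one_mul, sub_self]
  eval := by
    rintro c hc l ⟨a, ha, h⟩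
    refine ⟨zmon p k b a • partialD p k ι l, LieSubalgebra.mem_top _, ?_, 1, one_ne_zero,
      aug_zmon_smul_partialD ha l⟩
    rw [lie_toral_zmon_smul_partialD, ← h, add_sub_cancel_right]

end Saturated

/-! ### Enough eigenvectors in S(n)^(1). -/

section SaturatedSpecial

variable {p : ℕ} {k : Type*} [Field k] [CharP k p] [Fact p.Prime] {n : ℕ}
  {b : Fin n → Prop} [DecidablePred b]

theorem divergence_toral (u : Fin n → k) :
    divergence p k (toral p k b u) = algebraMap k _ (∑ i, u i) := by
  rw [divergence, map_sum]
  refine Finset.sum_congr rfl fun i _ => ?_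
  rw [toral_x, Derivation.map_smul, partialD_zc, if_pos rfl, smul_eq_algebraMap_mul, mul_one]

theorem hasEigenvectors_special {w : Fin n → k}
    (hw : toral p k b w ∈ derivedSubalgebra (specialFull p k n) 1) {l : Fin n} (hl : ¬ b l) :
    HasEigenvectors (derivedSubalgebra (specialFull p k n) 1) b w where
  shift := by
    intro c hc
    -- Divergence-free weight vectors of nonzero weight lie in the derived algebra automatically.
    -- Weight zero is served by T(w) itself.
    by_cases hc0 : c = 0
    · exact ⟨_, hw, by rw [lie_toral_toral, hc0, zero_smul], 
        mem_isotropy.mpr fun i => by rw [Derivation.sub_apply, map_sub, sub_self]⟩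
    obtain ⟨a, ha, rfl⟩ := hc
    set c := ∑ i, (a i : k) * w i with hc
    -- z^a T(w) has divergence c z^a. Subtracting c from the weight at the unshifted index l cancels
    -- it, without changing the constant part, since z_l vanishes at the origin.
    have h1 := lie_toral_zmon_smul_toral (p := p) (b := b) (w := w) a (w - Pi.single l c)
    refine ⟨_, mem_derivedSubalgebra_of_lie_eq hc0 hw ?_ h1, h1, ?_⟩
    · have hw0 : ∑ i, w i = 0 := by
        have h2 := mem_specialFull.mp (derivedSubalgebra_le _ hw)
        rw [divergence_toral] at h2
        exact (algebraMap k (TruncPoly p k (Fin n))).injective (by rw [h2, map_zero])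
      have h3 : ∑ i, (w - Pi.single l c : Fin n → k) i = -c := by
        simp only [Pi.sub_apply, Finset.sum_sub_distrib, hw0, Finset.sum_pi_single',
          Finset.mem_univ, if_true, zero_sub]
      have h4 : ∑ i, (a i : k) * (w - Pi.single l c : Fin n → k) i = c := by
        simp only [Pi.sub_apply, mul_sub, Finset.sum_sub_distrib, ← hc]
        rw [Finset.sum_eq_zero, sub_zero]
        intro i _
        by_cases hi : i = l
        · rw [hi, ha l hl, Nat.cast_zero, zero_mul]
        · rw [Pi.single_eq_of_ne hi, mul_zero]
      rw [mem_specialFull, divergence_smul, divergence_toral, toral_zmon, h3, h4,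
        smul_eq_algebraMap_mul, map_neg]
      ring
    · rw [mem_isotropy]
      intro i
      rw [Derivation.sub_apply, Derivation.smul_apply, smul_eq_mul, map_sub, map_mul, aug_zmon ha,
        one_mul, toral_x, toral_x, map_smul, map_smul, ← sub_smul, aug_zc]
      by_cases hi : i = l
      · rw [hi, if_neg hl, smul_zero]
      · rw [Pi.sub_apply, Pi.single_eq_of_ne hi, sub_zero, sub_self, zero_smul]
  eval := by
    rintro c hc l ⟨a, ha, h⟩
    have hc0 : c ≠ 0 := fun h => hc (h ▸ zero_mem _)
    have h1 := lie_toral_zmon_smul_partialD (p := p) (b := b) (w := w) a l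
    rw [← h, add_sub_cancel_right] at h1
    have hbl : ¬ b l := fun hbl => hc (by
      have h2 : c + w l ∈ weightGroup p b w := ⟨a, ha, h⟩
      simpa using sub_mem h2 (weight_mem_weightGroup hbl))
    refine ⟨_, mem_derivedSubalgebra_of_lie_eq hc0 hw ?_ h1, h1, 1, one_ne_zero,
      aug_zmon_smul_partialD ha l⟩
    exact smul_partialD_mem_specialFull (partialD_zmon_of_eq_zero (ha l hbl))

end SaturatedSpecial

/-! ### Enough eigenvectors in H(2m)^(2). -/

section SaturatedHamiltonian

variable {p : ℕ} {k : Type*} [Field k] [CharP k p] [Fact p.Prime] {m : ℕ}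
  {b : Fin m ⊕ Fin m → Prop} [DecidablePred b]

/-- The Hamiltonian function `∑ u_i z_i x_{i'}`, the sum running over the first half of the
indices. -/
noncomputable def hamToral (p : ℕ) {k : Type*} [Field k] {m : ℕ} (b : Fin m ⊕ Fin m → Prop)
    [DecidablePred b] (u : Fin m → k) : TruncPoly p k (Fin m ⊕ Fin m) :=
  ∑ i, u i • (zc p k b (Sum.inl i) * x p k _ (Sum.inr i))

/-- The weight `(u, -u)`. -/
def hamWeight {k : Type*} [Field k] {m : ℕ} (u : Fin m → k) : Fin m ⊕ Fin m → k := Sum.elim u (-u)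

theorem ham_hamToral (hb : ∀ i, ¬ b (Sum.inr i)) (u : Fin m → k) :
    ham (hamToral p b u) = -toral p k b (hamWeight u) := by
  have hz : ∀ i : Fin m, zc p k b (Sum.inr i) = x p k _ (Sum.inr i) := fun i => by
    rw [zc, if_neg (hb i)]
  refine witt_ext p fun j => ?_
  rw [ham_x, Derivation.neg_apply, toral_x, hamToral, map_sum]
  rcases j with j | j
  · rw [Finset.sum_eq_single j]
    · rw [Derivation.map_smul, Derivation.leibniz, partialD_zc]
      simp [partialD_x, sgn, hamWeight]
    · intro i _ hi
      rw [Derivation.map_smul, Derivation.leibniz, partialD_zc]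
      simp [partialD_x, hi]
    · simp
  · rw [Finset.sum_eq_single j]
    · rw [Derivation.map_smul, Derivation.leibniz, partialD_zc, hz]
      simp [partialD_x, sgn, hamWeight]
    · intro i _ hi
      rw [Derivation.map_smul, Derivation.leibniz, partialD_zc]
      simp [partialD_x, hi]
    · simp

theorem toral_hamWeight_mem (hb : ∀ i, ¬ b (Sum.inr i)) (u : Fin m → k) :
    toral p k b (hamWeight u) ∈ hamiltonianFull p k m := by
  rw [← neg_mem_iff, ← ham_hamToral hb]
  exact ham_mem_full _

theorem toral_hamWeight_hamToral (hb : ∀ i, ¬ b (Sum.inr i)) (u v : Fin m → k) :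
    toral p k b (hamWeight u) (hamToral p b v) = 0 := by
  rw [hamToral, map_sum]
  refine Finset.sum_eq_zero fun i _ => ?_
  have hz : x p k _ (Sum.inr i) = zc p k b (Sum.inr i) := by rw [zc, if_neg (hb i)]
  rw [Derivation.map_smul, hz, eigen_mul (toral_zc _ _) (toral_zc _ _)]
  simp [hamWeight]

theorem aug_hamToral (u : Fin m → k) : aug p k _ (hamToral p b u) = 0 := by
  rw [hamToral, map_sum]
  refine Finset.sum_eq_zero fun i _ => ?_
  rw [map_smul, map_mul, aug_x, mul_zero, smul_zero]

/-- If h is the function with D_h = -T(w), then -D_{z^a h} = z^a T(w) - h D_{z^a}, and h vanishes at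
the origin, so the constant part is that of T(w). A prescribed constant direction l comes from z^a
x_{l'}; the index l' is unshifted because c lies outside the weight group. -/
theorem hasEigenvectors_ham (hb : ∀ i, ¬ b (Sum.inr i)) {u : Fin m → k}
    (hw : toral p k b (hamWeight u) ∈ derivedSubalgebra (hamiltonianFull p k m) 2) :
    HasEigenvectors (derivedSubalgebra (hamiltonianFull p k m) 2) b (hamWeight u) where
  shift := by
    intro c hc
    by_cases hc0 : c = 0
    · exact ⟨_, hw, by rw [lie_toral_toral, hc0, zero_smul], 
        mem_isotropy.mpr fun i => by rw [Derivation.sub_apply, map_sub, sub_self]⟩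
    obtain ⟨a, ha, hca⟩ := hc
    have h1 : ⁅toral p k b (hamWeight u), ham (-(zmon p k b a * hamToral p b u))⁆ =
        c • ham (-(zmon p k b a * hamToral p b u)) := by
      rw [lie_ham (toral_hamWeight_mem hb u), map_neg, eigen_mul (β := 0) (toral_zmon _ a)
        (by rw [toral_hamWeight_hamToral hb, zero_smul]), add_zero, ← hca, ← smul_neg, map_smul]
    refine ⟨_, mem_derivedSubalgebra_of_lie_eq hc0 hw (ham_mem_full _) h1, h1, ?_⟩
    rw [mem_isotropy]
    intro i
    rw [Derivation.sub_apply, map_neg, ham_mul, ham_hamToral hb]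
    simp only [Derivation.neg_apply, Derivation.add_apply, Derivation.smul_apply, smul_eq_mul,
      map_sub, map_neg, map_add, map_mul, aug_zmon ha, aug_hamToral]
    ring
  eval := by
    rintro c hc l ⟨a, ha, h⟩
    have hc0 : c ≠ 0 := fun h => hc (h ▸ zero_mem _)
    have h2 : c + hamWeight u l ∈ weightGroup p b (hamWeight u) := ⟨a, ha, h⟩
    have hs : hamWeight u l.swap = -hamWeight u l := by cases l <;> simp [hamWeight]
    have hbl : ¬ b l.swap := fun hbl => hc (by
      have := add_mem h2 (weight_mem_weightGroup (w := hamWeight u) hbl)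
      rw [hs] at this
      simpa using this)
    have hz : x p k _ l.swap = zc p k b l.swap := by rw [zc, if_neg hbl]
    have h1 : ⁅toral p k b (hamWeight u), ham (zmon p k b a * x p k _ l.swap)⁆ =
        c • ham (zmon p k b a * x p k _ l.swap) := by
      rw [lie_ham (toral_hamWeight_mem hb u), hz, eigen_mul (toral_zmon _ a) (toral_zc _ _), hs, ← h,
        add_neg_cancel_right, map_smul]
    refine ⟨_, mem_derivedSubalgebra_of_lie_eq hc0 hw (ham_mem_full _) h1, h1, sgn k l.swap,
      sgn_ne_zero _, fun j => ?_⟩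
    rw [ham_x, Derivation.leibniz, partialD_x, map_smul, map_add, smul_eq_mul, smul_eq_mul, smul_eq_mul,
      map_mul, map_mul, aug_zmon ha, aug_x, zero_mul, add_zero, one_mul]
    by_cases hj : j = l
    · simp [hj]
    · have : l.swap ≠ j.swap := fun h => hj (by simpa using congrArg Sum.swap h.symm)
      simp [hj, this]

end SaturatedHamiltonian

/-! ### Matching the weights of two elements in one orbit. -/

section Permutation

variable {p : ℕ} {k : Type*} [Field k] [CharP k p] [Fact p.Prime] {ι : Type*} [Fintype ι]
  [DecidableEq ι] {b : ι → Prop} [DecidablePred b] {L : LieSubalgebra k (Witt p k ι)}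

theorem weightGroup_eq_of_lieEquiv
    (hL : ∀ g : L ≃ₗ⁅k⁆ L, ∀ D : L, (D : Witt p k ι) ∈ isotropy p k ι →
      (g D : Witt p k ι) ∈ isotropy p k ι)
    {w w' : ι → k} {d d' : L} (hd : (d : Witt p k ι) = toral p k b w)
    (hd' : (d' : Witt p k ι) = toral p k b w') (hgd : ∃ g : L ≃ₗ⁅k⁆ L, g d = d')
    (hw : ∀ i, b i → w i ≠ 0) (hw' : ∀ i, b i → w' i ≠ 0)
    (hE : HasEigenvectors L b w) (hE' : HasEigenvectors L b w') :
    weightGroup p b w = weightGroup p b w' := by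
  obtain ⟨g, hg⟩ := hgd
  exact le_antisymm (weightGroup_le_of_lieEquiv hd hd' g (hL g) hg hw' hE.shift)
    (weightGroup_le_of_lieEquiv hd' hd g.symm (hL g.symm) (by rw [← hg, LieEquiv.symm_apply_apply])
      hw hE'.shift)

theorem card_eq_of_lieEquiv
    (hL : ∀ g : L ≃ₗ⁅k⁆ L, ∀ D : L, (D : Witt p k ι) ∈ isotropy p k ι →
      (g D : Witt p k ι) ∈ isotropy p k ι)
    {w w' : ι → k} {d d' : L} (hd : (d : Witt p k ι) = toral p k b w)
    (hd' : (d' : Witt p k ι) = toral p k b w') (hgd : ∃ g : L ≃ₗ⁅k⁆ L, g d = d')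
    (hV : weightGroup p b w = weightGroup p b w')
    (hE : HasEigenvectors L b w) (hE' : HasEigenvectors L b w') {c : k}
    (hc : c ∉ weightGroup p b w') :
    Nat.card {l // c + w l ∈ weightGroup p b w'} = Nat.card {l // c + w' l ∈ weightGroup p b w'} := by
  obtain ⟨g, hg⟩ := hgd
  have h1 := card_le_of_lieEquiv hd hd' g (hL g.symm) hg (hE.eval c (by rwa [hV]))
  have h2 := card_le_of_lieEquiv hd' hd g.symm (hL g.symm.symm)
    (by rw [← hg, LieEquiv.symm_apply_apply]) (hE'.eval c hc)
  rw [hV] at h1 h2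
  exact le_antisymm h1 h2

theorem exists_perm_of_card {V : AddSubgroup k} {w w' : ι → k} (hw : ∀ i, b i → w i ∈ V)
    (hw' : ∀ i, b i → w' i ∈ V)
    (h : ∀ c ∉ V, Nat.card {l // c + w l ∈ V} = Nat.card {l // c + w' l ∈ V}) :
    ∃ e : Equiv.Perm ι, (∀ i, b i → e i = i) ∧ ∀ i, w i - w' (e i) ∈ V := by
  obtain ⟨e, he, he'⟩ := exists_perm_of_card_fiber (f := fun i => (w i : k ⧸ V))
    (f' := fun i => (w' i : k ⧸ V)) b 0
    (fun i hi => (QuotientAddGroup.eq_zero_iff _).mpr (hw i hi))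
    (fun i hi => (QuotientAddGroup.eq_zero_iff _).mpr (hw' i hi)) (by
    intro c hc
    obtain ⟨c, rfl⟩ := QuotientAddGroup.mk_surjective c
    have h1 : ∀ w : ι → k, ∀ i, ((w i : k ⧸ V) = (c : k ⧸ V)) ↔ -c + w i ∈ V := fun w i => by
      rw [eq_comm, QuotientAddGroup.eq]
    have h2 : -c ∉ V := by
      rwa [neg_mem_iff, ← QuotientAddGroup.eq_zero_iff]
    simp only [h1]
    exact h _ h2)
  refine ⟨e, he, fun i => ?_⟩
  rw [← QuotientAddGroup.eq_iff_sub_mem]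
  exact (he' i).symm

/-- The version of `exists_perm_of_card` for weights `(u, -u)`: classes are compared up to sign. -/
theorem exists_perm_of_card_ham (hp : p ≠ 2) {m : ℕ} {b : Fin m → Prop} {V : AddSubgroup k}
    {u u' : Fin m → k} (hu : ∀ i, b i → u i ∈ V) (hu' : ∀ i, b i → u' i ∈ V)
    (h : ∀ c ∉ V, Nat.card {l // c + hamWeight u l ∈ V} = Nat.card {l // c + hamWeight u' l ∈ V}) :
    ∃ e : Equiv.Perm (Fin m), (∀ i, b i → e i = i) ∧
      ∀ i, u i - u' (e i) ∈ V ∨ u i + u' (e i) ∈ V := by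
  have hcls : ∀ (u : Fin m → k) (i : Fin m) (c : k),
      s((u i : k ⧸ V), -(u i : k ⧸ V)) = s((c : k ⧸ V), -(c : k ⧸ V)) ↔
        u i - c ∈ V ∨ u i + c ∈ V := by
    intro u i c
    rw [Sym2.eq_iff, ← QuotientAddGroup.eq_iff_sub_mem]
    have : u i + c = u i - -c := by ring
    rw [this, ← QuotientAddGroup.eq_iff_sub_mem]
    constructor
    · rintro (⟨h, -⟩ | ⟨h, -⟩)
      · exact Or.inl h
      · exact Or.inr h
    · rintro (h | h)
      · exact Or.inl ⟨h, by rw [h]⟩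
      · refine Or.inr ⟨h, ?_⟩
        rw [h]; exact neg_neg (c : k ⧸ V)
  have hcard : ∀ (u : Fin m → k) (c : k), c ∉ V →
      Nat.card {i // u i - c ∈ V ∨ u i + c ∈ V} = Nat.card {l // c + hamWeight u l ∈ V} := by
    intro u c hc
    -- Both together would give 2c in V, hence c in V because p is odd. So each index counts once,
    -- through exactly one of the weights u_i and -u_i.
    have h2 : ∀ i, ¬ (u i - c ∈ V ∧ u i + c ∈ V) := by
      rintro i ⟨h1, h2⟩
      have h3 := sub_mem h2 h1
      have h4 : u i + c - (u i - c) = 2 * c := by ring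
      rw [h4] at h3
      have hodd := ((Fact.out : p.Prime).eq_two_or_odd').resolve_left hp
      obtain ⟨q, hq⟩ := hodd
      have h5 := V.nsmul_mem h3 (q + 1)
      have h6 : (q + 1) • (2 * c) = c := by
        have : ((p : ℕ) : k) = 0 := CharP.cast_eq_zero k p
        rw [hq] at this
        push_cast at this
        rw [nsmul_eq_mul]
        push_cast
        linear_combination c * this
      rw [h6] at h5
      exact hc h5
    refine Nat.card_congr (Equiv.ofBijective
      (f := fun l : {l // c + hamWeight u l ∈ V} => (⟨Sum.elim id id l.1, ?_⟩ :
        {i // u i - c ∈ V ∨ u i + c ∈ V})) ⟨?_, ?_⟩).symm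
    · rcases l with ⟨l | l, hl⟩
      · right
        rw [add_comm]; exact hl
      · left
        rw [← neg_mem_iff]
        have : -(u l - c) = c + -u l := by ring
        rw [Sum.elim_inr, id, this]; exact hl
    · rintro ⟨l | l, hl⟩ ⟨l' | l', hl'⟩ h
      · have : l = l' := congrArg Subtype.val h
        subst this; rfl
      · exfalso
        have : l = l' := congrArg Subtype.val h
        subst this
        refine h2 l ⟨?_, ?_⟩
        · rw [← neg_mem_iff]
          have : -(u l - c) = c + -u l := by ring
          rw [this]; exact hl'
        · rw [add_comm]; exact hl
      · exfalso
        have : l = l' := congrArg Subtype.val h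
        subst this
        refine h2 l ⟨?_, ?_⟩
        · rw [← neg_mem_iff]
          have : -(u l - c) = c + -u l := by ring
          rw [this]; exact hl
        · rw [add_comm]; exact hl'
      · have : l = l' := congrArg Subtype.val h
        subst this; rfl
    · rintro ⟨i, hi | hi⟩
      · refine ⟨⟨Sum.inr i, ?_⟩, rfl⟩
        have : c + hamWeight u (Sum.inr i) = -(u i - c) := by
          simp only [hamWeight, Sum.elim_inr, Pi.neg_apply]; ring
        rw [this, neg_mem_iff]; exact hi
      · refine ⟨⟨Sum.inl i, ?_⟩, rfl⟩
        rw [add_comm]; exact hi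
  obtain ⟨e, he, he'⟩ := exists_perm_of_card_fiber (f := fun i => s((u i : k ⧸ V), -(u i : k ⧸ V)))
    (f' := fun i => s((u' i : k ⧸ V), -(u' i : k ⧸ V))) b s(0, -0)
    (fun i hi => by rw [(QuotientAddGroup.eq_zero_iff _).mpr (hu i hi)])
    (fun i hi => by rw [(QuotientAddGroup.eq_zero_iff _).mpr (hu' i hi)]) (by
    intro s hs
    -- Unordered pairs not of the form {c, -c} have empty fibres on both sides.
    by_cases hs' : ∃ c : k, s = s((c : k ⧸ V), -(c : k ⧸ V))
    · obtain ⟨c, rfl⟩ := hs'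
      have hc : c ∉ V := fun hc => hs (by rw [(QuotientAddGroup.eq_zero_iff c).mpr hc])
      simp only [hcls]
      rw [hcard u c hc, hcard u' c hc, h c hc]
    · have hempty : ∀ u : Fin m → k, IsEmpty {i // s((u i : k ⧸ V), -(u i : k ⧸ V)) = s} :=
        fun u => ⟨fun i => hs' ⟨u i, i.2.symm⟩⟩
      have := hempty u
      have := hempty u'
      rw [Nat.card_of_isEmpty, Nat.card_of_isEmpty])
  exact ⟨e, he, fun i => (hcls u i _).mp (he' i).symm⟩

end Permutation

/-! ### Conjugation of derivations by automorphisms of A. -/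

section Conjugation

variable {p : ℕ} {k : Type*} [Field k] [CharP k p] [Fact p.Prime] {ι : Type*}

/-- Conjugation `D ↦ ψ D ψ⁻¹` as a linear map. -/
noncomputable def conjLinear (ψ : TruncPoly p k ι ≃ₐ[k] TruncPoly p k ι) :
    Witt p k ι →ₗ[k] Witt p k ι where
  toFun D := Derivation.mk' (ψ.toLinearMap ∘ₗ D.toLinearMap ∘ₗ ψ.symm.toLinearMap) (by
    intro a b
    change ψ (D (ψ.symm (a * b))) = a • ψ (D (ψ.symm b)) + b • ψ (D (ψ.symm a))
    rw [map_mul, Derivation.leibniz, map_add, smul_eq_mul, smul_eq_mul, map_mul, map_mul,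
      AlgEquiv.apply_symm_apply, AlgEquiv.apply_symm_apply, smul_eq_mul, smul_eq_mul])
  map_add' D E := by
    ext a
    change ψ ((D + E) (ψ.symm a)) = ψ (D (ψ.symm a)) + ψ (E (ψ.symm a))
    rw [Derivation.add_apply, map_add]
  map_smul' c D := by
    ext a
    change ψ ((c • D) (ψ.symm a)) = c • ψ (D (ψ.symm a))
    rw [Derivation.smul_apply, map_smul]

theorem conjLinear_apply (ψ : TruncPoly p k ι ≃ₐ[k] TruncPoly p k ι) (D : Witt p k ι)
    (a : TruncPoly p k ι) : conjLinear ψ D a = ψ (D (ψ.symm a)) := rfl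

/-- Conjugation by an automorphism of `A`, as an automorphism of the Lie algebra `W`. -/
noncomputable def conj (ψ : TruncPoly p k ι ≃ₐ[k] TruncPoly p k ι) :
    Witt p k ι ≃ₗ⁅k⁆ Witt p k ι where
  __ := conjLinear ψ
  map_lie' := by
    intro D E
    ext a
    change ψ (⁅D, E⁆ (ψ.symm a)) = ⁅conjLinear ψ D, conjLinear ψ E⁆ a
    rw [Derivation.commutator_apply, Derivation.commutator_apply, map_sub, conjLinear_apply,
      conjLinear_apply, conjLinear_apply, conjLinear_apply, AlgEquiv.symm_apply_apply,
      AlgEquiv.symm_apply_apply]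
  invFun := conjLinear ψ.symm
  left_inv D := by
    ext a
    change ψ.symm (ψ (D (ψ.symm (ψ.symm.symm a)))) = D a
    rw [AlgEquiv.symm_apply_apply, AlgEquiv.symm_symm, AlgEquiv.symm_apply_apply]
  right_inv D := by
    ext a
    change ψ (ψ.symm (D (ψ.symm.symm (ψ.symm a)))) = D a
    rw [AlgEquiv.apply_symm_apply, AlgEquiv.symm_symm, AlgEquiv.apply_symm_apply]

theorem conj_apply (ψ : TruncPoly p k ι ≃ₐ[k] TruncPoly p k ι) (D : Witt p k ι)
    (a : TruncPoly p k ι) : conj ψ D a = ψ (D (ψ.symm a)) := rfl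

theorem conj_eq {ψ : TruncPoly p k ι ≃ₐ[k] TruncPoly p k ι} {D E : Witt p k ι}
    (h : ∀ f, E (ψ f) = ψ (D f)) : conj ψ D = E := by
  ext a
  rw [conj_apply, ← h, AlgEquiv.apply_symm_apply]

theorem conj_smul (ψ : TruncPoly p k ι ≃ₐ[k] TruncPoly p k ι) (f : TruncPoly p k ι)
    (D : Witt p k ι) : conj ψ (f • D) = ψ f • conj ψ D := by
  ext a
  rw [conj_apply, Derivation.smul_apply, Derivation.smul_apply, conj_apply, smul_eq_mul, map_mul,
    smul_eq_mul]

theorem intertwine {ψ : TruncPoly p k ι →ₐ[k] TruncPoly p k ι} {D E : Witt p k ι}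
    (h : ∀ i, D (ψ (x p k ι i)) = ψ (E (x p k ι i))) (f : TruncPoly p k ι) :
    D (ψ f) = ψ (E f) := by
  induction f using truncPoly_induction with
  | C c => rw [AlgHom.commutes, Derivation.map_algebraMap, Derivation.map_algebraMap, map_zero]
  | add f g hf hg => rw [map_add, map_add, map_add, map_add, hf, hg]
  | mul_x f i hf =>
    rw [map_mul, Derivation.leibniz, Derivation.leibniz, hf, h, smul_eq_mul, smul_eq_mul,
      smul_eq_mul, smul_eq_mul, map_add, map_mul, map_mul]

/-- The kernel lies in the maximal ideal and is stable under all ∂_i, hence is zero. Finite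
dimension gives surjectivity. -/
theorem bijective_of_partialD_stable [Finite ι] (ψ : TruncPoly p k ι →ₐ[k] TruncPoly p k ι)
    (h0 : ∀ i, aug p k ι (ψ (x p k ι i)) = 0)
    (h : ∀ f, ψ f = 0 → ∀ i, ψ (partialD p k ι i f) = 0) : Function.Bijective ψ := by
  have : Module.Finite k (TruncPoly p k ι) := finite_truncPoly
  have haug : ∀ f, aug p k ι (ψ f) = aug p k ι f := fun f =>
    algHom_ext_x (f := (aug p k ι).comp ψ) (g := aug p k ι) (fun i => by
      rw [AlgHom.comp_apply, h0, aug_x]) f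
  have hinj : Function.Injective ψ.toLinearMap := by
    rw [← LinearMap.ker_eq_bot, LinearMap.ker_eq_bot']
    intro f hf
    exact eq_zero_of_partialD_stable (K := {f | ψ f = 0}) (fun f hf i => h f hf i)
      (fun f hf => by rw [← haug, show ψ f = 0 from hf, map_zero]) hf
  exact ⟨hinj, LinearMap.injective_iff_surjective.mp hinj⟩

theorem finite_witt [Fintype ι] : Module.Finite k (Witt p k ι) := by
  have : Module.Finite k (TruncPoly p k ι) := finite_truncPoly
  let φ : Witt p k ι →ₗ[k] (ι → TruncPoly p k ι) :=
    { toFun := fun D i => D (x p k ι i)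
      map_add' := fun D E => rfl
      map_smul' := fun c D => rfl }
  exact Module.Finite.of_injective φ fun D E h => witt_ext p fun i => congrFun h i

theorem exists_lieEquiv_of_conj [Fintype ι] {L : LieSubalgebra k (Witt p k ι)}
    (ψ : TruncPoly p k ι ≃ₐ[k] TruncPoly p k ι) (h : ∀ D ∈ L, conj ψ D ∈ L) :
    ∃ g : L ≃ₗ⁅k⁆ L, ∀ D : L, (g D : Witt p k ι) = conj ψ D := by
  have : Module.Finite k (Witt p k ι) := finite_witt
  let f : L →ₗ⁅k⁆ L :=
    { toFun := fun D => ⟨conj ψ D, h D D.2⟩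
      map_add' := fun D E => Subtype.ext (map_add (conj ψ) (D : Witt p k ι) E)
      map_smul' := fun c D => Subtype.ext (map_smul (conj ψ) c (D : Witt p k ι))
      map_lie' := fun {D E} => Subtype.ext (LieEquiv.map_lie (conj ψ) (D : Witt p k ι) E) }
  have hinj : Function.Injective f := fun D E hDE =>
    Subtype.ext ((conj ψ).injective (congrArg Subtype.val hDE))
  have hfin : Module.Finite k L := inferInstanceAs (Module.Finite k L.toSubmodule)
  have hsurj : Function.Surjective f :=
    LinearMap.injective_iff_surjective (f := (f : L →ₗ[k] L)).mp hinj
  exact ⟨LieEquiv.ofBijective f ⟨hinj, hsurj⟩, fun D => rfl⟩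

end Conjugation

/-! ### Monomial substitutions and their action on weights. -/

section Exponents

variable {p : ℕ} {k : Type*} [Field k] [CharP k p] [Fact p.Prime] {ι : Type*} [Fintype ι]
  [DecidableEq ι] {b : ι → Prop} [DecidablePred b]

theorem exists_algHom_zc (y : ι → TruncPoly p k ι)
    (hy : ∀ i, aug p k ι (y i) = if b i then 1 else 0) :
    ∃ ψ : TruncPoly p k ι →ₐ[k] TruncPoly p k ι, (∀ i, aug p k ι (ψ (x p k ι i)) = 0) ∧
      (∀ i, ψ (zc p k b i) = y i) ∧ ∀ i, ∀ D : Witt p k ι, D (ψ (x p k ι i)) = D (y i) := by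
  have h : ∀ i, aug p k ι (y i - if b i then 1 else 0) = 0 := by
    intro i
    rw [map_sub, hy]
    split_ifs <;> simp
  obtain ⟨ψ, hψ⟩ := exists_algHom _ h
  refine ⟨ψ, fun i => by rw [hψ, h], fun i => ?_, fun i D => ?_⟩
  · rw [zc]
    split_ifs with hb
    · rw [map_add, map_one, hψ, if_pos hb, add_sub_cancel]
    · rw [hψ, if_neg hb, sub_zero]
  · rw [hψ, map_sub]
    split_ifs <;> simp

theorem intertwine_toral {ψ : TruncPoly p k ι →ₐ[k] TruncPoly p k ι} {y : ι → TruncPoly p k ι}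
    (hψ : ∀ i, ψ (zc p k b i) = y i)
    (hψD : ∀ i, ∀ D : Witt p k ι, D (ψ (x p k ι i)) = D (y i)) {u v : ι → k}
    (h : ∀ i, toral p k b u (y i) = v i • y i) (f : TruncPoly p k ι) :
    toral p k b u (ψ f) = ψ (toral p k b v f) :=
  intertwine (fun i => by rw [hψD, h, toral_x, map_smul, hψ]) f

theorem zmon_mul_zmon (a a' : ι → ℕ) : zmon p k b a * zmon p k b a' = zmon p k b (a + a') := by
  simp only [zmon, Pi.add_apply, pow_add, Finset.prod_mul_distrib]

theorem zmon_mul_inv {a : ι → ℕ} (ha : ∀ i, ¬ b i → a i = 0) :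
    zmon p k b a * zmon p k b ((p - 1) • a) = 1 := by
  have h1 : 1 ≤ p := (Fact.out : p.Prime).one_le
  have h2 : a + (p - 1) • a = p • a := by
    nth_rewrite 1 [← one_smul ℕ a]
    rw [← add_smul]; congr 1; omega
  have h3 : zmon p k b (p • a) = zmon p k b a ^ p := by
    simp only [zmon, Pi.smul_apply, smul_eq_mul, ← Finset.prod_pow, ← pow_mul, mul_comm]
  rw [zmon_mul_zmon, h2, h3, pow_p_eq, aug_zmon ha, one_pow, map_one]

/-- The effect on weights of the substitution `z_i ↦ z^{a_i}` (`b i`), `z_i ↦ x_{e i} z^{a_i}`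
(`¬ b i`). -/
def expWeight {k : Type*} [Field k] {ι : Type*} [Fintype ι] (b : ι → Prop) [DecidablePred b]
    (e : ι → ι) (a : ι → ι → ℕ) : (ι → k) →ₗ[k] (ι → k) where
  toFun u i := (if b i then 0 else u (e i)) + ∑ j, (a i j : k) * u j
  map_add' u v := by
    funext i
    simp only [Pi.add_apply, mul_add, Finset.sum_add_distrib]
    split_ifs <;> ring
  map_smul' c u := by
    funext i
    simp only [Pi.smul_apply, smul_eq_mul, RingHom.id_apply, mul_add, Finset.mul_sum]
    congr 1
    · split_ifs <;> simp
    · exact Finset.sum_congr rfl fun j _ => by ring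

theorem expWeight_apply (e : ι → ι) (a : ι → ι → ℕ) (u : ι → k) (i : ι) :
    expWeight b e a u i = (if b i then 0 else u (e i)) + ∑ j, (a i j : k) * u j := rfl

theorem zc_of_not {i : ι} (h : ¬ b i) : zc p k b i = x p k ι i := by rw [zc, if_neg h]

/-- The substitution intertwines T(χ u) with T(u) on generators, hence everywhere, where χ is the
map `expWeight`. Bijectivity follows from stability of the kernel under every ∂_i. For unshifted i
this uses the intertwining of ∂_i with a multiple of ∂_{e i}. -/
theorem exists_algEquiv_of_exponents (e : Equiv.Perm ι) (he : ∀ i, ¬ b i → ¬ b (e i))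
    (a : ι → ι → ℕ) (ha : ∀ i j, ¬ b j → a i j = 0)
    (hinj : Function.Injective (expWeight (k := k) b e a)) :
    ∃ ψ : TruncPoly p k ι ≃ₐ[k] TruncPoly p k ι,
      (∀ u, conj ψ (toral p k b (expWeight b e a u)) = toral p k b u) ∧
      (∀ i, ¬ b i → conj ψ (partialD p k ι i) =
        zmon p k b ((p - 1) • a i) • partialD p k ι (e i)) ∧
      ∀ i, b i → IsUnit (ψ (zc p k b i)) := by
  let y : ι → TruncPoly p k ι := fun i =>
    (if b i then 1 else x p k ι (e i)) * zmon p k b (a i)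
  have hyb : ∀ i, b i → y i = zmon p k b (a i) := fun i hi => by
    simp only [y, if_pos hi, one_mul]
  have hyn : ∀ i, ¬ b i → y i = x p k ι (e i) * zmon p k b (a i) := fun i hi => by
    simp only [y, if_neg hi]
  obtain ⟨ψ, h0, hψ, hψD⟩ := exists_algHom_zc (b := b) y fun i => by
    by_cases hi : b i
    · rw [hyb i hi, aug_zmon (ha i), if_pos hi]
    · rw [hyn i hi, map_mul, aug_x, zero_mul, if_neg hi]
  have hT : ∀ u f, toral p k b u (ψ f) = ψ (toral p k b (expWeight b e a u) f) := fun u =>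
    intertwine_toral hψ hψD fun i => by
      rw [expWeight_apply]
      by_cases hi : b i
      · rw [hyb i hi, if_pos hi, zero_add]; exact toral_zmon u (a i)
      · rw [hyn i hi, if_neg hi, ← zc_of_not (he i hi)]
        exact eigen_mul (toral_zc u (e i)) (toral_zmon u (a i))
  have hP : ∀ i, ¬ b i → ∀ f, (zmon p k b ((p - 1) • a i) • partialD p k ι (e i)) (ψ f) =
      ψ (partialD p k ι i f) := fun i hi => by
    refine intertwine fun j => ?_
    rw [hψD, Derivation.smul_apply, partialD_x]
    by_cases hj : b j
    · rw [hyb j hj, partialD_zmon_of_eq_zero (ha j _ (he i hi)), smul_zero,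
        if_neg (by rintro rfl; exact hi hj), map_zero]
    · rw [hyn j hj, Derivation.leibniz, partialD_zmon_of_eq_zero (ha j _ (he i hi)), smul_zero,
        zero_add, partialD_x]
      by_cases hij : j = i
      · rw [if_pos (congrArg e hij), if_pos hij, map_one, smul_eq_mul, smul_eq_mul, mul_one, hij,
          mul_comm, zmon_mul_inv (ha i)]
      · rw [if_neg (fun h => hij (e.injective h)), if_neg hij, map_zero, smul_zero, smul_zero]
  have hunit : ∀ i, b i → IsUnit (ψ (zc p k b i)) := fun i hi => by
    rw [hψ, hyb i hi]
    exact isUnit_of_aug (by rw [aug_zmon (ha i)]; exact one_ne_zero)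
  have hbij := bijective_of_partialD_stable ψ h0 fun f hf i => by
    by_cases hi : b i
    -- For shifted i, surjectivity of χ makes z_i ∂_i correspond to a toral derivation, and the
    -- factor z_i, mapped to a unit, can be cancelled.
    · obtain ⟨u, hu⟩ := LinearMap.injective_iff_surjective.mp hinj (Pi.single i 1)
      have h1 := hT u f
      rw [hf, map_zero, hu, toral_apply, Finset.sum_eq_single i (fun j _ hj => by
        rw [Pi.single_eq_of_ne hj, zero_smul]) (by simp), Pi.single_eq_same, one_smul, map_mul] at h1
      exact (hunit i hi).mul_right_eq_zero.mp h1.symm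
    · rw [← hP i hi, hf, map_zero]
  refine ⟨AlgEquiv.ofBijective ψ hbij, fun u => conj_eq fun f => hT u f,
    fun i hi => conj_eq fun f => hP i hi f, hunit⟩

end Exponents

/-! ### Substitutions compatible with the divergence. -/

section ExponentsSpecial

variable {p : ℕ} {k : Type*} [Field k] [CharP k p] [Fact p.Prime] {n : ℕ}
  {b : Fin n → Prop} [DecidablePred b]

theorem divergence_add (D E : Witt p k (Fin n)) :
    divergence p k (D + E) = divergence p k D + divergence p k E := by
  simp [divergence, Finset.sum_add_distrib]

theorem divergence_conj {ψ : TruncPoly p k (Fin n) ≃ₐ[k] TruncPoly p k (Fin n)}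
    (h : ∀ i, divergence p k (conj ψ (partialD p k (Fin n) i)) = 0) (D : Witt p k (Fin n)) :
    divergence p k (conj ψ D) = ψ (divergence p k D) := by
  have key : ∀ s : Finset (Fin n), ∀ f : Fin n → TruncPoly p k (Fin n),
      divergence p k (conj ψ (∑ i ∈ s, f i • partialD p k (Fin n) i)) =
        ψ (divergence p k (∑ i ∈ s, f i • partialD p k (Fin n) i)) := by
    intro s f
    induction s using Finset.induction_on with
    | empty => simp [divergence]
    | insert i s hi ih =>
      rw [Finset.sum_insert hi, map_add, divergence_add, divergence_add, map_add, ih, conj_smul,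
        divergence_smul, divergence_smul, h, divergence_partialD, mul_zero, mul_zero, zero_add,
        zero_add, conj_apply, AlgEquiv.symm_apply_apply]
  rw [witt_sum_smul_partialD D]
  exact key _ _

theorem algebraMap_sum_eq_of_conj {ψ : TruncPoly p k (Fin n) ≃ₐ[k] TruncPoly p k (Fin n)}
    {f : TruncPoly p k (Fin n)} {E : Witt p k (Fin n)} {v : Fin n → k}
    (h : conj ψ (f • E) = toral p k b v) :
    algebraMap k _ (∑ i, v i) = ψ f * divergence p k (conj ψ E) + ψ (E f) := by
  rw [← divergence_toral (b := b), ← h, conj_smul, divergence_smul, conj_apply,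
    AlgEquiv.symm_apply_apply]

theorem toral_single (i : Fin n) :
    toral p k b (Pi.single i 1) = zc p k b i • partialD p k (Fin n) i := by
  rw [toral, Fintype.linearCombination_apply_single, one_smul, eulerD_eq]

/-- It suffices that each conjugate of ∂_i has divergence zero. For shifted i, the conjugate of z_i
∂_i is T(u) with Σ u = 1, because χ preserves sums. Comparing divergences gives 1 = ψ(z_i)·div + 1,
and ψ(z_i) is a unit. -/
theorem conj_mem_special (e : Equiv.Perm (Fin n)) (he : ∀ i, ¬ b i → ¬ b (e i))
    {a : Fin n → Fin n → ℕ} (ha : ∀ i j, ¬ b j → a i j = 0)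
    (hinj : Function.Injective (expWeight (k := k) b e a))
    (hsum : ∀ u : Fin n → k, ∑ i, expWeight b e a u i = ∑ i, u i)
    {ψ : TruncPoly p k (Fin n) ≃ₐ[k] TruncPoly p k (Fin n)}
    (hT : ∀ u, conj ψ (toral p k b (expWeight b e a u)) = toral p k b u)
    (hP : ∀ i, ¬ b i → conj ψ (partialD p k (Fin n) i) =
        zmon p k b ((p - 1) • a i) • partialD p k (Fin n) (e i))
    (hunit : ∀ i, b i → IsUnit (ψ (zc p k b i))) :
    ∀ D ∈ derivedSubalgebra (specialFull p k n) 1,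
      conj ψ D ∈ derivedSubalgebra (specialFull p k n) 1 := by
  refine derivedSubalgebra_map_mem (conj ψ) fun D hD => ?_
  rw [mem_specialFull] at hD ⊢
  rw [divergence_conj (fun i => ?_), hD, map_zero]
  by_cases hi : b i
  · obtain ⟨u, hu⟩ := LinearMap.injective_iff_surjective.mp hinj (Pi.single i 1)
    have h1 := hT u
    rw [hu, toral_single] at h1
    have h3 := algebraMap_sum_eq_of_conj h1
    have h4 : ∑ i, u i = 1 := by
      rw [← hsum u, hu, Finset.sum_pi_single', if_pos (Finset.mem_univ _)]
    have h5 : partialD p k (Fin n) i (zc p k b i) = 1 := by rw [partialD_zc, if_pos rfl]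
    rw [h4, h5, map_one, map_one] at h3
    exact (hunit i hi).mul_right_eq_zero.mp (add_eq_right.mp h3.symm)
  · rw [hP i hi, divergence_smul, divergence_partialD, mul_zero, zero_add]
    refine partialD_zmon_of_eq_zero ?_
    rw [Pi.smul_apply, ha i _ (he i hi), smul_zero]

end ExponentsSpecial

/-! ### Substitutions preserving the Poisson bracket. -/

section ExponentsHamiltonian

variable {p : ℕ} {k : Type*} [Field k] [CharP k p] [Fact p.Prime] {m : ℕ}
  {b : Fin m ⊕ Fin m → Prop} [DecidablePred b]

theorem ham_x_x (i j : Fin m ⊕ Fin m) :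
    ham (x p k _ i) (x p k _ j) = if j = i.swap then algebraMap k _ (sgn k i) else 0 := by
  rw [ham_x_eq, Derivation.smul_apply, partialD_x]
  split_ifs
  · rw [smul_eq_algebraMap_mul, mul_one]
  · rw [smul_zero]

theorem mem_hamiltonianFull_of_lie {D : Witt p k (Fin m ⊕ Fin m)}
    (h : ∀ f, ⁅D, ham f⁆ = ham (D f)) : D ∈ hamiltonianFull p k m := by
  rw [mem_hamiltonianFull]
  intro i j
  have h1 := DFunLike.congr_fun (h (x p k _ i)) (x p k _ j)
  have h2 : D (ham (x p k _ i) (x p k _ j)) = 0 := by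
    rw [ham_x_x]; split_ifs
    · exact Derivation.map_algebraMap _ _
    · exact map_zero _
  have h3 : sgn k i • partialD p k _ i.swap (D (x p k _ j)) =
      sgn k j • partialD p k _ j.swap (D (x p k _ i)) := by
    rw [Derivation.commutator_apply, h2, ham_x, ham_x_eq, Derivation.smul_apply, sgn_swap, neg_smul,
      zero_sub, neg_inj] at h1
    exact h1
  calc sgn k i • partialD p k _ j.swap (D (x p k _ i))
      = (sgn k i * sgn k j) • (sgn k j • partialD p k _ j.swap (D (x p k _ i))) := by
        rw [smul_smul, mul_assoc, sgn_mul_self, mul_one]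
    _ = sgn k j • partialD p k _ i.swap (D (x p k _ j)) := by
        rw [← h3, smul_smul, mul_right_comm, sgn_mul_self, one_mul]

/-- An algebra endomorphism preserving the Poisson bracket of generators preserves the bracket. -/
theorem ham_algHom {ψ : TruncPoly p k (Fin m ⊕ Fin m) →ₐ[k] TruncPoly p k (Fin m ⊕ Fin m)}
    (h : ∀ i j, ham (ψ (x p k _ i)) (ψ (x p k _ j)) = ψ (ham (x p k _ i) (x p k _ j)))
    (f g : TruncPoly p k (Fin m ⊕ Fin m)) : ham (ψ f) (ψ g) = ψ (ham f g) := by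
  refine intertwine (fun j => ?_) g
  rw [ham_antisymm, ham_antisymm f, map_neg, intertwine (fun i => h j i)]

/-- Conjugation sends D_f to D_{ψ f}, and H(2m) consists of exactly those D with [D, D_f] = D_{D f}
for all f. -/
theorem conj_mem_ham {ψ : TruncPoly p k (Fin m ⊕ Fin m) ≃ₐ[k] TruncPoly p k (Fin m ⊕ Fin m)}
    (h : ∀ f g, ham (ψ f) (ψ g) = ψ (ham f g)) :
    ∀ D ∈ derivedSubalgebra (hamiltonianFull p k m) 2,
      conj ψ D ∈ derivedSubalgebra (hamiltonianFull p k m) 2 := by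
  have h1 : ∀ f, conj ψ (ham f) = ham (ψ f) := fun f => conj_eq fun g => h f g
  refine derivedSubalgebra_map_mem (conj ψ) fun D hD => mem_hamiltonianFull_of_lie fun f => ?_
  obtain ⟨f, rfl⟩ := ψ.surjective f
  rw [← h1, ← LieEquiv.map_lie, lie_ham hD, h1, conj_apply, AlgEquiv.symm_apply_apply]

theorem ham_eq_zero_of_zmon (hb : ∀ i, ¬ b (Sum.inr i)) {a a' : Fin m ⊕ Fin m → ℕ}
    (ha : ∀ i, ¬ b i → a i = 0) (ha' : ∀ i, ¬ b i → a' i = 0) :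
    ham (zmon p k b a) (zmon p k b a') = 0 := by
  rw [ham_apply]
  refine Finset.sum_eq_zero fun i _ => ?_
  rcases i with i | i
  · rw [Sum.swap_inl, partialD_zmon_of_eq_zero (ha' _ (hb i)), mul_zero, smul_zero]
  · rw [partialD_zmon_of_eq_zero (ha _ (hb i)), zero_mul, smul_zero]

theorem ham_x_zmon {a : Fin m ⊕ Fin m → ℕ} {l : Fin m ⊕ Fin m} (ha : a l.swap = 0) :
    ham (x p k _ l) (zmon p k b a) = 0 := by
  rw [ham_x_eq, Derivation.smul_apply, partialD_zmon_of_eq_zero ha, smul_zero]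

/-- The bracket of products of commuting factors. -/
theorem ham_mul_mul {f f' g g' : TruncPoly p k (Fin m ⊕ Fin m)} (h1 : ham f g' = 0)
    (h2 : ham f' g = 0) (h3 : ham f' g' = 0) :
    ham (f * f') (g * g') = f' * g' * ham f g := by
  rw [ham_mul_apply, Derivation.leibniz, Derivation.leibniz, h1, h2, h3]
  simp only [smul_eq_mul, mul_zero, zero_add, add_zero]
  ring

theorem hamWeight_swap (u : Fin m → k) (i : Fin m ⊕ Fin m) :
    hamWeight u i.swap = -hamWeight u i := by
  cases i <;> simp [hamWeight]

theorem ham_apply_hamToral (hb : ∀ i, ¬ b (Sum.inr i)) (u : Fin m → k)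
    (f : TruncPoly p k (Fin m ⊕ Fin m)) :
    ham f (hamToral p b u) = toral p k b (hamWeight u) f := by
  rw [ham_antisymm, ham_hamToral hb, Derivation.neg_apply, neg_neg]

/-- The effect on weights `(u, -u)` of the symplectic substitution given by the indices `κ i` and
the exponents `a i`. -/
def hamExpWeight {k : Type*} [Field k] {m : ℕ} (b : Fin m ⊕ Fin m → Prop) [DecidablePred b]
    (κ : Fin m → Fin m ⊕ Fin m) (a : Fin m → Fin m ⊕ Fin m → ℕ) : (Fin m → k) →ₗ[k] (Fin m → k) where
  toFun u i := (if b (Sum.inl i) then 0 else hamWeight u (κ i)) + ∑ j, (a i j : k) * hamWeight u j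
  map_add' u v := by
    have h : ∀ j, hamWeight (u + v) j = hamWeight u j + hamWeight v j := by
      rintro (j | j) <;> simp [hamWeight]; ring
    funext i
    simp only [Pi.add_apply, h, mul_add, Finset.sum_add_distrib]
    split_ifs <;> ring
  map_smul' c u := by
    have h : ∀ j, hamWeight (c • u) j = c * hamWeight u j := by
      rintro (j | j) <;> simp [hamWeight]
    funext i
    simp only [h, Pi.smul_apply, smul_eq_mul, RingHom.id_apply, mul_add, Finset.mul_sum]
    congr 1
    · split_ifs <;> simp
    · exact Finset.sum_congr rfl fun j _ => by ring

theorem hamExpWeight_apply (κ : Fin m → Fin m ⊕ Fin m) (a : Fin m → Fin m ⊕ Fin m → ℕ)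
    (u : Fin m → k) (i : Fin m) : hamExpWeight b κ a u i =
      (if b (Sum.inl i) then 0 else hamWeight u (κ i)) + ∑ j, (a i j : k) * hamWeight u j := rfl

/-- The images of the generators `z_i`, `i` in the first half. -/
noncomputable def hamSubstL (p : ℕ) (k : Type*) [Field k] {m : ℕ} (b : Fin m ⊕ Fin m → Prop)
    [DecidablePred b] (κ : Fin m → Fin m ⊕ Fin m) (a : Fin m → Fin m ⊕ Fin m → ℕ) (i : Fin m) :
    TruncPoly p k (Fin m ⊕ Fin m) :=
  (if b (Sum.inl i) then 1 else x p k _ (κ i)) * zmon p k b (a i)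

/-- The images of the generators `x_i`, `i` in the second half. -/
noncomputable def hamSubstR (p : ℕ) {k : Type*} [Field k] {m : ℕ} (b : Fin m ⊕ Fin m → Prop)
    [DecidablePred b] (κ : Fin m → Fin m ⊕ Fin m) (a : Fin m → Fin m ⊕ Fin m → ℕ)
    (c : Fin m → Fin m → k) (i : Fin m) : TruncPoly p k (Fin m ⊕ Fin m) :=
  (if b (Sum.inl i) then hamToral p b (c i) else sgn k (κ i) • x p k _ (κ i).swap) *
    zmon p k b ((p - 1) • a i)

section Substitution

variable {κ : Fin m → Fin m ⊕ Fin m} {a : Fin m → Fin m ⊕ Fin m → ℕ} {c : Fin m → Fin m → k}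

theorem toral_zmon_inv (w : Fin m ⊕ Fin m → k) (a : Fin m ⊕ Fin m → ℕ) :
    toral p k b w (zmon p k b ((p - 1) • a)) =
      (-∑ j, (a j : k) * w j) • zmon p k b ((p - 1) • a) := by
  have h1 : 1 ≤ p := (Fact.out : p.Prime).one_le
  rw [toral_zmon, ← Finset.sum_neg_distrib]
  congr 1
  refine Finset.sum_congr rfl fun j _ => ?_
  rw [Pi.smul_apply, smul_eq_mul, Nat.cast_mul, Nat.cast_sub h1, CharP.cast_eq_zero k p]
  push_cast; ring

theorem toral_hamSubstL (hκ : ∀ i, ¬ b (Sum.inl i) → ¬ b (κ i)) (u : Fin m → k) (i : Fin m) :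
    toral p k b (hamWeight u) (hamSubstL p k b κ a i) =
      hamExpWeight b κ a u i • hamSubstL p k b κ a i := by
  rw [hamSubstL, hamExpWeight_apply]
  split_ifs with hi
  · rw [one_mul, zero_add]; exact toral_zmon _ _
  · rw [← zc_of_not (hκ i hi)]
    exact eigen_mul (toral_zc _ _) (toral_zmon _ _)

theorem toral_hamSubstR (hb : ∀ i, ¬ b (Sum.inr i))
    (hκ' : ∀ i, ¬ b (Sum.inl i) → ¬ b (κ i).swap) (u : Fin m → k) (i : Fin m) :
    toral p k b (hamWeight u) (hamSubstR p b κ a c i) =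
      (-hamExpWeight b κ a u i) • hamSubstR p b κ a c i := by
  rw [hamSubstR, hamExpWeight_apply, neg_add]
  split_ifs with hi
  · refine eigen_mul ?_ (toral_zmon_inv _ _)
    rw [toral_hamWeight_hamToral hb, neg_zero, zero_smul]
  · refine eigen_mul ?_ (toral_zmon_inv _ _)
    rw [← zc_of_not (hκ' i hi), Derivation.map_smul, toral_zc, hamWeight_swap, smul_comm]

theorem ham_one (f : TruncPoly p k (Fin m ⊕ Fin m)) : ham 1 f = 0 := by
  rw [ham_antisymm, Derivation.map_one_eq_zero, neg_zero]

theorem ham_zmon_x {a : Fin m ⊕ Fin m → ℕ} {l : Fin m ⊕ Fin m} (ha : a l.swap = 0) :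
    ham (zmon p k b a) (x p k _ l) = 0 := by
  rw [ham_antisymm, ham_x_zmon ha, neg_zero]

theorem ham_hamSubstL_hamSubstL (hb : ∀ i, ¬ b (Sum.inr i)) (ha : ∀ i j, ¬ b j → a i j = 0)
    (hκ' : ∀ i, ¬ b (Sum.inl i) → ¬ b (κ i).swap)
    (hκκ : ∀ i j, ¬ b (Sum.inl i) → ¬ b (Sum.inl j) → κ j ≠ (κ i).swap) (i j : Fin m) :
    ham (hamSubstL p k b κ a i) (hamSubstL p k b κ a j) = 0 := by
  rw [hamSubstL, hamSubstL, ham_mul_mul _ _ (ham_eq_zero_of_zmon hb (ha i) (ha j))]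
  · split_ifs with hi hj hj
    · rw [ham_one, mul_zero]
    · rw [ham_one, mul_zero]
    · rw [Derivation.map_one_eq_zero, mul_zero]
    · rw [ham_x_x, if_neg (hκκ i j hi hj), mul_zero]
  · split_ifs with hi
    · exact ham_one _
    · exact ham_x_zmon (ha j _ (hκ' i hi))
  · split_ifs with hj
    · exact Derivation.map_one_eq_zero _
    · exact ham_zmon_x (ha i _ (hκ' j hj))

theorem smul_inv_supp (ha : ∀ i j, ¬ b j → a i j = 0) (i : Fin m) (j : Fin m ⊕ Fin m)
    (hj : ¬ b j) : ((p - 1) • a i) j = 0 := by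
  rw [Pi.smul_apply, ha i j hj, smul_zero]

/-- For shifted j, bracketing with `hamToral` of c_j is the action of T(c_j, -c_j). Its eigenvalue
on the i-th image is the i-th entry of χ(c_j), that is, δ_ij. The factor z^{-a_j} then normalizes
the bracket to 1. For unshifted j the sign in the second-half image does the same. -/
theorem ham_hamSubstL_hamSubstR (hb : ∀ i, ¬ b (Sum.inr i)) (ha : ∀ i j, ¬ b j → a i j = 0)
    (hκ : ∀ i, ¬ b (Sum.inl i) → ¬ b (κ i))
    (hκ' : ∀ i, ¬ b (Sum.inl i) → ¬ b (κ i).swap)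
    (hinj : ∀ i j, ¬ b (Sum.inl i) → ¬ b (Sum.inl j) → κ i = κ j → i = j)
    (hc : ∀ j, hamExpWeight b κ a (c j) = Pi.single j 1) (i j : Fin m) :
    ham (hamSubstL p k b κ a i) (hamSubstR p b κ a c j) = if i = j then 1 else 0 := by
  have hLz : ham (hamSubstL p k b κ a i) (zmon p k b ((p - 1) • a j)) = 0 := by
    rw [ham_antisymm, hamSubstL, Derivation.leibniz,
      ham_eq_zero_of_zmon hb (smul_inv_supp ha j) (ha i)]
    split_ifs with hi
    · rw [Derivation.map_one_eq_zero, smul_zero, smul_zero, add_zero, neg_zero]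
    · rw [ham_zmon_x (smul_inv_supp ha j _ (hκ' i hi)), smul_zero, smul_zero, add_zero, neg_zero]
  by_cases hj : b (Sum.inl j)
  · rw [hamSubstR, if_pos hj, Derivation.leibniz, hLz, smul_zero, zero_add, ham_apply_hamToral hb,
      toral_hamSubstL hκ, hc]
    split_ifs with hij
    · subst hij
      rw [Pi.single_eq_same, one_smul, hamSubstL, if_pos hj, one_mul, smul_eq_mul, mul_comm,
        zmon_mul_inv (ha i)]
    · rw [Pi.single_eq_of_ne hij, zero_smul, smul_zero]
  · rw [hamSubstR, if_neg hj, Derivation.leibniz, hLz, smul_zero, zero_add, Derivation.map_smul,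
      ham_antisymm, hamSubstL, Derivation.leibniz, ham_x_zmon (by
        rw [Sum.swap_swap]; exact ha i _ (hκ j hj)), smul_zero, zero_add]
    by_cases hi : b (Sum.inl i)
    · rw [if_pos hi, Derivation.map_one_eq_zero, if_neg (by rintro rfl; exact hj hi)]
      simp
    · rw [if_neg hi, ham_x_x, Sum.swap_swap]
      by_cases hij : i = j
      · subst hij
        rw [if_pos rfl, if_pos rfl, sgn_swap]
        have h1 : (algebraMap k (TruncPoly p k (Fin m ⊕ Fin m))) (sgn k (κ i)) *
            algebraMap k _ (sgn k (κ i)) = 1 := by rw [← map_mul, sgn_mul_self, map_one]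
        have h2 := zmon_mul_inv (p := p) (k := k) (ha i)
        rw [smul_eq_algebraMap_mul, smul_eq_mul, smul_eq_mul, map_neg]
        linear_combination (zmon p k b (a i) * zmon p k b ((p - 1) • a i)) * h1 + h2
      · rw [if_neg (fun h => hij (hinj i j hi hj h)), if_neg hij]
        simp

theorem ham_hamSubstR_hamSubstR (hb : ∀ i, ¬ b (Sum.inr i)) (ha : ∀ i j, ¬ b j → a i j = 0)
    (hκ : ∀ i, ¬ b (Sum.inl i) → ¬ b (κ i))
    (hκ' : ∀ i, ¬ b (Sum.inl i) → ¬ b (κ i).swap)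
    (hκκ : ∀ i j, ¬ b (Sum.inl i) → ¬ b (Sum.inl j) → κ j ≠ (κ i).swap)
    (hc : ∀ j, hamExpWeight b κ a (c j) = Pi.single j 1) {i j : Fin m} (hij : i ≠ j) :
    ham (hamSubstR p b κ a c i) (hamSubstR p b κ a c j) = 0 := by
  have hxz : ∀ i, ¬ b (Sum.inl i) → ∀ j, ham (hamSubstR p b κ a c i)
      (zmon p k b ((p - 1) • a j)) = 0 := fun i hi j => by
    rw [hamSubstR, if_neg hi, ham_mul_apply, map_smul, Derivation.smul_apply,
      ham_eq_zero_of_zmon hb (smul_inv_supp ha i) (smul_inv_supp ha j),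
      ham_x_zmon (by rw [Sum.swap_swap]; exact smul_inv_supp ha j _ (hκ i hi)), mul_zero, smul_zero,
      mul_zero, add_zero]
  have hR : ∀ i j, i ≠ j → b (Sum.inl j) →
      ham (hamSubstR p b κ a c i) (hamSubstR p b κ a c j) = 0 := by
    intro i j hij hj
    have h1 : ham (hamSubstR p b κ a c i) (hamToral p b (c j)) = 0 := by
      rw [ham_apply_hamToral hb, toral_hamSubstR hb hκ', hc, Pi.single_eq_of_ne hij, neg_zero,
        zero_smul]
    have h2 : ham (hamSubstR p b κ a c i) (zmon p k b ((p - 1) • a j)) = 0 := by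
      by_cases hi : b (Sum.inl i)
      · have h3 : ∑ l, (a j l : k) * hamWeight (c i) l = 0 := by
          have := congrFun (hc i) j
          rwa [hamExpWeight_apply, if_pos hj, zero_add, Pi.single_eq_of_ne hij.symm] at this
        rw [hamSubstR, if_pos hi, ham_mul_apply,
          ham_eq_zero_of_zmon hb (smul_inv_supp ha i) (smul_inv_supp ha j), mul_zero, zero_add,
          ham_hamToral hb, Derivation.neg_apply, toral_zmon_inv, h3, neg_zero, zero_smul, neg_zero,
          mul_zero]
      · exact hxz i hi j
    nth_rewrite 2 [hamSubstR]
    rw [if_pos hj, Derivation.leibniz, h1, h2, smul_zero, smul_zero, add_zero]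
  by_cases hj : b (Sum.inl j)
  · exact hR i j hij hj
  by_cases hi : b (Sum.inl i)
  · rw [ham_antisymm, hR j i hij.symm hi, neg_zero]
  · have h1 : ham (hamSubstR p b κ a c i) (x p k _ (κ j).swap) = 0 := by
      have h2 : (κ i).swap ≠ (κ j).swap.swap := by
        rw [Sum.swap_swap]; exact (hκκ i j hi hj).symm
      rw [ham_antisymm, hamSubstR, if_neg hi, Derivation.leibniz, ham_x_zmon (by
        rw [Sum.swap_swap]; exact smul_inv_supp ha i _ (hκ j hj)), Derivation.map_smul, ham_x_x,
        if_neg h2]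
      simp
    nth_rewrite 2 [hamSubstR]
    rw [if_neg hj, Derivation.leibniz, hxz i hi j, Derivation.map_smul, h1, smul_zero, smul_zero,
      smul_zero, add_zero]

theorem exists_algEquiv_of_ham_exponents (hp : p ≠ 2) (hb : ∀ i, ¬ b (Sum.inr i))
    (ha : ∀ i j, ¬ b j → a i j = 0) (hκ : ∀ i, ¬ b (Sum.inl i) → ¬ b (κ i))
    (hκ' : ∀ i, ¬ b (Sum.inl i) → ¬ b (κ i).swap)
    (hκκ : ∀ i j, ¬ b (Sum.inl i) → ¬ b (Sum.inl j) → κ j ≠ (κ i).swap)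
    (hinj : ∀ i j, ¬ b (Sum.inl i) → ¬ b (Sum.inl j) → κ i = κ j → i = j)
    (hχ : Function.Injective (hamExpWeight (k := k) b κ a)) :
    ∃ ψ : TruncPoly p k (Fin m ⊕ Fin m) ≃ₐ[k] TruncPoly p k (Fin m ⊕ Fin m),
      (∀ u, conj ψ (toral p k b (hamWeight (hamExpWeight b κ a u))) =
        toral p k b (hamWeight u)) ∧ ∀ f g, ham (ψ f) (ψ g) = ψ (ham f g) := by
  have hsurj := LinearMap.injective_iff_surjective.mp hχ
  -- The columns of the inverse of χ provide functions dual to the monomials z^{a_i}, which replace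
  -- the missing conjugate variables of the shifted indices.
  choose c hc using fun j : Fin m => hsurj (Pi.single j 1)
  let y : Fin m ⊕ Fin m → TruncPoly p k (Fin m ⊕ Fin m) :=
    Sum.elim (hamSubstL p k b κ a) (hamSubstR p b κ a c)
  obtain ⟨ψ, h0, hψ, hψD⟩ := exists_algHom_zc (b := b) y fun i => by
    rcases i with i | i
    · change aug p k _ (hamSubstL p k b κ a i) = _
      rw [hamSubstL, map_mul, aug_zmon (ha i), mul_one]
      split_ifs
      · exact map_one _
      · exact aug_x _
    · change aug p k _ (hamSubstR p b κ a c i) = _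
      rw [hamSubstR, map_mul, if_neg (hb i)]
      split_ifs
      · rw [aug_hamToral, zero_mul]
      · rw [map_smul, aug_x, smul_zero, zero_mul]
  have hT : ∀ u f, toral p k b (hamWeight u) (ψ f) =
      ψ (toral p k b (hamWeight (hamExpWeight b κ a u)) f) := fun u =>
    intertwine_toral hψ hψD fun i => by
      rcases i with i | i
      · exact toral_hamSubstL hκ u i
      · exact toral_hamSubstR hb hκ' u i
  have hgen : ∀ i j, ham (ψ (x p k _ i)) (ψ (x p k _ j)) = ψ (ham (x p k _ i) (x p k _ j)) := by
    intro i j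
    rw [hψD, ham_antisymm, hψD, ← ham_antisymm, ham_x_x]
    rcases i with i | i <;> rcases j with j | j
    · rw [if_neg (by simp), map_zero]
      exact ham_hamSubstL_hamSubstL hb ha hκ' hκκ i j
    · change ham (hamSubstL p k b κ a i) (hamSubstR p b κ a c j) = _
      rw [ham_hamSubstL_hamSubstR hb ha hκ hκ' hinj hc]
      by_cases h : i = j
      · simp [h, sgn]
      · rw [if_neg h, if_neg (by simpa using fun h' => h h'.symm), map_zero]
    · change ham (hamSubstR p b κ a c i) (hamSubstL p k b κ a j) = _
      rw [ham_antisymm, ham_hamSubstL_hamSubstR hb ha hκ hκ' hinj hc]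
      by_cases h : i = j
      · simp [h, sgn]
      · rw [if_neg (fun h' => h h'.symm), if_neg (by simpa using fun h' => h h'.symm), map_zero,
          neg_zero]
    · rw [if_neg (by simp), map_zero]
      change ham (hamSubstR p b κ a c i) (hamSubstR p b κ a c j) = 0
      by_cases h : i = j
      · rw [h]; exact ham_self _ hp
      · exact ham_hamSubstR_hamSubstR hb ha hκ hκ' hκκ hc h
  have hham := ham_algHom hgen
  have hbij := bijective_of_partialD_stable ψ h0 fun f hf i => by
    rw [partialD_eq_ham, Derivation.smul_apply, map_smul, ← hham, hf, map_zero, smul_zero]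
  exact ⟨AlgEquiv.ofBijective ψ hbij, fun u => conj_eq fun f => hT u f, fun f g => hham f g⟩

end Substitution

end ExponentsHamiltonian

/-! ### Independence over the prime field and invertibility of exponent matrices. -/

section Independence

variable {p : ℕ} {k : Type*} [Field k] [CharP k p] [Fact p.Prime] {ι : Type*} [Fintype ι]
  [DecidableEq ι] {b : ι → Prop} [DecidablePred b]

/-- The weights `w_i` with `b i` are linearly independent over the prime field. -/
def WeightIndependent {k : Type*} [Field k] {ι : Type*} [Fintype ι] (b : ι → Prop) (w : ι → k) :
    Prop :=
  ∀ a : ι → ℕ, (∀ i, ¬ b i → a i = 0) → ∑ i, (a i : k) * w i = 0 → ∀ i, (a i : k) = 0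

theorem WeightIndependent.ne_zero {w : ι → k} (h : WeightIndependent b w) {i : ι} (hi : b i) :
    w i ≠ 0 := by
  intro h0
  have := h (Pi.single i 1) (fun j hj => by
    rw [Pi.single_eq_of_ne]; rintro rfl; exact hj hi) (by
    rw [Finset.sum_eq_single i]
    · rw [h0, mul_zero]
    · intro j _ hj; rw [Pi.single_eq_of_ne hj, Nat.cast_zero, zero_mul]
    · simp) i
  rw [Pi.single_eq_same, Nat.cast_one] at this
  exact one_ne_zero this

theorem sum_eq_sum_subtype {a : ι → ℕ} (ha : ∀ j, ¬ b j → a j = 0) (u : ι → k) :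
    ∑ j, (a j : k) * u j = ∑ j : {j // b j}, (a j : k) * u j := by
  rw [← Finset.sum_subtype (Finset.univ.filter b) (by simp) fun j => (a j : k) * u j]
  refine (Finset.sum_filter_of_ne fun j _ hj => ?_).symm
  by_contra h
  exact hj (by rw [ha j h, Nat.cast_zero, zero_mul])

/-- An integral matrix transforming weights into independent weights is invertible modulo `p`. -/
theorem WeightIndependent.eq_zero_of_sum_eq_zero (p : ℕ) [CharP k p] [Fact p.Prime] {w w' : ι → k} (h : WeightIndependent b w)
    {a : ι → ι → ℕ} (ha : ∀ i j, ¬ b j → a i j = 0)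
    (hw : ∀ i, b i → w i = ∑ j, (a i j : k) * w' j) {u : ι → k}
    (hu : ∀ i, b i → ∑ j, (a i j : k) * u j = 0) {j : ι} (hj : b j) : u j = 0 := by
  let M : Matrix {i // b i} {i // b i} (ZMod p) := fun i j => (a i j : ZMod p)
  let φ : ZMod p →+* k := ZMod.castHom (dvd_refl p) k
  have hφ : ∀ v : ZMod p, ((v.val : ℕ) : k) = φ v := fun v => by
    rw [← map_natCast φ, ZMod.natCast_zmod_val]
  -- A left kernel vector over 𝔽_p would be a relation among the w_i. The determinant is thus
  -- nonzero over 𝔽_p and stays so in k.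
  have hM : M.det ≠ 0 := by
    intro h0
    obtain ⟨v, hv0, hv⟩ := Matrix.exists_vecMul_eq_zero_iff.mpr h0
    apply hv0
    let α : ι → ℕ := fun i => if hi : b i then (v ⟨i, hi⟩).val else 0
    have hα : ∀ i : {i // b i}, (α i : k) = φ (v i) := fun i => by
      simp only [α, i.2, dif_pos]; exact hφ _
    have hαb : ∀ i, ¬ b i → α i = 0 := fun i hi => by simp [α, hi]
    have h1 := h α hαb (by
      rw [sum_eq_sum_subtype hαb]
      calc ∑ i : {i // b i}, (α i : k) * w i
          = ∑ i : {i // b i}, ∑ j : {j // b j}, φ (v i) * ((a i j : k) * w' j) :=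
            Finset.sum_congr rfl fun i _ => by
              rw [hw i i.2, sum_eq_sum_subtype (ha i), Finset.mul_sum, hα]
        _ = ∑ j : {j // b j}, φ (Matrix.vecMul v M j) * w' j := by
            rw [Finset.sum_comm]
            refine Finset.sum_congr rfl fun j _ => ?_
            rw [Matrix.vecMul, dotProduct, map_sum, Finset.sum_mul]
            refine Finset.sum_congr rfl fun i _ => ?_
            rw [map_mul, map_natCast, mul_assoc]
        _ = 0 := by rw [hv]; simp)
    funext i
    have h2 := h1 i
    rw [hα] at h2
    exact φ.injective (by rw [h2]; simp)
  have hM' : (M.map φ).det ≠ 0 := by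
    intro h0
    rw [← RingHom.mapMatrix_apply, ← RingHom.map_det] at h0
    exact hM (φ.injective (by rw [h0, map_zero]))
  have := Matrix.eq_zero_of_mulVec_eq_zero hM' (v := fun j => u j) (by
    funext i
    have h1 := hu i i.2
    rw [sum_eq_sum_subtype (ha i)] at h1
    rw [Pi.zero_apply, ← h1]
    refine Finset.sum_congr rfl fun j _ => ?_
    change φ (a i j : ZMod p) * u j = _
    rw [map_natCast])
  exact congrFun this ⟨j, hj⟩

/-- The map is block triangular: the shifted block is invertible by assumption, and modulo shifted
weights the unshifted block is the permutation e. -/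
theorem expWeight_injective (e : Equiv.Perm ι) (he : ∀ i, b i → e i = i) {a : ι → ι → ℕ}
    (ha : ∀ i j, ¬ b j → a i j = 0)
    (h : ∀ u : ι → k, (∀ i, b i → ∑ j, (a i j : k) * u j = 0) → ∀ j, b j → u j = 0) :
    Function.Injective (expWeight (k := k) b e a) := by
  rw [injective_iff_map_eq_zero]
  intro u hu
  have h1 : ∀ j, b j → u j = 0 := h u fun i hi => by
    have := congrFun hu i
    rwa [expWeight_apply, if_pos hi, zero_add] at this
  funext j
  by_cases hj : b j
  · exact h1 j hj
  · have hj' : ¬ b (e.symm j) := fun hb => hj (by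
      have := he _ hb
      rw [Equiv.apply_symm_apply] at this
      rwa [this])
    have := congrFun hu (e.symm j)
    rw [expWeight_apply, if_neg hj', Equiv.apply_symm_apply, Finset.sum_eq_zero, add_zero] at this
    · exact this
    · intro i _
      by_cases hi : b i
      · rw [h1 i hi, mul_zero]
      · rw [ha _ i hi, Nat.cast_zero, zero_mul]

theorem not_apply_of_fix {e : Equiv.Perm ι} (he : ∀ i, b i → e i = i) {i : ι} (hi : ¬ b i) :
    ¬ b (e i) := fun h => hi (by
  have := e.injective (he _ h)
  rwa [this] at h)

theorem apply_iff_of_fix {e : Equiv.Perm ι} (he : ∀ i, b i → e i = i) (i : ι) :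
    b (e i) ↔ b i :=
  ⟨fun h => by by_contra hi; exact not_apply_of_fix he hi h, fun h => by rwa [he i h]⟩

/-- Changing the exponents at the unshifted index `l` so that the sum of weights is preserved. -/
def volumeExponents (p : ℕ) (b : ι → Prop) [DecidablePred b] (l : ι) (a : ι → ι → ℕ) (i j : ι) : ℕ :=
  if i = l then (if b j then 1 + (p - 1) * ∑ i ∈ Finset.univ.erase l, a i j else 0) else a i j

theorem volumeExponents_of_ne {l i : ι} (h : i ≠ l) (a : ι → ι → ℕ) :
    volumeExponents p b l a i = a i := by
  funext j; rw [volumeExponents, if_neg h]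

theorem volumeExponents_supp {l : ι} {a : ι → ι → ℕ} (ha : ∀ i j, ¬ b j → a i j = 0) (i j : ι)
    (hj : ¬ b j) : volumeExponents p b l a i j = 0 := by
  rw [volumeExponents, if_neg hj, ha i j hj, ite_self]

theorem sum_volumeExponents {l : ι} (a : ι → ι → ℕ) {j : ι} (hj : b j) :
    ∑ i, (volumeExponents p b l a i j : k) = 1 := by
  have h1 : 1 ≤ p := (Fact.out : p.Prime).one_le
  rw [← Finset.add_sum_erase _ _ (Finset.mem_univ l), volumeExponents, if_pos rfl, if_pos hj,
    Finset.sum_congr rfl fun i hi =>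
      (by rw [volumeExponents_of_ne (Finset.ne_of_mem_erase hi)] :
        (volumeExponents p b l a i j : k) = a i j)]
  push_cast [Nat.cast_sub h1, CharP.cast_eq_zero k p]
  ring

/-- Row l is chosen so that every shifted column sums to 1 modulo p (with p - 1 acting as -1), while
e permutes the unshifted weights. -/
theorem sum_expWeight {e : Equiv.Perm ι} (he : ∀ i, b i → e i = i) {l : ι} {a : ι → ι → ℕ}
    (ha : ∀ i j, ¬ b j → a i j = 0) (u : ι → k) :
    ∑ i, expWeight b e (volumeExponents p b l a) u i = ∑ i, u i := by
  simp only [expWeight_apply]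
  rw [Finset.sum_add_distrib, Finset.sum_comm]
  have h1 : ∑ i, (if b i then 0 else u (e i)) = ∑ i, (if b i then 0 else u i) := by
    rw [← Equiv.sum_comp e fun i => if b i then 0 else u i]
    exact Finset.sum_congr rfl fun i _ => by simp only [apply_iff_of_fix he]
  rw [h1, ← Finset.sum_add_distrib]
  refine Finset.sum_congr rfl fun j _ => ?_
  rw [← Finset.sum_mul]
  by_cases hj : b j
  · rw [sum_volumeExponents a hj, if_pos hj, zero_add, one_mul]
  · rw [if_neg hj, Finset.sum_eq_zero, zero_mul, add_zero]
    intro i _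
    rw [volumeExponents_supp ha i j hj, Nat.cast_zero]

/-- Exponents of the substitution which turns a relation `∑ a_i w_i = 0` with `a_{i₁} ≠ 0` into
the vanishing of the weight at `q`. -/
def relationExponents (q i₁ : ι) (a : ι → ℕ) (i : ι) : ι → ℕ :=
  if i = q then a else Pi.single (Equiv.swap q i₁ i) 1

theorem sum_relationExponents_of_ne {q i₁ : ι} {a : ι → ℕ} {i : ι} (hi : i ≠ q) (u : ι → k) :
    ∑ j, (relationExponents q i₁ a i j : k) * u j = u (Equiv.swap q i₁ i) := by
  rw [relationExponents, if_neg hi, Finset.sum_eq_single (Equiv.swap q i₁ i)]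
  · simp
  · intro j _ hj; rw [Pi.single_eq_of_ne hj, Nat.cast_zero, zero_mul]
  · simp

theorem swap_of_mem {q i₁ : ι} (hq : b q) (hi₁ : b i₁) (i : ι) :
    b (Equiv.swap q i₁ i) ↔ b i := by
  rw [Equiv.swap_apply_def]
  split_ifs with h1 h2
  · rw [h1]; tauto
  · rw [h2]; tauto
  · rfl

/-- The rows other than q are the unit vectors at all indices except i₁, so only u_{i₁} remains. Row
q then reads a_{i₁} u_{i₁} = 0. -/
theorem eq_zero_of_relationExponents {q i₁ : ι} {a : ι → ℕ} (hq : b q) (hi₁ : b i₁)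
    (ha₁ : (a i₁ : k) ≠ 0) (ha : ∀ i, ¬ b i → a i = 0) (u : ι → k)
    (hu : ∀ i, b i → ∑ j, (relationExponents q i₁ a i j : k) * u j = 0) (j : ι) (hj : b j) :
    u j = 0 := by
  have h1 : ∀ j, b j → j ≠ i₁ → u j = 0 := by
    intro j hj hj1
    have h2 : Equiv.swap q i₁ j ≠ q := by
      intro h
      apply hj1
      have h2 := congrArg (Equiv.swap q i₁) h
      rwa [Equiv.swap_apply_self, Equiv.swap_apply_left] at h2
    have h3 := hu _ ((swap_of_mem hq hi₁ j).mpr hj)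
    rwa [sum_relationExponents_of_ne h2, Equiv.swap_apply_self] at h3
  by_cases hj1 : j = i₁
  · have h3 := hu q hq
    rw [relationExponents, if_pos rfl, Finset.sum_eq_single i₁] at h3
    · rw [hj1]; exact (mul_eq_zero.mp h3).resolve_left ha₁
    · intro i _ hi
      by_cases hbi : b i
      · rw [h1 i hbi hi, mul_zero]
      · rw [ha i hbi, Nat.cast_zero, zero_mul]
    · simp
  · exact h1 j hj hj1

theorem relationExponents_supp {q i₁ : ι} {a : ι → ℕ} (ha : ∀ i, ¬ b i → a i = 0) (hq : b q)
    (hi₁ : b i₁) (i : ι) (hi : b i) (j : ι) (hj : ¬ b j) : relationExponents q i₁ a i j = 0 := by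
  rw [relationExponents]
  split_ifs
  · exact ha j hj
  · rw [Pi.single_eq_of_ne]
    rintro rfl
    exact hj ((swap_of_mem hq hi₁ i).mpr hi)

end Independence

/-! ### Explicit conjugations for types W and S. -/

section Moves

variable {p : ℕ} {k : Type*} [Field k] [CharP k p] [Fact p.Prime]

/-- If the shifted weights of `T(w)` are dependent, then `T(w)` is conjugate to some `T(v)` with
`v_q = 0`. -/
theorem exists_conj_of_dependent {ι : Type*} [Fintype ι] [DecidableEq ι] {b : ι → Prop}
    [DecidablePred b] {w : ι → k} (hw : ¬ WeightIndependent b w) {q : ι} (hq : b q) :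
    ∃ (ψ : TruncPoly p k ι ≃ₐ[k] TruncPoly p k ι) (v : ι → k), v q = 0 ∧
      conj ψ (toral p k b v) = toral p k b w := by
  simp only [WeightIndependent] at hw
  push Not at hw
  obtain ⟨a, ha, haw, i₁, hai⟩ := hw
  have hi₁ : b i₁ := by
    by_contra h; exact hai (by rw [ha i₁ h, Nat.cast_zero])
  let A : ι → ι → ℕ := fun i => if b i then relationExponents q i₁ a i else 0
  have hA : ∀ i, b i → A i = relationExponents q i₁ a i := fun i hi => if_pos hi
  have hAs : ∀ i j, ¬ b j → A i j = 0 := fun i j hj => by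
    by_cases hi : b i
    · rw [hA i hi]; exact relationExponents_supp ha hq hi₁ i hi j hj
    · simp only [A, if_neg hi]; rfl
  obtain ⟨ψ, hψ, -, -⟩ := exists_algEquiv_of_exponents (p := p) (k := k) (b := b) (Equiv.refl ι)
    (fun i hi => hi) A hAs (expWeight_injective _ (fun i _ => rfl) hAs fun u hu =>
      eq_zero_of_relationExponents hq hi₁ hai ha u fun i hi => by rw [← hA i hi]; exact hu i hi)
  refine ⟨ψ, _, ?_, hψ w⟩
  rw [expWeight_apply, if_pos hq, zero_add, hA q hq, relationExponents, if_pos rfl, haw]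

theorem exists_conj_of_dependent_special {n : ℕ} {b : Fin n → Prop} [DecidablePred b]
    {w : Fin n → k} (hw0 : ∑ i, w i = 0) (hw : ¬ WeightIndependent b w) {q : Fin n} (hq : b q)
    {l : Fin n} (hl : ¬ b l) :
    ∃ (ψ : TruncPoly p k (Fin n) ≃ₐ[k] TruncPoly p k (Fin n)) (v : Fin n → k), v q = 0 ∧
      ∑ i, v i = 0 ∧ conj ψ (toral p k b v) = toral p k b w ∧
      ∀ D ∈ derivedSubalgebra (specialFull p k n) 1,
        conj ψ D ∈ derivedSubalgebra (specialFull p k n) 1 := by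
  simp only [WeightIndependent] at hw
  push Not at hw
  obtain ⟨a, ha, haw, i₁, hai⟩ := hw
  have hi₁ : b i₁ := by
    by_contra h; exact hai (by rw [ha i₁ h, Nat.cast_zero])
  let A : Fin n → Fin n → ℕ := fun i => if b i then relationExponents q i₁ a i else 0
  have hA : ∀ i, b i → A i = relationExponents q i₁ a i := fun i hi => if_pos hi
  have hAs : ∀ i j, ¬ b j → A i j = 0 := fun i j hj => by
    by_cases hi : b i
    · rw [hA i hi]; exact relationExponents_supp ha hq hi₁ i hi j hj
    · simp only [A, if_neg hi]; rfl
  have hB : ∀ i, b i → volumeExponents p b l A i = relationExponents q i₁ a i := fun i hi => by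
    rw [volumeExponents_of_ne (by rintro rfl; exact hl hi), hA i hi]
  have hBs := volumeExponents_supp (p := p) (l := l) hAs
  have hinj := expWeight_injective (k := k) (Equiv.refl (Fin n)) (fun i _ => rfl) hBs fun u hu =>
      eq_zero_of_relationExponents hq hi₁ hai ha u fun i hi => by rw [← hB i hi]; exact hu i hi
  have hsum : ∀ u : Fin n → k, _ := fun u =>
    sum_expWeight (p := p) (e := Equiv.refl (Fin n)) (l := l) (fun i _ => rfl) hAs u
  obtain ⟨ψ, hT, hP, hU⟩ := exists_algEquiv_of_exponents (p := p) (k := k) (b := b)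
    (Equiv.refl (Fin n)) (fun i hi => hi) _ hBs hinj
  refine ⟨ψ, _, ?_, by rw [hsum w, hw0], hT w,
    conj_mem_special _ (fun i hi => hi) hBs hinj hsum hT hP hU⟩
  rw [expWeight_apply, if_pos hq, zero_add, hB q hq, relationExponents, if_pos rfl, haw]

theorem exists_conj_of_lieEquiv_witt {ι : Type*} [Fintype ι] [DecidableEq ι] {b : ι → Prop}
    [DecidablePred b] (hp : 3 ≤ p) (h1 : 1 ≤ Fintype.card ι) (h5 : Fintype.card ι = 1 → 5 ≤ p)
    {w w' : ι → k} {d d' : (⊤ : LieSubalgebra k (Witt p k ι))}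
    (hd : (d : Witt p k ι) = toral p k b w) (hd' : (d' : Witt p k ι) = toral p k b w')
    (hg : ∃ g : (⊤ : LieSubalgebra k (Witt p k ι)) ≃ₗ⁅k⁆ (⊤ : LieSubalgebra k (Witt p k ι)),
      g d = d')
    (hw : WeightIndependent b w) (hw' : WeightIndependent b w') :
    ∃ ψ : TruncPoly p k ι ≃ₐ[k] TruncPoly p k ι,
      (∀ u, ∃ v, conj ψ (toral p k b v) = toral p k b u) ∧
      conj ψ (toral p k b w) = toral p k b w' := by
  have hL := isotropy_invariant_witt (k := k) (ι := ι) hp h1 h5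
  have hE := hasEigenvectors_top (p := p) (b := b) w
  have hE' := hasEigenvectors_top (p := p) (b := b) w'
  have hV := weightGroup_eq_of_lieEquiv hL hd hd' hg (fun i hi => hw.ne_zero hi)
    (fun i hi => hw'.ne_zero hi) hE hE'
  have hmem : ∀ i, b i → w i ∈ weightGroup p b w' := fun i hi => hV ▸ weight_mem_weightGroup hi
  obtain ⟨e, he, hew⟩ := exists_perm_of_card (b := b) hmem
    (fun i hi => weight_mem_weightGroup hi)
    (fun c hc => card_eq_of_lieEquiv hL hd hd' hg hV hE hE' hc)
  have hex : ∀ i, w i - (if b i then 0 else w' (e i)) ∈ weightGroup p b w' := fun i => by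
    split_ifs with hi
    · rw [sub_zero]; exact hmem i hi
    · exact hew i
  choose a ha haw using hex
  have hχ : expWeight b e a w' = w := by
    funext i
    rw [expWeight_apply, ← haw i, add_sub_cancel]
  obtain ⟨ψ, hψ, -, -⟩ := exists_algEquiv_of_exponents (p := p) (k := k) (b := b) e
    (fun i hi => not_apply_of_fix he hi) a ha (expWeight_injective e he ha fun u hu j hj =>
      hw.eq_zero_of_sum_eq_zero p ha (fun i hi => by rw [← haw i, if_pos hi, sub_zero]) hu hj)
  exact ⟨ψ, fun u => ⟨_, hψ u⟩, by rw [← hψ w', hχ]⟩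

theorem exists_conj_of_lieEquiv_special {n : ℕ} {b : Fin n → Prop} [DecidablePred b] (hp : 3 ≤ p)
    (hn : 3 ≤ n) {l : Fin n} (hl : ¬ b l) {w w' : Fin n → k} (hw0 : ∑ i, w i = 0)
    (hw0' : ∑ i, w' i = 0) {d d' : derivedSubalgebra (specialFull p k n) 1}
    (hd : (d : Witt p k (Fin n)) = toral p k b w) (hd' : (d' : Witt p k (Fin n)) = toral p k b w')
    (hg : ∃ g : derivedSubalgebra (specialFull p k n) 1 ≃ₗ⁅k⁆ derivedSubalgebra (specialFull p k n) 1,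
      g d = d')
    (hw : WeightIndependent b w) (hw' : WeightIndependent b w') :
    ∃ ψ : TruncPoly p k (Fin n) ≃ₐ[k] TruncPoly p k (Fin n),
      (∀ u : Fin n → k, ∑ i, u i = 0 →
        ∃ v : Fin n → k, ∑ i, v i = 0 ∧ conj ψ (toral p k b v) = toral p k b u) ∧
      conj ψ (toral p k b w) = toral p k b w' ∧
      ∀ D ∈ derivedSubalgebra (specialFull p k n) 1,
        conj ψ D ∈ derivedSubalgebra (specialFull p k n) 1 := by
  have hL := isotropy_invariant_special (k := k) hp hn
  have hE := hasEigenvectors_special (b := b) (w := w) (hd ▸ d.2) hl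
  have hE' := hasEigenvectors_special (b := b) (w := w') (hd' ▸ d'.2) hl
  have hV := weightGroup_eq_of_lieEquiv hL hd hd' hg (fun i hi => hw.ne_zero hi)
    (fun i hi => hw'.ne_zero hi) hE hE'
  have hmem : ∀ i, b i → w i ∈ weightGroup p b w' := fun i hi => hV ▸ weight_mem_weightGroup hi
  obtain ⟨e, he, hew⟩ := exists_perm_of_card (b := b) hmem
    (fun i hi => weight_mem_weightGroup hi)
    (fun c hc => card_eq_of_lieEquiv hL hd hd' hg hV hE hE' hc)
  have hex : ∀ i, w i - (if b i then 0 else w' (e i)) ∈ weightGroup p b w' := fun i => by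
    split_ifs with hi
    · rw [sub_zero]; exact hmem i hi
    · exact hew i
  choose a ha haw using hex
  have hBs := volumeExponents_supp (p := p) (l := l) ha
  have hsum : ∀ u : Fin n → k, _ := fun u => sum_expWeight (p := p) (l := l) he ha u
  have hχne : ∀ i, i ≠ l → expWeight b e (volumeExponents p b l a) w' i = w i := fun i hi => by
    rw [expWeight_apply, volumeExponents_of_ne hi, ← haw i, add_sub_cancel]
  -- Changing row l leaves all other weights as prescribed. The weight at l then comes out right
  -- because both weight vectors sum to zero.
  have hχ : expWeight b e (volumeExponents p b l a) w' = w := by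
    funext i
    by_cases hi : i = l
    · have h1 := hsum w'
      rw [hw0', ← hw0, ← Finset.add_sum_erase _ _ (Finset.mem_univ l),
        ← Finset.add_sum_erase _ w (Finset.mem_univ l),
        Finset.sum_congr rfl fun i hi => hχne i (Finset.ne_of_mem_erase hi)] at h1
      rw [hi]; exact add_right_cancel h1
    · exact hχne i hi
  have hinj := expWeight_injective (k := k) e he hBs fun u hu j hj =>
    hw.eq_zero_of_sum_eq_zero p (w' := w') hBs (fun i hi => by
      have := congrFun hχ i
      rw [expWeight_apply, if_pos hi, zero_add] at this
      exact this.symm) hu hj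
  obtain ⟨ψ, hT, hP, hU⟩ := exists_algEquiv_of_exponents (p := p) (k := k) (b := b) e
    (fun i hi => not_apply_of_fix he hi) _ hBs hinj
  exact ⟨ψ, fun u hu => ⟨_, by rw [hsum, hu], hT u⟩, by rw [← hT w', hχ],
    conj_mem_special e (fun i hi => not_apply_of_fix he hi) hBs hinj hsum hT hP hU⟩

end Moves

/-! ### Explicit conjugations for type H. -/

section HamiltonianMoves

variable {p : ℕ} {k : Type*} [Field k] [CharP k p] [Fact p.Prime] {m : ℕ}
  {b : Fin m ⊕ Fin m → Prop} [DecidablePred b]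

theorem elim_swap (i : Fin m ⊕ Fin m) : Sum.elim id id i.swap = Sum.elim id id i := by
  cases i <;> rfl

theorem eq_inl_of_apply (hb : ∀ i, ¬ b (Sum.inr i)) {i : Fin m ⊕ Fin m} (hi : b i) :
    i = Sum.inl (Sum.elim id id i) := by
  rcases i with i | i
  · rfl
  · exact absurd hi (hb i)

theorem not_apply_of_elim (hb : ∀ i, ¬ b (Sum.inr i)) {i : Fin m ⊕ Fin m}
    (h : ¬ b (Sum.inl (Sum.elim id id i))) : ¬ b i := fun hi =>
  h (by rwa [← eq_inl_of_apply hb hi])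

theorem hamExpWeight_injective (hb : ∀ i, ¬ b (Sum.inr i)) {κ : Fin m → Fin m ⊕ Fin m}
    (e : Equiv.Perm (Fin m)) (he : ∀ i, b (Sum.inl i) → e i = i)
    (hκ : ∀ i, Sum.elim id id (κ i) = e i) {a : Fin m → Fin m ⊕ Fin m → ℕ}
    (ha : ∀ i j, ¬ b j → a i j = 0)
    (h : ∀ u : Fin m → k, (∀ i, b (Sum.inl i) → ∑ j, (a i j : k) * hamWeight u j = 0) →
      ∀ j, b (Sum.inl j) → u j = 0) :
    Function.Injective (hamExpWeight (k := k) b κ a) := by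
  rw [injective_iff_map_eq_zero]
  intro u hu
  have h1 : ∀ j, b (Sum.inl j) → u j = 0 := h u fun i hi => by
    have := congrFun hu i
    rwa [hamExpWeight_apply, if_pos hi, zero_add] at this
  funext j
  by_cases hj : b (Sum.inl j)
  · exact h1 j hj
  · have hj' : ¬ b (Sum.inl (e.symm j)) := fun hb => hj (by
      have := he _ hb
      rw [Equiv.apply_symm_apply] at this
      rwa [this])
    have h2 := congrFun hu (e.symm j)
    rw [hamExpWeight_apply, if_neg hj', Finset.sum_eq_zero, add_zero] at h2
    · have h3 := hκ (e.symm j)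
      rw [Equiv.apply_symm_apply] at h3
      rcases hk : κ (e.symm j) with i | i
      · rw [hk] at h2 h3
        have h4 : i = j := h3
        rw [← h4]; exact h2
      · rw [hk] at h2 h3
        have h4 : i = j := h3
        rw [← h4]; exact neg_eq_zero.mp h2
    · intro i _
      by_cases hi : b i
      · rcases i with i | i
        · have h4 : hamWeight u (Sum.inl i) = 0 := h1 i hi
          rw [h4, mul_zero]
        · exact absurd hi (hb i)
      · rw [ha _ i hi, Nat.cast_zero, zero_mul]

theorem exists_algEquiv_of_signed_perm (hp : p ≠ 2) (hb : ∀ i, ¬ b (Sum.inr i))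
    {κ : Fin m → Fin m ⊕ Fin m} (e : Equiv.Perm (Fin m)) (he : ∀ i, b (Sum.inl i) → e i = i)
    (hκ : ∀ i, Sum.elim id id (κ i) = e i) {a : Fin m → Fin m ⊕ Fin m → ℕ}
    (ha : ∀ i j, ¬ b j → a i j = 0)
    (h : ∀ u : Fin m → k, (∀ i, b (Sum.inl i) → ∑ j, (a i j : k) * hamWeight u j = 0) →
      ∀ j, b (Sum.inl j) → u j = 0) :
    ∃ ψ : TruncPoly p k (Fin m ⊕ Fin m) ≃ₐ[k] TruncPoly p k (Fin m ⊕ Fin m),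
      (∀ u, conj ψ (toral p k b (hamWeight (hamExpWeight b κ a u))) =
        toral p k b (hamWeight u)) ∧ ∀ D ∈ derivedSubalgebra (hamiltonianFull p k m) 2,
          conj ψ D ∈ derivedSubalgebra (hamiltonianFull p k m) 2 := by
  have hn : ∀ i, ¬ b (Sum.inl i) → ¬ b (Sum.inl (e i)) := fun i hi =>
    not_apply_of_fix (b := fun i => b (Sum.inl i)) he hi
  obtain ⟨ψ, h1, h2⟩ := exists_algEquiv_of_ham_exponents (p := p) (k := k) hp hb ha
    (κ := κ) (fun i hi => not_apply_of_elim hb (by rw [hκ]; exact hn i hi))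
    (fun i hi => not_apply_of_elim hb (by rw [elim_swap, hκ]; exact hn i hi))
    (fun i j _ _ hij => by
      have h3 := congrArg (Sum.elim id id) hij
      rw [elim_swap, hκ, hκ] at h3
      have h4 : j = i := e.injective h3
      rw [h4] at hij
      exact swap_ne _ hij.symm)
    (fun i j _ _ hij => by
      have h3 := congrArg (Sum.elim id id) hij
      rw [hκ, hκ] at h3
      exact e.injective h3)
    (hamExpWeight_injective hb e he hκ ha h)
  exact ⟨ψ, h1, conj_mem_ham h2⟩

theorem exists_conj_of_dependent_ham (hp : p ≠ 2) (hb : ∀ i, ¬ b (Sum.inr i)) {u : Fin m → k}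
    (hu : ¬ WeightIndependent b (hamWeight u)) {q : Fin m} (hq : b (Sum.inl q)) :
    ∃ (ψ : TruncPoly p k (Fin m ⊕ Fin m) ≃ₐ[k] TruncPoly p k (Fin m ⊕ Fin m)) (v : Fin m → k),
      v q = 0 ∧ conj ψ (toral p k b (hamWeight v)) = toral p k b (hamWeight u) ∧
      ∀ D ∈ derivedSubalgebra (hamiltonianFull p k m) 2,
        conj ψ D ∈ derivedSubalgebra (hamiltonianFull p k m) 2 := by
  simp only [WeightIndependent] at hu
  push Not at hu
  obtain ⟨a, ha, haw, i₁, hai⟩ := hu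
  have hi₁ : b i₁ := by
    by_contra h; exact hai (by rw [ha i₁ h, Nat.cast_zero])
  let A : Fin m → Fin m ⊕ Fin m → ℕ := fun i =>
    if b (Sum.inl i) then relationExponents (Sum.inl q) i₁ a (Sum.inl i) else 0
  have hA : ∀ i, b (Sum.inl i) → A i = relationExponents (Sum.inl q) i₁ a (Sum.inl i) :=
    fun i hi => if_pos hi
  have hAs : ∀ i j, ¬ b j → A i j = 0 := fun i j hj => by
    by_cases hi : b (Sum.inl i)
    · rw [hA i hi]; exact relationExponents_supp ha hq hi₁ _ hi j hj
    · simp only [A, if_neg hi]; rfl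
  obtain ⟨ψ, h1, h2⟩ := exists_algEquiv_of_signed_perm (p := p) (k := k) hp hb (κ := Sum.inl)
    (Equiv.refl _) (fun i _ => rfl) (fun i => rfl) hAs fun u hu j hj =>
      eq_zero_of_relationExponents hq hi₁ hai ha (hamWeight u) (fun i hi => by
        have h3 := eq_inl_of_apply hb hi
        rw [h3] at hi ⊢
        rw [← hA _ hi]; exact hu _ hi) (Sum.inl j) hj
  refine ⟨ψ, _, ?_, h1 u, h2⟩
  rw [hamExpWeight_apply, if_pos hq, zero_add, hA q hq, relationExponents, if_pos rfl, haw]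

theorem exists_conj_of_lieEquiv_ham (hp : 3 ≤ p) (hm : 1 ≤ m) (h5 : m = 1 → 5 ≤ p)
    (hb : ∀ i, ¬ b (Sum.inr i)) {u u' : Fin m → k}
    {d d' : derivedSubalgebra (hamiltonianFull p k m) 2}
    (hd : (d : Witt p k (Fin m ⊕ Fin m)) = toral p k b (hamWeight u))
    (hd' : (d' : Witt p k (Fin m ⊕ Fin m)) = toral p k b (hamWeight u'))
    (hg : ∃ g : derivedSubalgebra (hamiltonianFull p k m) 2 ≃ₗ⁅k⁆
      derivedSubalgebra (hamiltonianFull p k m) 2, g d = d')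
    (hu : WeightIndependent b (hamWeight u)) (hu' : WeightIndependent b (hamWeight u')) :
    ∃ ψ : TruncPoly p k (Fin m ⊕ Fin m) ≃ₐ[k] TruncPoly p k (Fin m ⊕ Fin m),
      (∀ u : Fin m → k, ∃ v : Fin m → k,
        conj ψ (toral p k b (hamWeight v)) = toral p k b (hamWeight u)) ∧
      conj ψ (toral p k b (hamWeight u)) = toral p k b (hamWeight u') ∧
      ∀ D ∈ derivedSubalgebra (hamiltonianFull p k m) 2,
        conj ψ D ∈ derivedSubalgebra (hamiltonianFull p k m) 2 := by
  classical
  have hL := isotropy_invariant_ham (k := k) hp hm h5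
  have hE := hasEigenvectors_ham (u := u) hb (hd ▸ d.2)
  have hE' := hasEigenvectors_ham (u := u') hb (hd' ▸ d'.2)
  have hV := weightGroup_eq_of_lieEquiv hL hd hd' hg (fun i hi => hu.ne_zero hi)
    (fun i hi => hu'.ne_zero hi) hE hE'
  set V := weightGroup p b (hamWeight u') with hVdef
  have hmem : ∀ i, b (Sum.inl i) → u i ∈ V := fun i hi =>
    hV ▸ weight_mem_weightGroup (w := hamWeight u) hi
  obtain ⟨e, he, hew⟩ := exists_perm_of_card_ham (p := p) (by omega) (b := fun i => b (Sum.inl i))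
    hmem (fun i hi => weight_mem_weightGroup (w := hamWeight u') hi)
    (fun c hc => card_eq_of_lieEquiv hL hd hd' hg hV hE hE' hc)
  -- The index κ i records the sign in the matching: u_i is congruent to the weight of x_{e i} or to
  -- that of its conjugate variable.
  let κ : Fin m → Fin m ⊕ Fin m := fun i =>
    if u i - u' (e i) ∈ V then Sum.inl (e i) else Sum.inr (e i)
  have hκ : ∀ i, Sum.elim id id (κ i) = e i := fun i => by
    simp only [κ]; split_ifs <;> rfl
  have hκV : ∀ i, u i - hamWeight u' (κ i) ∈ V := fun i => by
    simp only [κ]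
    split_ifs with h
    · exact h
    · have := (hew i).resolve_left h
      rwa [hamWeight, Sum.elim_inr, Pi.neg_apply, sub_neg_eq_add]
  have hex : ∀ i, u i - (if b (Sum.inl i) then 0 else hamWeight u' (κ i)) ∈ V := fun i => by
    split_ifs with hi
    · rw [sub_zero]; exact hmem i hi
    · exact hκV i
  choose a ha haw using hex
  have hχ : hamExpWeight b κ a u' = u := by
    funext i
    rw [hamExpWeight_apply, ← haw i, add_sub_cancel]
  obtain ⟨ψ, h1, h2⟩ := exists_algEquiv_of_signed_perm (p := p) (k := k) (by omega) hb e he hκ ha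
    fun v hv j hj => hu.eq_zero_of_sum_eq_zero p (w' := hamWeight u') (u := hamWeight v)
      (a := fun i => a (Sum.elim id id i)) (j := Sum.inl j) (fun i j hj => ha _ j hj) (fun i hi => by
        have h3 := eq_inl_of_apply hb hi
        rw [h3] at hi ⊢
        have := haw (Sum.elim id id i)
        rw [if_pos hi, sub_zero] at this
        exact this) (fun i hi => by
        have h3 := eq_inl_of_apply hb hi
        rw [h3] at hi
        exact hv _ hi) hj
  exact ⟨ψ, fun u => ⟨_, h1 u⟩, by rw [← h1 u', hχ], h2⟩

end HamiltonianMoves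

/-! ### Standard tori in terms of weights. -/

section Tori

variable {p : ℕ} {k : Type*} [Field k] [CharP k p] [Fact p.Prime]

theorem mem_torus_iff {c : Family} {r : ℕ} {D : c.algebra p k} : D ∈ c.torus p k r ↔
    (D : Witt p k c.Index) ∈ Submodule.span k (c.torusBasis p k r) := Iff.rfl

theorem mem_span_torusBasis_witt {n r : ℕ} {D : Witt p k (Fin n)} :
    D ∈ Submodule.span k ((Family.W n).torusBasis p k r) ↔
      ∃ u, D = toral p k (fun i : Fin n => (i : ℕ) < r) u := by
  have h1 : (Family.W n).torusBasis p k r =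
      Set.range fun i : Fin n => Family.eulerD p k ((i : ℕ) < r) i := by
    ext D
    exact ⟨fun ⟨i, hi⟩ => ⟨i, hi.symm⟩, fun ⟨i, hi⟩ => ⟨i, hi.symm⟩⟩
  rw [h1, ← Fintype.range_linearCombination]
  exact ⟨fun ⟨u, hu⟩ => ⟨u, hu.symm⟩, fun ⟨u, hu⟩ => ⟨u, hu.symm⟩⟩

theorem toral_single_eq {ι : Type*} [Fintype ι] [DecidableEq ι] {b : ι → Prop} [DecidablePred b]
    (i : ι) : toral p k b (Pi.single i 1) = Family.eulerD p k (b i) i := by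
  rw [toral, Fintype.linearCombination_apply_single, one_smul]

theorem eulerD_false {ι : Type*} {q : Prop} [Decidable q] (h : ¬ q) (i : ι) :
    Family.eulerD p k q i = Family.eulerD p k False i := by
  rw [Family.eulerD, Family.eulerD, if_neg h, if_neg not_false]

theorem mem_span_torusBasis_special {n r : ℕ} {l : Fin n} (hl : (l : ℕ) + 1 = n) (hr : r ≤ n - 1)
    {D : Witt p k (Fin n)} :
    D ∈ Submodule.span k ((Family.S n).torusBasis p k r) ↔
      ∃ u : Fin n → k, ∑ i, u i = 0 ∧ D = toral p k (fun i : Fin n => (i : ℕ) < r) u := by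
  have hl' : ¬ (l : ℕ) < r := by omega
  constructor
  · intro hD
    induction hD using Submodule.span_induction with
    | mem D hD =>
      obtain ⟨i, l', hl'', -, rfl⟩ := hD
      have : l' = l := Fin.ext (by omega)
      subst this
      refine ⟨Pi.single i 1 - Pi.single l' 1, by simp, ?_⟩
      rw [map_sub, toral_single_eq, toral_single_eq, eulerD_false hl']
    | zero => exact ⟨0, by simp, by rw [map_zero]⟩
    | add D E _ _ hD hE =>
      obtain ⟨u, hu, rfl⟩ := hD
      obtain ⟨v, hv, rfl⟩ := hE
      exact ⟨u + v, by simp [Finset.sum_add_distrib, hu, hv], by rw [map_add]⟩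
    | smul c D _ hD =>
      obtain ⟨u, hu, rfl⟩ := hD
      exact ⟨c • u, by simp [← Finset.mul_sum, hu], by rw [map_smul]⟩
  · rintro ⟨u, hu, rfl⟩
    -- Since Σ u_i = 0, subtracting the unit vector at l from each term changes nothing.
    have h1 : u = ∑ i, u i • (Pi.single i 1 - Pi.single l 1 : Fin n → k) := by
      simp only [smul_sub, Finset.sum_sub_distrib, ← Finset.sum_smul, hu, zero_smul, sub_zero]
      funext j
      simp [Finset.sum_apply, Pi.single_apply]
    rw [h1, map_sum]
    refine Submodule.sum_mem _ fun i _ => ?_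
    rw [map_smul]
    refine Submodule.smul_mem _ _ ?_
    by_cases hi : i = l
    · rw [hi, sub_self, map_zero]; exact Submodule.zero_mem _
    · refine Submodule.subset_span ⟨i, l, hl, hi, ?_⟩
      rw [map_sub, toral_single_eq, toral_single_eq, eulerD_false hl']

/-- The shifted indices of the `r`-th standard torus of type `H`. -/
def hamShift (m r : ℕ) : Fin m ⊕ Fin m → Prop := Sum.elim (fun i => (i : ℕ) < r) fun _ => False

instance (m r : ℕ) : DecidablePred (hamShift m r) := fun i => by
  cases i with
  | inl i => exact inferInstanceAs (Decidable ((i : ℕ) < r))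
  | inr i => exact inferInstanceAs (Decidable False)

theorem toral_hamWeight {m r : ℕ} (u : Fin m → k) : toral p k (hamShift m r) (hamWeight u) =
    ∑ i, u i • (Family.eulerD p k ((i : ℕ) < r) (Sum.inl i : Fin m ⊕ Fin m) -
      Family.eulerD p k False (Sum.inr i)) := by
  refine witt_ext p fun j => ?_
  rw [toral, Fintype.linearCombination_apply, Fintype.sum_sum_type, Derivation.add_apply,
    witt_sum_apply, witt_sum_apply, witt_sum_apply, ← Finset.sum_add_distrib]
  refine Finset.sum_congr rfl fun i _ => ?_
  rw [Derivation.smul_apply, Derivation.smul_apply, Derivation.smul_apply, Derivation.sub_apply,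
    smul_sub, sub_eq_add_neg]
  congr 1
  change (-u i) • _ = _
  rw [neg_smul]
  rfl

theorem mem_span_torusBasis_ham {m r : ℕ} {D : Witt p k (Fin m ⊕ Fin m)} :
    D ∈ Submodule.span k ((Family.H m).torusBasis p k r) ↔
      ∃ u, D = toral p k (hamShift m r) (hamWeight u) := by
  have h1 : (Family.H m).torusBasis p k r = Set.range fun i : Fin m =>
      Family.eulerD p k ((i : ℕ) < r) (Sum.inl i : Fin m ⊕ Fin m) -
        Family.eulerD p k False (Sum.inr i) := by
    ext D
    exact ⟨fun ⟨i, hi⟩ => ⟨i, hi.symm⟩, fun ⟨i, hi⟩ => ⟨i, hi.symm⟩⟩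
  rw [h1, ← Fintype.range_linearCombination]
  simp only [toral_hamWeight]
  exact ⟨fun ⟨u, hu⟩ => ⟨u, hu.symm⟩, fun ⟨u, hu⟩ => ⟨u, hu.symm⟩⟩

/-- A toral derivation is insensitive to shifting a variable whose weight vanishes. -/
theorem toral_congr {ι : Type*} [Fintype ι] {b b' : ι → Prop} [DecidablePred b] [DecidablePred b']
    {u : ι → k} (h : ∀ i, u i ≠ 0 → (b i ↔ b' i)) : toral p k b u = toral p k b' u := by
  rw [toral_eq, toral_eq]
  refine Finset.sum_congr rfl fun i _ => ?_
  by_cases hi : u i = 0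
  · rw [hi, zero_smul, zero_smul]
  · have : zc p k b i = zc p k b' i := by simp only [zc, h i hi]
    rw [this]

end Tori

/-! ### From conjugations to normalizing automorphisms and bounds on the index. -/

section Conclusion

variable {p : ℕ} {k : Type*} [Field k] [CharP k p] [Fact p.Prime] {c : Family} [Fintype c.Index]

theorem exists_inducedBy_of_conj {r : ℕ} {d t : c.algebra p k}
    (ψ : TruncPoly p k c.Index ≃ₐ[k] TruncPoly p k c.Index)
    (hψ : ∀ D ∈ c.algebra p k, conj ψ D ∈ c.algebra p k)
    (htor : ∀ D ∈ Submodule.span k (c.torusBasis p k r),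
      ∃ E ∈ Submodule.span k (c.torusBasis p k r), conj ψ E = D)
    (hdt : conj ψ (d : Witt p k c.Index) = t) :
    ∃ (ψ : TruncPoly p k c.Index ≃ₐ[k] TruncPoly p k c.Index) (g : c.Aut p k),
      c.IsInducedBy p k g ψ ∧ g ∈ c.normalizer p k (c.torus p k r) ∧ g d = t := by
  have hfin : Module.Finite k (Witt p k c.Index) := finite_witt
  have hfin' : Module.Finite k (c.algebra p k) :=
    inferInstanceAs (Module.Finite k (c.algebra p k).toSubmodule)
  obtain ⟨g, hg⟩ := exists_lieEquiv_of_conj ψ hψ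
  refine ⟨ψ, g, fun D a => by rw [hg]; rfl, ?_, Subtype.ext (by rw [hg, hdt])⟩
  let f : c.algebra p k →ₗ[k] c.algebra p k := (g : c.algebra p k →ₗ[k] c.algebra p k)
  have hle : c.torus p k r ≤ (c.torus p k r).map f := by
    intro D hD
    obtain ⟨E, hE, hED⟩ := htor D (mem_torus_iff.mp hD)
    have h1 : ((g.symm D : c.algebra p k) : Witt p k c.Index) = E := by
      refine (conj ψ).injective (?_ : conj ψ _ = conj ψ E)
      rw [hED, ← hg, LieEquiv.apply_symm_apply]
    refine ⟨g.symm D, ?_, LieEquiv.apply_symm_apply g D⟩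
    rw [SetLike.mem_coe, mem_torus_iff, h1]
    exact hE
  -- The torus lies in its image under g, whose dimension is no larger, so the two coincide.
  have heq := Submodule.eq_of_le_of_finrank_le hle (Submodule.finrank_map_le f _)
  change (g : c.algebra p k → c.algebra p k) '' _ = _
  conv_rhs => rw [heq]
  rfl

theorem index_le_of_conj {r : ℕ} (hr : r ≤ c.mu) {s : c.algebra p k}
    (ψ : TruncPoly p k c.Index ≃ₐ[k] TruncPoly p k c.Index)
    (hψ : ∀ D ∈ c.algebra p k, conj ψ D ∈ c.algebra p k) {E : Witt p k c.Index}
    (hE : E ∈ Submodule.span k (c.torusBasis p k r))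
    (hs : conj ψ E = s) : c.index p k s ≤ r := by
  obtain ⟨g, hg⟩ := exists_lieEquiv_of_conj ψ hψ
  refine Nat.sInf_le ⟨hr, g.symm, ?_⟩
  have h1 : ((g.symm s : c.algebra p k) : Witt p k c.Index) = E := by
    refine (conj ψ).injective (?_ : conj ψ _ = conj ψ E)
    rw [hs, ← hg, LieEquiv.apply_symm_apply]
  rw [mem_torus_iff, h1]
  exact hE

end Conclusion

/-! ### Index r forces independent shifted weights. -/

section Independent

variable {p : ℕ} {k : Type*} [Field k] [CharP k p] [Fact p.Prime]

theorem weightIndependent_of_no_shift {ι : Type*} [Fintype ι] {b : ι → Prop} (h : ∀ i, ¬ b i)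
    (w : ι → k) : WeightIndependent b w :=
  fun a ha _ i => by rw [ha i (h i), Nat.cast_zero]

/-- A dependency allows conjugation to a T(v) whose weight at the last shifted index, numbered r -
1, is zero. The shift there is then irrelevant, T(v) lies in the torus with r - 1 shifts, and the
index would be smaller than r. -/
theorem weightIndependent_witt {n r : ℕ} (hr : r ≤ n) {d : (Family.W n).algebra p k}
    (hd : (Family.W n).index p k d = r) {w : Fin n → k}
    (hw : (d : Witt p k (Fin n)) = toral p k (fun i : Fin n => (i : ℕ) < r) w) :
    WeightIndependent (fun i : Fin n => (i : ℕ) < r) w := by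
  rcases Nat.eq_zero_or_pos r with rfl | hr0
  · exact weightIndependent_of_no_shift (fun i => Nat.not_lt_zero _) w
  by_contra hdep
  obtain ⟨ψ, v, hv, hψ⟩ := exists_conj_of_dependent (p := p) hdep
    (q := ⟨r - 1, by omega⟩) (show r - 1 < r by omega)
  have := index_le_of_conj (c := Family.W n) (r := r - 1) (show r - 1 ≤ n by omega) (s := d) ψ
    (fun D _ => LieSubalgebra.mem_top _) (mem_span_torusBasis_witt.mpr ⟨v, rfl⟩) (by
      rw [hw, ← hψ]
      refine congrArg _ (toral_congr fun i hi => ?_)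
      have : (i : ℕ) ≠ r - 1 := fun h => hi (by rw [← hv]; congr 1; exact Fin.ext h)
      constructor <;> intro <;> omega)
  omega

theorem weightIndependent_special {n r : ℕ} (hr : r ≤ n - 1) {l : Fin n} (hl : (l : ℕ) + 1 = n)
    {d : (Family.S n).algebra p k} (hd : (Family.S n).index p k d = r) {w : Fin n → k}
    (hw0 : ∑ i, w i = 0)
    (hw : (d : Witt p k (Fin n)) = toral p k (fun i : Fin n => (i : ℕ) < r) w) :
    WeightIndependent (fun i : Fin n => (i : ℕ) < r) w := by
  rcases Nat.eq_zero_or_pos r with rfl | hr0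
  · exact weightIndependent_of_no_shift (fun i => Nat.not_lt_zero _) w
  by_contra hdep
  obtain ⟨ψ, v, hv, hv0, hψ, hψL⟩ := exists_conj_of_dependent_special (p := p) hw0 hdep
    (q := ⟨r - 1, by omega⟩) (show r - 1 < r by omega) (l := l) (show ¬ (l : ℕ) < r by omega)
  have := index_le_of_conj (c := Family.S n) (r := r - 1) (show r - 1 ≤ n - 1 by omega) (s := d) ψ
    hψL ((mem_span_torusBasis_special hl (by omega)).mpr ⟨v, hv0, rfl⟩) (by
      rw [hw, ← hψ]
      refine congrArg _ (toral_congr fun i hi => ?_)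
      have : (i : ℕ) ≠ r - 1 := fun h => hi (by rw [← hv]; congr 1; exact Fin.ext h)
      constructor <;> intro <;> omega)
  omega

theorem weightIndependent_ham (hp : p ≠ 2) {m r : ℕ} (hr : r ≤ m) {d : (Family.H m).algebra p k}
    (hd : (Family.H m).index p k d = r) {u : Fin m → k}
    (hu : (d : Witt p k (Fin m ⊕ Fin m)) = toral p k (hamShift m r) (hamWeight u)) :
    WeightIndependent (hamShift m r) (hamWeight u) := by
  rcases Nat.eq_zero_or_pos r with rfl | hr0
  · exact weightIndependent_of_no_shift
      (fun i => by cases i <;> simp [hamShift]) _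
  by_contra hdep
  obtain ⟨ψ, v, hv, hψ, hψL⟩ := exists_conj_of_dependent_ham (p := p) hp (fun i => id) hdep
    (q := ⟨r - 1, by omega⟩) (show r - 1 < r by omega)
  have := index_le_of_conj (c := Family.H m) (r := r - 1) (show r - 1 ≤ m by omega) (s := d) ψ
    hψL (mem_span_torusBasis_ham.mpr ⟨v, rfl⟩) (by
      rw [hu, ← hψ]
      refine congrArg _ (toral_congr fun i hi => ?_)
      rcases i with i | i
      · have : (i : ℕ) ≠ r - 1 := fun h => hi (by
          rw [← hv]; exact congrArg v (Fin.ext h))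
        change (i : ℕ) < r - 1 ↔ (i : ℕ) < r
        constructor <;> intro <;> omega
      · rfl)
  omega

end Independent

end CartanType

theorem lemma4p2 (p : ℕ) (hp : 3 ≤ p) (k : Type*) [Field k] [IsAlgClosed k] [CharP k p]
    (c : CartanType.Family) (hc : c.Admissible p) (r : ℕ) (hr : r ≤ c.mu)
    (d t : c.algebra p k) (hd : d ∈ c.torusIndexPart p k r) (ht : t ∈ c.torusIndexPart p k r)
    (hdt : ∃ g : c.Aut p k, g d = t) :
    ∃ (ψ : CartanType.TruncPoly p k c.Index ≃ₐ[k] CartanType.TruncPoly p k c.Index)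
      (g : c.Aut p k), c.IsInducedBy p k g ψ ∧ g ∈ c.normalizer p k (c.torus p k r) ∧
        g d = t := by
  open CartanType in
  have hprime : Fact p.Prime :=
    ⟨(CharP.char_is_prime_or_zero k p).resolve_right (by omega)⟩
  obtain ⟨hd1, -, hd2⟩ := hd
  obtain ⟨ht1, -, ht2⟩ := ht
  cases c with
  | W n =>
    obtain ⟨hn, h5⟩ := hc
    obtain ⟨w, hw⟩ := mem_span_torusBasis_witt.mp (mem_torus_iff.mp hd1)
    obtain ⟨w', hw'⟩ := mem_span_torusBasis_witt.mp (mem_torus_iff.mp ht1)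
    obtain ⟨ψ, h1, h2⟩ := exists_conj_of_lieEquiv_witt (k := k) hp (by simpa using hn)
      (by simpa using h5) hw hw' hdt (weightIndependent_witt hr hd2 hw)
      (weightIndependent_witt hr ht2 hw')
    refine exists_inducedBy_of_conj (c := Family.W n) ψ (fun D _ => LieSubalgebra.mem_top _)
      (fun D hD => ?_) (by rw [hw, h2, hw'])
    obtain ⟨u, rfl⟩ := mem_span_torusBasis_witt.mp hD
    obtain ⟨v, hv⟩ := h1 u
    exact ⟨_, mem_span_torusBasis_witt.mpr ⟨v, rfl⟩, hv⟩
  | S n =>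
    have hn : 3 ≤ n := hc
    have hl : ((⟨n - 1, by omega⟩ : Fin n) : ℕ) + 1 = n := by simp; omega
    have hr' : r ≤ n - 1 := hr
    obtain ⟨w, hw0, hw⟩ := (mem_span_torusBasis_special hl hr).mp (mem_torus_iff.mp hd1)
    obtain ⟨w', hw0', hw'⟩ := (mem_span_torusBasis_special hl hr).mp (mem_torus_iff.mp ht1)
    obtain ⟨ψ, h1, h2, h3⟩ := exists_conj_of_lieEquiv_special (k := k) hp hn
      (l := ⟨n - 1, by omega⟩) (show ¬ n - 1 < r by omega) hw0 hw0' hw hw' hdt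
      (weightIndependent_special hr hl hd2 hw0 hw) (weightIndependent_special hr hl ht2 hw0' hw')
    refine exists_inducedBy_of_conj (c := Family.S n) ψ h3 (fun D hD => ?_) (by rw [hw, h2, hw'])
    obtain ⟨u, hu, rfl⟩ := (mem_span_torusBasis_special hl hr).mp hD
    obtain ⟨v, hv0, hv⟩ := h1 u hu
    exact ⟨_, (mem_span_torusBasis_special hl hr).mpr ⟨v, hv0, rfl⟩, hv⟩
  | H m =>
    obtain ⟨hm, h5⟩ := hc
    obtain ⟨w, hw⟩ := mem_span_torusBasis_ham.mp (mem_torus_iff.mp hd1)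
    obtain ⟨w', hw'⟩ := mem_span_torusBasis_ham.mp (mem_torus_iff.mp ht1)
    obtain ⟨ψ, h1, h2, h3⟩ := exists_conj_of_lieEquiv_ham (k := k) hp hm h5 (fun i => id) hw hw' hdt
      (weightIndependent_ham (by omega) hr hd2 hw) (weightIndependent_ham (by omega) hr ht2 hw')
    refine exists_inducedBy_of_conj (c := Family.H m) ψ h3 (fun D hD => ?_) (by rw [hw, h2, hw'])
    obtain ⟨u, rfl⟩ := mem_span_torusBasis_ham.mp hD
    obtain ⟨v, hv⟩ := h1 u
    exact ⟨_, mem_span_torusBasis_ham.mpr ⟨v, rfl⟩, hv⟩
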